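/- Let $\vec i,\vec j,\vec k$ be the standard basis of $\mathbb{R}^3$, $Ry=\vec k\times y$, so that $e^{\theta R}$ is the rotation by the angle $\theta$ about the vertical axis. Let $L^2=L^2((0,\infty),r\,dr)$ be the space of complex-valued functions. A map $u:\mathbb{R}^2\to\mathbb{S}^2\subset\mathbb{R}^3$ is 1-equivariant with profile $\bar u$ if $u(r,\theta)=e^{\theta R}\bar u(r)$ in polar coordinates (almost everywhere). A normalized Coulomb gauge for $u$ is a pair $\bar v,\bar w:(0,\infty)\to\mathbb{R}^3$ such that, for all $r>0$, $|\bar v|=1$, $\bar v\cdot\bar u=0$, $\bar w=\bar u\times\bar v$, with $\partial_r\bar v\cdot\bar w=0$ for almost every $r>0$, and $$\lim_{r\to\infty}\bar v(r)=\vec i,\qquad \lim_{r\to\infty}\bar w(r)=-\vec j ;$$ here $\bar u,\bar v,\bar w$ are locally absolutely continuous on $(0,\infty)$ and $|\bar u|=1$. Put $\bar{\mathcal W}^-=\partial_r\bar u-\frac1r\,\bar u\times R\bar u$. We say that $\psi^-\in L^2$ represents $\mathcal W^-$ for the map $u$ if $u$ is 1-equivariant and has a normalized Coulomb gauge $(\bar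 v,\bar w)$ such that $\psi^-=\bar{\mathcal W}^-\cdot\bar v+i\,\bar{\mathcal W}^-\cdot\bar w$ almost everywhere. Let $E(u)=\frac12\int_{\mathbb{R}^2}|\nabla u|^2\,dx$ and $\|f\|_{\dot H^1}=\|\nabla f\|_{L^2(\mathbb{R}^2)}$, with weak gradients. Then: (i) For every $\psi^-\in L^2$ with $\|\psi^-\|_{L^2}<2\sqrt2$ there is a map $u:\mathbb{R}^2\to\mathbb{S}^2$, unique up to sets of measure zero, such that $\psi^-$ represents $\mathcal W^-$ for $u$. This map has finite energy, $E(u)=\pi\|\psi^-\|_{L^2}^2$. (ii) The map $\psi^-\mapsto u$ is Lipschitz in the following sense: for every $M<2\sqrt2$ there is a constant $C=C(M)$ such that, if $\|\psi^-\|_{L^2},\|\tilde\psi^-\|_{L^2}\le M$ and $u,\tilde u$ are the corresponding maps, then $$\|u-\tilde u\|_{\dot H^1}\le C\,\|\psi^--\tilde\psi^-\|_{L^2}.$$ -/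

import Mathlib

open MeasureTheory Set Filter Topology
open scoped ENNReal NNReal

noncomputable section

namespace EquivariantMap

/-- The domain `ℝ²`, with Euclidean norm and Lebesgue measure. -/
abbrev Plane : Type := EuclideanSpace ℝ (Fin 2)

/-- The ambient space `ℝ³` of the target sphere. -/
abbrev Space : Type := EuclideanSpace ℝ (Fin 3)

/-- The target `S² ⊂ ℝ³`. -/
abbrev Sphere2 : Type := Metric.sphere (0 : Space) 1

/-- The standard basis vectors of `ℝ³`. -/
def vecI : Space := !₂[1, 0, 0]
def vecJ : Space := !₂[0, 1, 0]
def vecK : Space := !₂[0, 0, 1]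

/-- The vector product of `ℝ³`. -/
def cross (a b : Space) : Space :=
  WithLp.toLp 2 (crossProduct (WithLp.ofLp a) (WithLp.ofLp b))

/-- The generator of horizontal rotations, `R y = k × y`. -/
def genR (y : Space) : Space := cross vecK y

/-- The horizontal rotation `e^{θR}` by the angle `θ`. -/
def rotR (θ : ℝ) (y : Space) : Space :=
  !₂[Real.cos θ * y 0 - Real.sin θ * y 1, Real.sin θ * y 0 + Real.cos θ * y 1, y 2]

/-- The measure `r dr` on `(0, ∞)`. -/
def radialMeasure : Measure ℝ :=
  (volume.restrict (Ioi (0 : ℝ))).withDensity (fun r => ENNReal.ofReal r)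

/-- The complex space `L²((0, ∞), r dr)`. -/
abbrev RadialL2 : Type := Lp ℂ 2 radialMeasure

/-- `G = (G 0, G 1)` is the weak (distributional) gradient of `f : ℝ² → ℝ³`: the `G j` are
locally integrable, and `∫ ∂_j φ f = - ∫ φ G_j` for every real test function `φ ∈ C_c^∞(ℝ²)`. -/
structure IsWeakGradient (f : Plane → Space) (G : Fin 2 → Plane → Space) : Prop where
  locallyIntegrable : LocallyIntegrable f volume
  locallyIntegrable_grad : ∀ j, LocallyIntegrable (G j) volume
  integral_eq : ∀ (j : Fin 2) (φ : Plane → ℝ),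
    ContDiff ℝ ((⊤ : ℕ∞) : WithTop ℕ∞) φ → HasCompactSupport φ →
      ∫ x, (fderiv ℝ φ x (EuclideanSpace.single j 1)) • f x = - ∫ x, φ x • G j x

/-- The Dirichlet integral `∫_{ℝ²} |∇f|² dx ∈ [0, ∞]`, where `∇f` is the weak gradient and `|∇f|`
its Euclidean (Hilbert-Schmidt) norm. The weak gradient is unique up to null sets, so the infimum
is over a single value; it is `∞` if there is no weak gradient. -/
def dirichlet (f : Plane → Space) : ℝ≥0∞ :=
  ⨅ (G : Fin 2 → Plane → Space) (_ : IsWeakGradient f G), ∫⁻ x, ∑ j, ‖G j x‖ₑ ^ 2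

/-- The energy `E(u) = (1/2) ∫_{ℝ²} |∇u|² dx`. -/
def energy (u : Plane → Sphere2) : ℝ≥0∞ :=
  2⁻¹ * dirichlet (fun x => (u x : Space))

/-- The homogeneous Sobolev norm `‖f‖ = ‖∇f‖_{L²(ℝ²)}` of `Ḣ¹`. -/
def homogNorm (f : Plane → Space) : ℝ≥0∞ :=
  dirichlet f ^ (1 / 2 : ℝ)

/-- Absolute continuity on every compact subinterval of `(0, ∞)`. -/
def LocallyAC (f : ℝ → Space) : Prop :=
  ∀ a b : ℝ, 0 < a → a ≤ b → AbsolutelyContinuousOnInterval f a b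

/-- `u` is 1-equivariant with radial profile `ubar`: almost everywhere, in polar coordinates,
`u(r, θ) = e^{θR} ubar(r)`. -/
def IsEquivariant (u : Plane → Sphere2) (ubar : ℝ → Space) : Prop :=
  ∀ᵐ x : Plane, ∀ r θ : ℝ, 0 < r → x = !₂[r * Real.cos θ, r * Real.sin θ] →
    (u x : Space) = rotR θ (ubar r)

/-- `(v, w)` is (the radial profile of) a 1-equivariant orthonormal frame of `u^* T S²`, oriented
by `w = u × v`, which is a Coulomb gauge, `∂_r v · w = 0`, and is normalized at infinity by
`v → i`, `w → -j`. -/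
structure IsNormalizedCoulombFrame (ubar v w : ℝ → Space) : Prop where
  locallyAC_u : LocallyAC ubar
  locallyAC_v : LocallyAC v
  locallyAC_w : LocallyAC w
  norm_u : ∀ r, 0 < r → ‖ubar r‖ = 1
  norm_v : ∀ r, 0 < r → ‖v r‖ = 1
  inner_v_u : ∀ r, 0 < r → inner ℝ (v r) (ubar r) = 0
  w_eq : ∀ r, 0 < r → w r = cross (ubar r) (v r)
  coulomb : ∀ᵐ r ∂(volume.restrict (Ioi (0 : ℝ))), inner ℝ (deriv v r) (w r) = 0
  tendsto_v : Tendsto v atTop (𝓝 vecI)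
  tendsto_w : Tendsto w atTop (𝓝 (-vecJ))

/-- The radial profile of the vector field `W⁻ = ∂_r u - (1/r) u × R u ∈ T_u S²`. -/
def fieldWMinus (ubar : ℝ → Space) (r : ℝ) : Space :=
  deriv ubar r - r⁻¹ • cross (ubar r) (genR (ubar r))

/-- The complex coordinate `W · v + i W · w` of a tangent vector `W` in the frame `(v, w)`. -/
def frameCoord (W v w : Space) : ℂ :=
  (inner ℝ W v : ℝ) + (inner ℝ W w : ℝ) * Complex.I

/-- `u` is a 1-equivariant map for which `ψ` is the representation of the field `W⁻` relative to
a Coulomb gauge normalized at infinity. -/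
def Represents (ψ : RadialL2) (u : Plane → Sphere2) : Prop :=
  ∃ ubar v w : ℝ → Space, IsEquivariant u ubar ∧ IsNormalizedCoulombFrame ubar v w ∧
    ∀ᵐ r ∂radialMeasure, ψ r = frameCoord (fieldWMinus ubar r) (v r) (w r)

end EquivariantMap

end

open EquivariantMap

/-!
The proof describes a 1-equivariant map by one complex function. For a normalized Coulomb frame
`(v, w)` of a map with profile `u`, the equations of the moving frame are `u' = q₁ v + q₂ w`,
`v' = -q₁ u`, `w' = -q₂ u` with `q = ψ + (v₃ + i w₃) / r` (`frame_equations`). The stereographic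
coordinate `z = (v₃ + i w₃) / (1 - u₃)` then solves the Riccati equation

  `z' = z / r + (ψ + ψ̄ z²) / 2`,   `z → 0` at infinity,

which involves `ψ` alone (`IsRiccati`). Conversely `z` determines the frame: up to explicit
algebraic expressions in `z`, all of `u`, `v`, `w` are given by the horizontal part `N` of `v + i w`,
and `N` solves the linear equation `N' = -q z̄ N`, `N → 2` at infinity, hence is an exponential of an
integral (`gaugeFactor`). So maps represented by `ψ` correspond to decaying solutions of the Riccati
equation (`IsRiccati.isNormalizedCoulombFrame`, `IsNormalizedCoulombFrame.exists_isRiccati`).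

The threshold `2√2` comes from the height `u₃ + 1` above the pole `-k`. By completing a square it
decreases at most at the rate `r ‖ψ‖² / 4`, so that it is at most `‖ψ‖² / 4 < 2`; the profile avoids
the pole `k`, and `z` is bounded in terms of `‖ψ‖` (`riccati_height_le`,
`IsNormalizedCoulombFrame.height_le`). With the quadratic term truncated, the Riccati equation is
solved by a contraction in a norm with an exponential weight, and the height bound removes the
truncation (`exists_truncated_riccati`, `exists_isRiccati`). Uniqueness and Lipschitz dependence of
`z` follow from a Grönwall inequality directed from infinity, in which the damping `z / r` also
controls the difference in `L²(dr / r)` (`gronwall_at_infinity`, `IsRiccati.stability`). They pass to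
`N`, and from there to the profile and its derivative (`exists_profile_lipschitz`).

For the energy, `r ‖u'‖² + r⁻¹ ‖R u‖²` is `r ‖ψ‖²` up to twice the derivative of the height, which
has the same limit at both ends (`energy_profile_eq`). Finally, the weak gradient of an equivariant
map is computed in polar coordinates: the integrand of the weak formulation is the sum of a radial
and an angular derivative, each of which integrates to zero, the boundary terms at the origin
vanishing because the profile is bounded (`isWeakGradient_equivMap`, `dirichlet_of_equivariant`).
-/

noncomputable section

namespace EquivariantMap

/-! ### Locally absolutely continuous functions on the half-line -/

/-- `f` is absolutely continuous on the compact subintervals of `(0, ∞)`, with almost everywhere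
derivative `g` there. Keeping `g` as a separate argument, determined up to null sets only, lets the
usual differentiation rules be stated without `deriv`. -/
structure HasACDeriv {F : Type*} [NormedAddCommGroup F] [NormedSpace ℝ F] (f g : ℝ → F) :
    Prop where
  ac : ∀ a b : ℝ, 0 < a → a ≤ b → AbsolutelyContinuousOnInterval f a b
  ae : ∀ᵐ r ∂(volume.restrict (Ioi (0 : ℝ))), HasDerivAt f (g r) r

section AC

variable {E F : Type*} [NormedAddCommGroup E] [NormedSpace ℝ E] [NormedAddCommGroup F]
  [NormedSpace ℝ F]

/-- A function whose increments are controlled by those of an absolutely continuous function is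
absolutely continuous. -/
theorem ac_of_dist_le {X Y : Type*} [PseudoMetricSpace X] [PseudoMetricSpace Y] {f : ℝ → X}
    {h : ℝ → Y} {a b C : ℝ}
    (H : ∀ x ∈ uIcc a b, ∀ y ∈ uIcc a b, dist (f x) (f y) ≤ C * dist (h x) (h y))
    (hh : AbsolutelyContinuousOnInterval h a b) : AbsolutelyContinuousOnInterval f a b := by
  have h0 := Tendsto.const_mul C hh
  rw [mul_zero] at h0
  refine squeeze_zero' (Eventually.of_forall fun t => Finset.sum_nonneg fun i _ => dist_nonneg)
    ?_ h0
  have : ∀ᶠ (E : ℕ × (ℕ → ℝ × ℝ)) in AbsolutelyContinuousOnInterval.totalLengthFilter ⊓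
      𝓟 (AbsolutelyContinuousOnInterval.disjWithin a b),
      E ∈ AbsolutelyContinuousOnInterval.disjWithin a b :=
    eventually_inf_principal.mpr (by simp)
  filter_upwards [this] with e he
  rw [Finset.mul_sum]
  exact Finset.sum_le_sum fun i hi => H _ (he.1 i hi).1 _ (he.1 i hi).2

theorem uIcc_subset_Ioi {a b : ℝ} (ha : 0 < a) (hab : a ≤ b) : uIcc a b ⊆ Ioi 0 := by
  rw [uIcc_of_le hab]; intro x hx; exact lt_of_lt_of_le ha hx.1

namespace HasACDeriv

theorem continuousOn {f g : ℝ → F} (h : HasACDeriv f g) : ContinuousOn f (Ioi 0) := by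
  intro x hx
  have hx' : (0:ℝ) < x := hx
  have := (h.ac (x / 2) (x + 1) (by positivity) (by linarith)).continuousOn
  refine (this.continuousAt ?_).continuousWithinAt
  rw [uIcc_of_le (by linarith)]
  exact Icc_mem_nhds (by linarith) (by linarith)

theorem congr_ae {f g g' : ℝ → F} (h : HasACDeriv f g)
    (hg : ∀ᵐ r ∂(volume.restrict (Ioi (0 : ℝ))), g r = g' r) : HasACDeriv f g' :=
  ⟨h.ac, by filter_upwards [h.ae, hg] with r h1 h2; rwa [← h2]⟩

theorem congr_deriv {f g g' : ℝ → F} (h : HasACDeriv f g)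
    (hg : ∀ r, 0 < r → g r = g' r) : HasACDeriv f g' :=
  h.congr_ae ((ae_restrict_iff' measurableSet_Ioi).2 (Eventually.of_forall hg))

theorem congr_fun {f f' g : ℝ → F} (h : HasACDeriv f g)
    (hf : ∀ r, 0 < r → f r = f' r) : HasACDeriv f' g := by
  constructor
  · intro a b ha hab
    refine ac_of_dist_le (C := 1) (fun x hx y hy => ?_) (h.ac a b ha hab)
    rw [hf x (uIcc_subset_Ioi ha hab hx), hf y (uIcc_subset_Ioi ha hab hy), one_mul]
  · filter_upwards [h.ae, ae_restrict_mem measurableSet_Ioi] with r h1 h2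
    refine h1.congr_of_eventuallyEq ?_
    filter_upwards [Ioi_mem_nhds (show (0:ℝ) < r from h2)] with s hs
    exact (hf s hs).symm

theorem const (c : F) : HasACDeriv (fun _ => c) (fun _ => 0) :=
  ⟨fun _ _ _ _ => (LipschitzWith.const c).lipschitzOnWith.absolutelyContinuousOnInterval,
    Eventually.of_forall fun r => hasDerivAt_const r c⟩

theorem of_hasDerivAt {f g : ℝ → F} (hf : ∀ r, 0 < r → HasDerivAt f (g r) r)
    (hg : ContinuousOn g (Ioi 0)) : HasACDeriv f g := by
  constructor
  · intro a b ha hab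
    have hs := uIcc_subset_Ioi ha hab
    obtain ⟨C, hC⟩ := isCompact_uIcc.exists_bound_of_continuousOn (hg.mono hs)
    have : LipschitzOnWith (Real.toNNReal C) f (uIcc a b) := by
      refine Convex.lipschitzOnWith_of_nnnorm_hasDerivWithin_le (convex_uIcc a b)
        (fun x hx => (hf x (hs hx)).hasDerivWithinAt) (fun x hx => ?_)
      rw [← NNReal.coe_le_coe]
      exact (hC x hx).trans (Real.le_coe_toNNReal C)
    exact this.absolutelyContinuousOnInterval
  · exact (ae_restrict_iff' measurableSet_Ioi).2 (Eventually.of_forall hf)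

theorem add {f f' g g' : ℝ → F} (h : HasACDeriv f g) (h' : HasACDeriv f' g') :
    HasACDeriv (fun r => f r + f' r) (fun r => g r + g' r) :=
  ⟨fun a b ha hab => (h.ac a b ha hab).fun_add (h'.ac a b ha hab), by
    filter_upwards [h.ae, h'.ae] with r h1 h2 using h1.add h2⟩

theorem neg {f g : ℝ → F} (h : HasACDeriv f g) : HasACDeriv (fun r => -f r) (fun r => -g r) :=
  ⟨fun a b ha hab => (h.ac a b ha hab).fun_neg, by
    filter_upwards [h.ae] with r h1 using h1.neg⟩

theorem sub {f f' g g' : ℝ → F} (h : HasACDeriv f g) (h' : HasACDeriv f' g') :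
    HasACDeriv (fun r => f r - f' r) (fun r => g r - g' r) :=
  ⟨fun a b ha hab => (h.ac a b ha hab).fun_sub (h'.ac a b ha hab), by
    filter_upwards [h.ae, h'.ae] with r h1 h2 using h1.sub h2⟩

theorem smul {f f' : ℝ → ℝ} {g g' : ℝ → F} (h : HasACDeriv f f') (h' : HasACDeriv g g') :
    HasACDeriv (fun r => f r • g r) (fun r => f r • g' r + f' r • g r) :=
  ⟨fun a b ha hab => (h.ac a b ha hab).fun_smul (h'.ac a b ha hab), by
    filter_upwards [h.ae, h'.ae] with r h1 h2 using h1.smul h2⟩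

theorem mul {A : Type*} [NormedRing A] [NormedAlgebra ℝ A] [NormMulClass A] {f f' g g' : ℝ → A}
    (h : HasACDeriv f f') (h' : HasACDeriv g g') :
    HasACDeriv (fun r => f r * g r) (fun r => f' r * g r + f r * g' r) :=
  ⟨fun a b ha hab => (h.ac a b ha hab).fun_smul (h'.ac a b ha hab), by
    filter_upwards [h.ae, h'.ae] with r h1 h2 using h1.mul h2⟩

theorem clm {f g : ℝ → E} (h : HasACDeriv f g) (L : E →L[ℝ] F) :
    HasACDeriv (fun r => L (f r)) (fun r => L (g r)) := by
  constructor
  · intro a b ha hab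
    exact ac_of_dist_le (C := ‖L‖)
      (fun x _ y _ => by simpa using L.lipschitz.dist_le_mul (f x) (f y)) (h.ac a b ha hab)
  · filter_upwards [h.ae] with r h1 using L.hasFDerivAt.comp_hasDerivAt r h1

theorem comp_contDiff [ProperSpace E] {f g : ℝ → E} (h : HasACDeriv f g) {Φ : E → F}
    (hΦ : ContDiff ℝ 1 Φ) : HasACDeriv (fun r => Φ (f r)) (fun r => fderiv ℝ Φ (f r) (g r)) := by
  constructor
  · intro a b ha hab
    obtain ⟨C, hC⟩ := (h.ac a b ha hab).exists_bound
    obtain ⟨K, hK⟩ := (hΦ.contDiffOn (s := Metric.closedBall 0 C)).exists_lipschitzOnWith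
      (by decide) (convex_closedBall _ _) (isCompact_closedBall _ _)
    refine ac_of_dist_le (C := K) (fun x hx y hy => ?_) (h.ac a b ha hab)
    exact hK.dist_le_mul _ (by simpa using hC x hx) _ (by simpa using hC y hy)
  · filter_upwards [h.ae] with r h1
    exact ((hΦ.differentiable (by decide)) (f r)).hasFDerivAt.comp_hasDerivAt r h1

theorem re {f g : ℝ → ℂ} (h : HasACDeriv f g) :
    HasACDeriv (fun r => (f r).re) (fun r => (g r).re) := h.clm Complex.reCLM

theorem im {f g : ℝ → ℂ} (h : HasACDeriv f g) :
    HasACDeriv (fun r => (f r).im) (fun r => (g r).im) := h.clm Complex.imCLM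

theorem conj {f g : ℝ → ℂ} (h : HasACDeriv f g) :
    HasACDeriv (fun r => star (f r)) (fun r => star (g r)) :=
  h.clm (starL' ℝ : ℂ ≃L[ℝ] ℂ).toContinuousLinearMap

theorem ofReal {f g : ℝ → ℝ} (h : HasACDeriv f g) :
    HasACDeriv (fun r => (f r : ℂ)) (fun r => (g r : ℂ)) := h.clm Complex.ofRealCLM

theorem cexp {f g : ℝ → ℂ} (h : HasACDeriv f g) :
    HasACDeriv (fun r => Complex.exp (f r)) (fun r => Complex.exp (f r) * g r) := by
  refine ⟨(h.comp_contDiff (Complex.contDiff_exp (𝕜 := ℝ))).ac, ?_⟩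
  filter_upwards [h.ae] with r h1 using h1.cexp

theorem rexp {f g : ℝ → ℝ} (h : HasACDeriv f g) :
    HasACDeriv (fun r => Real.exp (f r)) (fun r => Real.exp (f r) * g r) := by
  refine ⟨(h.comp_contDiff Real.contDiff_exp).ac, ?_⟩
  filter_upwards [h.ae] with r h1 using h1.exp

theorem inv {f g : ℝ → ℝ} (h : HasACDeriv f g)
    (h0 : ∀ r, 0 < r → f r ≠ 0) :
    HasACDeriv (fun r => (f r)⁻¹) (fun r => -g r / f r ^ 2) := by
  constructor
  · intro a b ha hab
    have hs := uIcc_subset_Ioi ha hab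
    have hc : ContinuousOn (fun r => ‖(f r)⁻¹‖) (uIcc a b) :=
      ((h.continuousOn.mono hs).inv₀ fun x hx => h0 x (hs hx)).norm
    obtain ⟨C, hC⟩ := isCompact_uIcc.exists_bound_of_continuousOn hc
    refine ac_of_dist_le (C := C * C) (fun x hx y hy => ?_) (h.ac a b ha hab)
    have hx0 := h0 x (hs hx)
    have hy0 := h0 y (hs hy)
    have e : (f x)⁻¹ - (f y)⁻¹ = (f x)⁻¹ * (f y)⁻¹ * (f y - f x) := by field_simp
    have hCx := hC x hx
    have hCy := hC y hy
    simp only [norm_norm] at hCx hCy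
    rw [dist_eq_norm, e, norm_mul, norm_mul, dist_comm, dist_eq_norm]
    have := norm_nonneg (f x)⁻¹
    have := norm_nonneg (f y)⁻¹
    gcongr
    linarith
  · filter_upwards [h.ae, ae_restrict_mem measurableSet_Ioi] with r h1 h2
    exact h1.inv (h0 r h2)

theorem ae_mem_uIcc {f g : ℝ → F} (h : HasACDeriv f g) {a b : ℝ} (ha : 0 < a) (hab : a ≤ b) :
    ∀ᵐ x, x ∈ uIcc a b → HasDerivAt f (g x) x := by
  have := (ae_restrict_iff' measurableSet_Ioi).1 h.ae
  filter_upwards [this] with x hx hx' using hx (uIcc_subset_Ioi ha hab hx')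

theorem intervalIntegrable_real {f g : ℝ → ℝ} (h : HasACDeriv f g) {a b : ℝ} (ha : 0 < a)
    (hab : a ≤ b) : IntervalIntegrable g volume a b := by
  refine ((h.ac a b ha hab).intervalIntegrable_deriv).congr_ae ?_
  rw [EventuallyEq, ae_restrict_iff' (by simp [uIoc])]
  filter_upwards [h.ae_mem_uIcc ha hab] with x hx hx'
  exact (hx (uIoc_subset_uIcc hx')).deriv

theorem intervalIntegrable [FiniteDimensional ℝ F] {f g : ℝ → F} (h : HasACDeriv f g) {a b : ℝ}
    (ha : 0 < a) (hab : a ≤ b) : IntervalIntegrable g volume a b := by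
  let e := (Module.finBasis ℝ F).equivFunL
  rw [intervalIntegrable_iff]
  have h1 : IntegrableOn (fun r => e (g r)) (uIoc a b) volume := by
    refine Integrable.of_eval fun i => ?_
    have := (h.clm ((ContinuousLinearMap.proj (R := ℝ) (φ := fun _ => ℝ) i).comp
      e.toContinuousLinearMap)).intervalIntegrable_real ha hab
    exact (intervalIntegrable_iff.1 this)
  have h2 := e.symm.toContinuousLinearMap.integrable_comp h1
  simpa [IntegrableOn] using h2

end HasACDeriv

theorem ac_intervalIntegral {g : ℝ → F} {a b c : ℝ}
    (h : IntervalIntegrable g volume a b) (hc : c ∈ uIcc a b) :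
    AbsolutelyContinuousOnInterval (fun x => ∫ v in c..x, g v) a b := by
  refine ac_of_dist_le (C := 1) (fun x hx y hy => ?_)
    (h.norm.absolutelyContinuousOnInterval_intervalIntegral hc)
  have sub : ∀ {p q}, p ∈ uIcc a b → q ∈ uIcc a b → IntervalIntegrable g volume p q :=
    fun hp hq => h.mono_set (uIcc_subset_uIcc hp hq)
  rw [one_mul, dist_eq_norm, Real.dist_eq,
    intervalIntegral.integral_interval_sub_left (sub hc hx) (sub hc hy),
    intervalIntegral.integral_interval_sub_left (sub hc hx).norm (sub hc hy).norm]
  exact intervalIntegral.norm_integral_le_abs_integral_norm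

theorem ae_mem_Ioi_of_interval {p : ℝ → Prop}
    (h : ∀ a b : ℝ, 0 < a → a ≤ b → ∀ᵐ x, x ∈ uIcc a b → p x) :
    ∀ᵐ r ∂(volume.restrict (Ioi (0 : ℝ))), p r := by
  have h1 : ∀ n : ℕ, 0 < 1 / ((n:ℝ) + 1) ∧ 1 / ((n:ℝ) + 1) ≤ (n:ℝ) + 1 := fun n => by
    have h0 : (0:ℝ) ≤ n := Nat.cast_nonneg n
    refine ⟨by positivity, ?_⟩
    rw [div_le_iff₀ (by positivity)]
    nlinarith
  rw [ae_restrict_iff' measurableSet_Ioi]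
  filter_upwards [ae_all_iff.2 fun n => h _ _ (h1 n).1 (h1 n).2] with x hx hx0
  have hx0' : (0:ℝ) < x := hx0
  obtain ⟨n, hn⟩ := exists_nat_ge (max x (1 / x))
  refine hx n ?_
  have h2 : x ≤ n := (le_max_left _ _).trans hn
  have h3 : 1 / x ≤ n := (le_max_right _ _).trans hn
  rw [uIcc_of_le (h1 n).2]
  refine ⟨?_, by linarith⟩
  rw [div_le_iff₀ (by positivity)]
  rw [div_le_iff₀ hx0'] at h3
  nlinarith

namespace HasACDeriv

theorem integral_eq_sub [FiniteDimensional ℝ F] {f g : ℝ → F} (h : HasACDeriv f g) {a b : ℝ}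
    (ha : 0 < a) (hab : a ≤ b) : ∫ x in a..b, g x = f b - f a := by
  have hi := h.intervalIntegrable ha hab
  have hz := ((h.ac a b ha hab).fun_sub (ac_intervalIntegral hi left_mem_uIcc))
    |>.const_of_ae_hasDerivAt_zero (by
      filter_upwards [h.ae_mem_uIcc ha hab, hi.ae_hasDerivAt_integral] with x h1 h2 h3
      have := (h1 h3).sub (h2 h3 a left_mem_uIcc)
      rwa [sub_self] at this)
  obtain ⟨C, hC⟩ := hz
  have e1 := hC a left_mem_uIcc
  have e2 := hC b right_mem_uIcc
  simp only [intervalIntegral.integral_same, sub_zero] at e1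
  rw [← e1] at e2
  rw [← e2]; abel

theorem of_intervalIntegrable [CompleteSpace F] {g : ℝ → F} (c : F)
    (hg : ∀ a b, 0 < a → a ≤ b → IntervalIntegrable g volume a b) :
    HasACDeriv (fun r => c + ∫ x in (1:ℝ)..r, g x) g := by
  have hac : ∀ a b, 0 < a → a ≤ b →
      AbsolutelyContinuousOnInterval (fun r => ∫ x in (1:ℝ)..r, g x) a b := by
    intro a b ha hab
    have hi := hg (min a 1) (max b 1) (by positivity) (by simp [hab])
    refine (ac_intervalIntegral (c := 1) hi ?_).mono ?_
    · rw [uIcc_of_le (by simp [hab])]; simp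
    · rw [uIcc_of_le hab, uIcc_of_le (by simp [hab])]
      exact Icc_subset_Icc (by simp) (by simp)
  constructor
  · intro a b ha hab
    exact ((const c).ac a b ha hab).fun_add (hac a b ha hab)
  · refine (ae_mem_Ioi_of_interval (p := fun x => x ∈ Ioi 0 → HasDerivAt
      (fun r => c + ∫ x in (1:ℝ)..r, g x) (g x) x) fun a b ha hab => ?_).mp
      ((ae_restrict_mem measurableSet_Ioi).mono fun x hx h => h hx)
    have hi := hg (min a 1) (max b 1) (by positivity) (by simp [hab])
    have hmm : min a 1 ≤ max b 1 := (min_le_right _ _).trans (le_max_right _ _)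
    filter_upwards [hi.ae_hasDerivAt_integral] with x hx hx' _
    refine (hx ?_ 1 ?_).const_add c
    · rw [uIcc_of_le hab] at hx'
      rw [uIcc_of_le hmm]
      exact ⟨(min_le_left _ _).trans hx'.1, hx'.2.trans (le_max_left _ _)⟩
    · rw [uIcc_of_le hmm]
      exact ⟨min_le_right _ _, le_max_right _ _⟩

/-- The tail integral `∫_r^∞ g` has almost everywhere derivative `-g`. -/
theorem tail [CompleteSpace F] {g : ℝ → F} (hg : ∀ a, 0 < a → IntegrableOn g (Ioi a)) :
    HasACDeriv (fun r => ∫ x in Ioi r, g x) (fun r => -g r) := by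
  have hi : ∀ a b, 0 < a → a ≤ b → IntervalIntegrable g volume a b := fun a b ha hab => by
    rw [intervalIntegrable_iff_integrableOn_Ioc_of_le hab]
    exact (hg a ha).mono_set Ioc_subset_Ioi_self
  have h1 := (const (∫ x in Ioi (1:ℝ), g x)).sub (of_intervalIntegrable 0 hi)
  refine (h1.congr_deriv fun r _ => by simp).congr_fun fun r hr => ?_
  have := intervalIntegral.integral_interval_add_Ioi' (f := g) (a := 1) (b := r) (μ := volume)
    (by
      rcases le_total 1 r with h | h
      · exact hi 1 r one_pos h
      · exact (hi r 1 hr h).symm) (hg r hr)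
  rw [← this]; simp

theorem le_of_nonneg {f g : ℝ → ℝ} (h : HasACDeriv f g)
    (hg : ∀ᵐ r ∂(volume.restrict (Ioi (0 : ℝ))), 0 ≤ g r) {a b : ℝ} (ha : 0 < a) (hab : a ≤ b) :
    f a ≤ f b := by
  have h1 := h.integral_eq_sub ha hab
  have : 0 ≤ ∫ x in a..b, g x := by
    rw [intervalIntegral.integral_of_le hab]
    refine integral_nonneg_of_ae ?_
    exact ae_restrict_of_ae_restrict_of_subset
      (fun x hx => lt_of_lt_of_le ha hx.1.le) hg
  linarith

theorem eq_of_zero [FiniteDimensional ℝ F] {f : ℝ → F} (h : HasACDeriv f (fun _ => 0))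
    {a b : ℝ} (ha : 0 < a) (hab : a ≤ b) : f a = f b := by
  have h1 := h.integral_eq_sub ha hab
  simp only [intervalIntegral.integral_zero] at h1
  exact (sub_eq_zero.1 h1.symm).symm

theorem eq_lim_of_zero [FiniteDimensional ℝ F] {f : ℝ → F} (h : HasACDeriv f (fun _ => 0))
    {L : F} (hL : Tendsto f atTop (𝓝 L)) {a : ℝ} (ha : 0 < a) : f a = L := by
  refine tendsto_nhds_unique (tendsto_const_nhds.congr' ?_) hL
  filter_upwards [eventually_ge_atTop a] with b hb using h.eq_of_zero ha hb

end HasACDeriv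

theorem tendsto_tail_zero {g : ℝ → F} {a : ℝ} (hg : IntegrableOn g (Ioi a)) :
    Tendsto (fun r => ∫ x in Ioi r, g x) atTop (𝓝 0) := by
  have h1 := intervalIntegral_tendsto_integral_Ioi a hg tendsto_id
  have h2 : Tendsto (fun r => (∫ x in Ioi a, g x) - ∫ x in a..r, g x) atTop
      (𝓝 ((∫ x in Ioi a, g x) - ∫ x in Ioi a, g x)) := tendsto_const_nhds.sub h1
  rw [sub_self] at h2
  refine h2.congr' ?_
  filter_upwards [eventually_ge_atTop a] with r hr
  rw [← intervalIntegral.integral_interval_add_Ioi' (a := a) (b := r)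
    ((intervalIntegrable_iff_integrableOn_Ioc_of_le hr).2 (hg.mono_set Ioc_subset_Ioi_self))
    (hg.mono_set (Ioi_subset_Ioi hr))]
  abel

end AC

/-! ### The radial `L²` norm -/

theorem radialMeasure_eq : radialMeasure =
    (volume.restrict (Ioi (0 : ℝ))).withDensity (fun r => ((Real.toNNReal r : ℝ≥0) : ℝ≥0∞)) := rfl

theorem radialMeasure_ac : radialMeasure ≪ volume.restrict (Ioi (0 : ℝ)) :=
  withDensity_absolutelyContinuous _ _

theorem ac_radialMeasure : volume.restrict (Ioi (0 : ℝ)) ≪ radialMeasure := by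
  refine withDensity_absolutelyContinuous' (by fun_prop) ?_
  refine (ae_restrict_iff' measurableSet_Ioi).2 (Eventually.of_forall fun r hr => ?_)
  simpa using hr

theorem ae_radialMeasure_iff {p : ℝ → Prop} :
    (∀ᵐ r ∂radialMeasure, p r) ↔ ∀ᵐ r ∂(volume.restrict (Ioi (0 : ℝ))), p r :=
  ⟨fun h => ac_radialMeasure.ae_le h, fun h => radialMeasure_ac.ae_le h⟩

theorem ae_pos : ∀ᵐ r ∂radialMeasure, (0 : ℝ) < r :=
  ae_radialMeasure_iff.2 (ae_restrict_mem measurableSet_Ioi)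

section RadNorm

variable {E F G : Type*} [NormedAddCommGroup E] [NormedAddCommGroup F] [NormedAddCommGroup G]

theorem integrable_radial_iff [NormedSpace ℝ F] {f : ℝ → F} :
    Integrable f radialMeasure ↔ IntegrableOn (fun r => r • f r) (Ioi 0) := by
  rw [radialMeasure_eq, integrable_withDensity_iff_integrable_smul (by fun_prop), IntegrableOn]
  refine integrable_congr ?_
  filter_upwards [ae_restrict_mem measurableSet_Ioi] with r hr
  rw [NNReal.smul_def, Real.coe_toNNReal r (le_of_lt hr)]

theorem integral_radial [NormedSpace ℝ F] (f : ℝ → F) :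
    ∫ r, f r ∂radialMeasure = ∫ r in Ioi 0, r • f r := by
  rw [radialMeasure_eq, integral_withDensity_eq_integral_smul (by fun_prop)]
  refine integral_congr_ae ?_
  filter_upwards [ae_restrict_mem measurableSet_Ioi] with r hr
  rw [NNReal.smul_def, Real.coe_toNNReal r (le_of_lt hr)]

theorem lintegral_radial {f : ℝ → ℝ≥0∞} :
    ∫⁻ r, f r ∂radialMeasure = ∫⁻ r in Ioi 0, ENNReal.ofReal r * f r := by
  rw [radialMeasure, lintegral_withDensity_eq_lintegral_mul_non_measurable _ (by fun_prop)
    (Eventually.of_forall fun r => ENNReal.ofReal_lt_top)]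
  rfl

theorem memLp_radial_iff {f : ℝ → F} (hf : AEStronglyMeasurable f (volume.restrict (Ioi 0))) :
    MemLp f 2 radialMeasure ↔ IntegrableOn (fun r => r * ‖f r‖ ^ 2) (Ioi 0) := by
  rw [memLp_two_iff_integrable_sq_norm (hf.mono_ac radialMeasure_ac), integrable_radial_iff]
  rfl

/-- The norm of `L²((0, ∞), r dr)`, as a real number; it is used for square-integrable functions
only. -/
def radNorm (f : ℝ → F) : ℝ := (eLpNorm f 2 radialMeasure).toReal

theorem radNorm_nonneg (f : ℝ → F) : 0 ≤ radNorm f := ENNReal.toReal_nonneg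

theorem eLpNorm_eq_radNorm {f : ℝ → F} (hf : MemLp f 2 radialMeasure) :
    eLpNorm f 2 radialMeasure = ENNReal.ofReal (radNorm f) :=
  (ENNReal.ofReal_toReal hf.2.ne).symm

theorem MemLp.aesm {f : ℝ → F} (hf : MemLp f 2 radialMeasure) :
    AEStronglyMeasurable f (volume.restrict (Ioi 0)) := hf.1.mono_ac ac_radialMeasure

theorem MemLp.integrableOn_sq {f : ℝ → F} (hf : MemLp f 2 radialMeasure) :
    IntegrableOn (fun r => r * ‖f r‖ ^ 2) (Ioi 0) :=
  (memLp_radial_iff (MemLp.aesm hf)).1 hf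

theorem radNorm_sq {f : ℝ → F} (hf : MemLp f 2 radialMeasure) :
    radNorm f ^ 2 = ∫ r in Ioi 0, r * ‖f r‖ ^ 2 := by
  rw [radNorm, hf.eLpNorm_eq_integral_rpow_norm (by simp) (by simp), ENNReal.toReal_ofReal
    (Real.rpow_nonneg (integral_nonneg fun r => by positivity) _), ← Real.rpow_natCast,
    ← Real.rpow_mul (integral_nonneg fun r => by positivity)]
  simp only [ENNReal.toReal_ofNat, Real.rpow_ofNat, Nat.cast_ofNat]
  rw [inv_mul_cancel₀ (by norm_num), Real.rpow_one, integral_radial]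
  rfl

/-- Pointwise domination by two square-integrable functions gives the corresponding bound for the
radial norms. -/
theorem radNorm_le_add {f : ℝ → E} {g : ℝ → F} {h : ℝ → G} {C D : ℝ}
    (hf : AEStronglyMeasurable f (volume.restrict (Ioi 0))) (hg : MemLp g 2 radialMeasure)
    (hh : MemLp h 2 radialMeasure) (hC : 0 ≤ C) (hD : 0 ≤ D)
    (H : ∀ᵐ r ∂(volume.restrict (Ioi (0 : ℝ))), ‖f r‖ ≤ C * ‖g r‖ + D * ‖h r‖) :
    MemLp f 2 radialMeasure ∧ radNorm f ≤ C * radNorm g + D * radNorm h := by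
  have hg' : MemLp (fun r => C * ‖g r‖) 2 radialMeasure := hg.norm.const_mul C
  have hh' : MemLp (fun r => D * ‖h r‖) 2 radialMeasure := hh.norm.const_mul D
  have H' : ∀ᵐ r ∂radialMeasure, ‖f r‖ ≤ ‖C * ‖g r‖ + D * ‖h r‖‖ := by
    filter_upwards [ae_radialMeasure_iff.2 H] with r hr using hr.trans (le_abs_self _)
  have hm : MemLp f 2 radialMeasure := (hg'.add hh').of_le (hf.mono_ac radialMeasure_ac) H'
  refine ⟨hm, ?_⟩
  have e1 : eLpNorm (fun r => C * ‖g r‖) 2 radialMeasure = ENNReal.ofReal (C * radNorm g) := by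
    have := eLpNorm_const_smul C (fun r => ‖g r‖) 2 radialMeasure
    rw [eLpNorm_norm, eLpNorm_eq_radNorm hg, Real.enorm_eq_ofReal hC,
      ← ENNReal.ofReal_mul hC] at this
    exact this
  have e2 : eLpNorm (fun r => D * ‖h r‖) 2 radialMeasure = ENNReal.ofReal (D * radNorm h) := by
    have := eLpNorm_const_smul D (fun r => ‖h r‖) 2 radialMeasure
    rw [eLpNorm_norm, eLpNorm_eq_radNorm hh, Real.enorm_eq_ofReal hD,
      ← ENNReal.ofReal_mul hD] at this
    exact this
  have h1 := (eLpNorm_mono_ae H').trans (eLpNorm_add_le hg'.1 hh'.1 one_le_two)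
  have hg0 := mul_nonneg hC (radNorm_nonneg g)
  have hh0 := mul_nonneg hD (radNorm_nonneg h)
  rw [e1, e2, ← ENNReal.ofReal_add hg0 hh0] at h1
  exact ENNReal.toReal_le_of_le_ofReal (add_nonneg hg0 hh0) h1

theorem radNorm_le_mul {f : ℝ → E} {g : ℝ → F} {C : ℝ}
    (hf : AEStronglyMeasurable f (volume.restrict (Ioi 0))) (hg : MemLp g 2 radialMeasure)
    (hC : 0 ≤ C)
    (H : ∀ᵐ r ∂(volume.restrict (Ioi (0 : ℝ))), ‖f r‖ ≤ C * ‖g r‖) :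
    MemLp f 2 radialMeasure ∧ radNorm f ≤ C * radNorm g := by
  have := radNorm_le_add (D := 0) hf hg hg hC le_rfl (by simpa using H)
  simpa using this

theorem integral_rpow_eq_radNorm {f : ℝ → F} (hf : MemLp f 2 radialMeasure) :
    (∫ r, ‖f r‖ ^ (2:ℝ) ∂radialMeasure) ^ (1 / (2:ℝ)) = radNorm f := by
  rw [integral_radial]
  simp only [Real.rpow_ofNat, smul_eq_mul]
  rw [← radNorm_sq hf, ← Real.sqrt_eq_rpow, Real.sqrt_sq (radNorm_nonneg f)]

/-- Cauchy–Schwarz for the pairing of `L²(r dr)` with `L²(dr / r)`. -/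
theorem integral_mul_le_radNorm {f : ℝ → E} {g : ℝ → F} {h : ℝ → G} (hf : MemLp f 2 radialMeasure)
    (hg : MemLp g 2 radialMeasure)
    (hh : AEStronglyMeasurable h (volume.restrict (Ioi 0)))
    (H : ∀ᵐ r ∂(volume.restrict (Ioi (0 : ℝ))), ‖h r‖ ≤ r * (‖f r‖ * ‖g r‖)) :
    IntegrableOn h (Ioi 0) ∧ ∫ r in Ioi 0, ‖h r‖ ≤ radNorm f * radNorm g := by
  have hi : Integrable (fun r => ‖f r‖ * ‖g r‖) radialMeasure :=
    MemLp.integrable_mul (p := 2) (q := 2) hf.norm hg.norm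
  have hi' := integrable_radial_iff.1 hi
  have h1 : IntegrableOn h (Ioi 0) := hi'.mono' hh H
  refine ⟨h1, (integral_mono_ae h1.norm hi' H).trans ?_⟩
  have h2 := integral_radial (fun r => ‖f r‖ * ‖g r‖)
  simp only [smul_eq_mul] at h2 ⊢
  rw [← h2]
  have h3 := integral_mul_le_Lp_mul_Lq_of_nonneg (μ := radialMeasure) Real.HolderConjugate.two_two
    (f := fun r => ‖f r‖) (g := fun r => ‖g r‖) (Eventually.of_forall fun r => norm_nonneg _)
    (Eventually.of_forall fun r => norm_nonneg _) (by simpa using hf.norm) (by simpa using hg.norm)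
  refine h3.trans (le_of_eq ?_)
  rw [integral_rpow_eq_radNorm hf, integral_rpow_eq_radNorm hg]

end RadNorm

theorem radNorm_coe (ψ : RadialL2) : radNorm ψ = ‖ψ‖ := (Lp.norm_def ψ).symm

theorem radNorm_sub_coe (ψ ψ' : RadialL2) : radNorm (fun r => ψ r - ψ' r) = ‖ψ - ψ'‖ := by
  rw [Lp.norm_def, radNorm, eLpNorm_congr_ae (Lp.coeFn_sub ψ ψ')]
  rfl

/-! ### Differential inequalities on the half-line -/

theorem HasACDeriv.le_lim_of_nonneg {f g : ℝ → ℝ} (h : HasACDeriv f g)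
    (hg : ∀ᵐ r ∂(volume.restrict (Ioi (0 : ℝ))), 0 ≤ g r) {L : ℝ} (hL : Tendsto f atTop (𝓝 L))
    {a : ℝ} (ha : 0 < a) : f a ≤ L := by
  refine ge_of_tendsto hL ?_
  filter_upwards [eventually_ge_atTop a] with b hb using h.le_of_nonneg hg ha hb

theorem HasACDeriv.norm_sq {f g : ℝ → ℂ} (h : HasACDeriv f g) :
    HasACDeriv (fun r => ‖f r‖ ^ 2) (fun r => 2 * (star (f r) * g r).re) := by
  refine ((h.mul h.conj).re.congr_fun fun r _ => ?_).congr_deriv fun r _ => ?_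
  · simp [← Complex.normSq_eq_norm_sq, Complex.normSq_apply]
  · simp; ring

theorem tail_sq_nonneg {F : Type*} [NormedAddCommGroup F] (ψ : ℝ → F) {r : ℝ} (hr : 0 ≤ r) :
    0 ≤ ∫ x in Ioi r, x * ‖ψ x‖ ^ 2 :=
  setIntegral_nonneg measurableSet_Ioi fun _ hx =>
    mul_nonneg (hr.trans (le_of_lt hx)) (sq_nonneg _)

theorem tail_sq_le {F : Type*} [NormedAddCommGroup F] {ψ : ℝ → F} (hψ : MemLp ψ 2 radialMeasure)
    {r : ℝ} (hr : 0 ≤ r) : ∫ x in Ioi r, x * ‖ψ x‖ ^ 2 ≤ radNorm ψ ^ 2 := by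
  rw [radNorm_sq hψ]
  refine setIntegral_mono_set (MemLp.integrableOn_sq hψ) ?_ (Ioi_subset_Ioi hr).eventuallyLE
  filter_upwards [ae_restrict_mem measurableSet_Ioi] with x hx
  exact mul_nonneg (le_of_lt hx) (sq_nonneg _)

theorem hasACDeriv_tail_sq {F : Type*} [NormedAddCommGroup F] {ψ : ℝ → F}
    (hψ : MemLp ψ 2 radialMeasure) :
    HasACDeriv (fun r => ∫ x in Ioi r, x * ‖ψ x‖ ^ 2) (fun r => -(r * ‖ψ r‖ ^ 2)) :=
  HasACDeriv.tail fun _ ha => (MemLp.integrableOn_sq hψ).mono_set (Ioi_subset_Ioi ha.le)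

theorem aecover_Ioc_nat : AECover (volume.restrict (Ioi (0 : ℝ))) atTop
    (fun n : ℕ => Ioc (1 / ((n : ℝ) + 1)) ((n : ℝ) + 1)) :=
  (aecover_Ioi_of_Ioi tendsto_one_div_add_atTop_nhds_zero_nat).inter
    (aecover_Iic (tendsto_atTop_add_const_right _ _ tendsto_natCast_atTop_atTop))

/-- A Grönwall inequality directed from infinity: the damping term `y / r` dominates, and the
potential `r ‖ψ‖²`, being integrable, is absorbed into the weight `exp (-C ∫_r^∞ s ‖ψ‖²)`. -/
theorem gronwall_at_infinity {ψ : ℝ → ℂ} (hψ : MemLp ψ 2 radialMeasure) {y y' h : ℝ → ℝ}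
    {C : ℝ} (hC : 0 ≤ C)
    (hy : HasACDeriv y y') (hy0 : ∀ r, 0 < r → 0 ≤ y r) (hlim : Tendsto y atTop (𝓝 0))
    (hh : IntegrableOn h (Ioi 0)) (hh0 : ∀ r, 0 < r → 0 ≤ h r)
    (H : ∀ᵐ r ∂(volume.restrict (Ioi (0 : ℝ))), y r / r - C * (r * ‖ψ r‖ ^ 2) * y r - h r ≤ y' r) :
    (∀ r, 0 < r → y r ≤ Real.exp (C * radNorm ψ ^ 2) * ∫ r in Ioi 0, h r) ∧
      IntegrableOn (fun r => y r / r) (Ioi 0) ∧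
      ∫ r in Ioi 0, y r / r ≤ Real.exp (C * radNorm ψ ^ 2) * ∫ r in Ioi 0, h r := by
  set e := Real.exp (-(C * radNorm ψ ^ 2)) with he
  have he0 : 0 < e := Real.exp_pos _
  have hee : Real.exp (C * radNorm ψ ^ 2) * e = 1 := by rw [he, ← Real.exp_add]; simp
  set W : ℝ → ℝ := fun r => Real.exp (-(C * ∫ x in Ioi r, x * ‖ψ x‖ ^ 2)) with hW
  have hWle : ∀ r, 0 < r → W r ≤ 1 := fun r hr => by
    rw [hW]; simp only [Real.exp_le_one_iff, neg_nonpos]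
    exact mul_nonneg hC (tail_sq_nonneg ψ hr.le)
  have hWge : ∀ r, 0 < r → e ≤ W r := fun r hr => by
    rw [hW, he]; simp only [Real.exp_le_exp, neg_le_neg_iff]
    exact mul_le_mul_of_nonneg_left (tail_sq_le hψ hr.le) hC
  have hWd : HasACDeriv W (fun r => W r * (C * (r * ‖ψ r‖ ^ 2))) := by
    have h1 := (((HasACDeriv.const C).mul (hasACDeriv_tail_sq hψ)).neg).rexp
    exact h1.congr_deriv fun r _ => by simp [hW]
  have hWy := hWd.mul hy
  set D : ℝ := ∫ r in Ioi 0, h r with hD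
  have hD0 : 0 ≤ D := setIntegral_nonneg measurableSet_Ioi fun r hr => hh0 r hr
  have hyr : ∀ a b, 0 < a → a ≤ b → IntervalIntegrable (fun r => y r / r) volume a b := by
    intro a b ha hab
    refine ContinuousOn.intervalIntegrable (ContinuousOn.div ?_ continuousOn_id ?_)
    · exact hy.continuousOn.mono (uIcc_subset_Ioi ha hab)
    · intro x hx; exact ne_of_gt (uIcc_subset_Ioi ha hab hx)
  have key : ∀ a b, 0 < a → a ≤ b → e * y a + e * ∫ r in a..b, y r / r ≤ y b + D := by
    intro a b ha hab
    have hb : 0 < b := lt_of_lt_of_le ha hab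
    have hhi : IntervalIntegrable h volume a b := by
      rw [intervalIntegrable_iff_integrableOn_Ioc_of_le hab]
      exact hh.mono_set fun x hx => lt_trans ha hx.1
    have h1 := hWy.integral_eq_sub ha hab
    have h2 : ∫ r in a..b, (e * (y r / r) - h r) ≤
        ∫ r in a..b, (W r * (C * (r * ‖ψ r‖ ^ 2)) * y r + W r * y' r) := by
      refine intervalIntegral.integral_mono_ae_restrict hab
        (((hyr a b ha hab).const_mul e).sub hhi) (hWy.intervalIntegrable ha hab) ?_
      have hsub : Icc a b ⊆ Ioi 0 := fun x hx => lt_of_lt_of_le ha hx.1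
      filter_upwards [ae_restrict_of_ae_restrict_of_subset hsub H,
        ae_restrict_mem measurableSet_Icc] with r hr hr'
      have hr0 : 0 < r := hsub hr'
      have hy1 : 0 ≤ y r / r := div_nonneg (hy0 r hr0) hr0.le
      have e1 : W r * (y r / r - C * (r * ‖ψ r‖ ^ 2) * y r - h r) ≤ W r * y' r :=
        mul_le_mul_of_nonneg_left hr (he0.le.trans (hWge r hr0))
      have e2 : e * (y r / r) ≤ W r * (y r / r) := mul_le_mul_of_nonneg_right (hWge r hr0) hy1
      have e3 : W r * h r ≤ 1 * h r := mul_le_mul_of_nonneg_right (hWle r hr0) (hh0 r hr0)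
      have e4 : W r * (y r / r - C * (r * ‖ψ r‖ ^ 2) * y r - h r) =
        W r * (y r / r) - W r * (C * (r * ‖ψ r‖ ^ 2)) * y r - W r * h r := by ring
      linarith
    rw [h1, intervalIntegral.integral_sub ((hyr a b ha hab).const_mul e) hhi,
      intervalIntegral.integral_const_mul] at h2
    have h3 : ∫ r in a..b, h r ≤ D := by
      rw [intervalIntegral.integral_of_le hab]
      have hsub : Ioc a b ⊆ Ioi 0 := fun x hx => lt_trans ha hx.1
      refine setIntegral_mono_set hh ?_ hsub.eventuallyLE
      exact (ae_restrict_iff' measurableSet_Ioi).2 (Eventually.of_forall hh0)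
    have h4 : e * y a ≤ W a * y a := mul_le_mul_of_nonneg_right (hWge a ha) (hy0 a ha)
    have h5 : W b * y b ≤ 1 * y b := mul_le_mul_of_nonneg_right (hWle b hb) (hy0 b hb)
    linarith
  have hint0 : ∀ a b, 0 < a → a ≤ b → 0 ≤ ∫ r in a..b, y r / r := fun a b ha hab =>
    intervalIntegral.integral_nonneg hab fun x hx =>
      div_nonneg (hy0 x (lt_of_lt_of_le ha hx.1)) (le_of_lt (lt_of_lt_of_le ha hx.1))
  have hsup : ∀ r, 0 < r → y r ≤ Real.exp (C * radNorm ψ ^ 2) * D := by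
    intro a ha
    have h1 : e * y a ≤ 0 + D := by
      refine ge_of_tendsto (hlim.add_const D) ?_
      filter_upwards [eventually_ge_atTop a] with b hb
      have := key a b ha hb
      have := mul_nonneg he0.le (hint0 a b ha hb)
      linarith
    calc y a = Real.exp (C * radNorm ψ ^ 2) * (e * y a) := by rw [← mul_assoc, hee, one_mul]
      _ ≤ _ := by
        rw [zero_add] at h1
        exact mul_le_mul_of_nonneg_left h1 (Real.exp_pos _).le
  have hn : ∀ n : ℕ, 0 < 1 / ((n : ℝ) + 1) ∧ 1 / ((n : ℝ) + 1) ≤ (n : ℝ) + 1 := by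
    intro n
    have h0 : (0:ℝ) ≤ n := Nat.cast_nonneg n
    refine ⟨by positivity, ?_⟩
    rw [div_le_iff₀ (by positivity)]
    nlinarith
  have hbd : ∀ n : ℕ, ∫ r in Ioc (1 / ((n : ℝ) + 1)) ((n : ℝ) + 1), y r / r ≤
      Real.exp (C * radNorm ψ ^ 2) * (y ((n : ℝ) + 1) + D) := by
    intro n
    rw [← intervalIntegral.integral_of_le (hn n).2]
    have h1 := key _ _ (hn n).1 (hn n).2
    have h2 := mul_nonneg he0.le (hy0 _ (hn n).1)
    calc _ = Real.exp (C * radNorm ψ ^ 2) * (e * ∫ r in (1 / ((n : ℝ) + 1))..((n : ℝ) + 1),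
          y r / r) := by rw [← mul_assoc, hee, one_mul]
      _ ≤ _ := mul_le_mul_of_nonneg_left (by linarith) (Real.exp_pos _).le
  have hnn : 0 ≤ᵐ[volume.restrict (Ioi (0 : ℝ))] fun r => y r / r := by
    filter_upwards [ae_restrict_mem measurableSet_Ioi] with r hr
    exact div_nonneg (hy0 r hr) (le_of_lt hr)
  have hrestr : ∀ n : ℕ, (volume.restrict (Ioi (0 : ℝ))).restrict
      (Ioc (1 / ((n : ℝ) + 1)) ((n : ℝ) + 1)) =
      volume.restrict (Ioc (1 / ((n : ℝ) + 1)) ((n : ℝ) + 1)) := fun n =>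
    Measure.restrict_restrict_of_subset fun x hx => lt_trans (hn n).1 hx.1
  have hI : IntegrableOn (fun r => y r / r) (Ioi 0) := by
    refine aecover_Ioc_nat.integrable_of_integral_bounded_of_nonneg_ae
      (Real.exp (C * radNorm ψ ^ 2) * (Real.exp (C * radNorm ψ ^ 2) * D + D)) (fun n => ?_) hnn
      (Eventually.of_forall fun n => ?_)
    · rw [IntegrableOn, hrestr]
      exact (intervalIntegrable_iff_integrableOn_Ioc_of_le (hn n).2).1 (hyr _ _ (hn n).1 (hn n).2)
    · rw [hrestr]
      refine (hbd n).trans (mul_le_mul_of_nonneg_left ?_ (Real.exp_pos _).le)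
      have := hsup ((n : ℝ) + 1) (by positivity)
      linarith
  refine ⟨hsup, hI, ?_⟩
  have t1 := aecover_Ioc_nat.integral_tendsto_of_countably_generated hI
  have t2 : Tendsto (fun n : ℕ => Real.exp (C * radNorm ψ ^ 2) * (y ((n : ℝ) + 1) + D)) atTop
      (𝓝 (Real.exp (C * radNorm ψ ^ 2) * (0 + D))) := by
    refine Tendsto.const_mul _ (Tendsto.add_const D (hlim.comp ?_))
    exact tendsto_atTop_add_const_right _ _ tendsto_natCast_atTop_atTop
  rw [zero_add] at t2
  refine le_of_tendsto_of_tendsto' t1 t2 fun n => ?_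
  rw [hrestr]
  exact hbd n

/-! ### The Riccati equation -/

/-- `z` solves the Riccati equation `z' = z / r + (ψ + ψ̄ z²) / 2` on `(0, ∞)` and decays at
infinity. For a Coulomb frame `(v, w)` of a map with profile `u`, this is the equation of the
stereographic coordinate `(v₃ + i w₃) / (1 - u₃)`. -/
structure IsRiccati (ψ z : ℝ → ℂ) : Prop where
  hasACDeriv : HasACDeriv z (fun r => z r / r + (ψ r + star (ψ r) * z r ^ 2) / 2)
  tendsto : Tendsto z atTop (𝓝 0)

theorem IsRiccati.zero : IsRiccati (fun _ => 0) (fun _ => 0) :=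
  ⟨(HasACDeriv.const 0).congr_deriv fun r _ => by simp, tendsto_const_nhds⟩

/-- The height `2 ‖z‖² / (1 + ‖z‖²)` above the pole `-k` decreases at most at the rate
`r ‖ψ‖² / 4`. The factor `ρ` allows for a truncation of the quadratic term. -/
theorem riccati_height_le {ψ z : ℝ → ℂ} {ρ : ℝ → ℝ} (hψ : MemLp ψ 2 radialMeasure)
    (hρ : ∀ r, 0 ≤ ρ r ∧ ρ r ≤ 1)
    (hz : HasACDeriv z (fun r => z r / r + (ψ r + star (ψ r) * (ρ r * z r ^ 2)) / 2))
    (hlim : Tendsto z atTop (𝓝 0)) {r : ℝ} (hr : 0 < r) :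
    2 * (‖z r‖ ^ 2 / (1 + ‖z r‖ ^ 2)) ≤ radNorm ψ ^ 2 / 4 := by
  have hs := hz.norm_sq
  have hpos : ∀ r : ℝ, 0 < 1 + ‖z r‖ ^ 2 := fun r => by positivity
  have hinv := ((HasACDeriv.const (1:ℝ)).add hs).inv fun r _ => (hpos r).ne'
  have hφ := ((HasACDeriv.const (2:ℝ)).sub ((HasACDeriv.const (2:ℝ)).mul hinv)).sub
    ((HasACDeriv.const (1 / 4 : ℝ)).mul (hasACDeriv_tail_sq hψ))
  have hlims : Tendsto (fun r => ‖z r‖ ^ 2) atTop (𝓝 0) := by simpa using hlim.norm.pow 2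
  have hlimφ : Tendsto (fun r => 2 - 2 * (1 + ‖z r‖ ^ 2)⁻¹ -
      1 / 4 * ∫ x in Ioi r, x * ‖ψ x‖ ^ 2) atTop (𝓝 0) := by
    have h1 := (hlims.const_add 1).inv₀ (by norm_num)
    have h2 := (h1.const_mul 2).const_sub 2
    have h3 := h2.sub ((tendsto_tail_zero (MemLp.integrableOn_sq hψ)).const_mul (1 / 4))
    simpa using h3
  have h1 := hφ.le_lim_of_nonneg ?_ hlimφ hr
  · have h2 := tail_sq_le hψ hr.le
    have h3 : 2 * (‖z r‖ ^ 2 / (1 + ‖z r‖ ^ 2)) = 2 - 2 * (1 + ‖z r‖ ^ 2)⁻¹ := by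
      have := (hpos r).ne'
      field_simp; ring
    linarith
  · filter_upwards [ae_restrict_mem measurableSet_Ioi] with r hr
    have hr : 0 < r := hr
    set s := ‖z r‖ ^ 2 with hs
    set p := ‖ψ r‖ with hp
    set x := (star (z r) * ψ r).re with hx
    have hzz : star (z r) * z r = (s : ℂ) := by
      rw [hs, Complex.star_def, ← Complex.normSq_eq_conj_mul_self, Complex.normSq_eq_norm_sq]
    have hre : 2 * (star (z r) * (z r / r + (ψ r + star (ψ r) * (ρ r * z r ^ 2)) / 2)).re =
        2 * s / r + (1 + ρ r * s) * x := by
      have e1 : star (z r) * (z r / r + (ψ r + star (ψ r) * (ρ r * z r ^ 2)) / 2) =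
          ((s / r : ℝ) : ℂ) + (1 / 2 : ℝ) * (star (z r) * ψ r) +
          ((ρ r * s / 2 : ℝ) : ℂ) * star (star (z r) * ψ r) := by
        push_cast
        rw [← hzz]
        simp only [star_mul', star_star]
        ring
      rw [e1]
      simp only [Complex.add_re, Complex.ofReal_re, Complex.re_ofReal_mul, Complex.star_def,
        Complex.conj_re]
      rw [← Complex.star_def, ← hx]
      ring
    rw [hre]
    have hxa : |x| ≤ ‖z r‖ * p := by
      refine (Complex.abs_re_le_norm _).trans ?_
      rw [norm_mul, norm_star]
    have hs0 : 0 ≤ s := by positivity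
    have h1s := hpos r
    have hx2 : -((1 + s) * (‖z r‖ * p)) ≤ (1 + ρ r * s) * x := by
      have h1 : 0 ≤ ρ r * s := mul_nonneg (hρ r).1 hs0
      have h2 : ρ r * s ≤ s := mul_le_of_le_one_left hs0 (hρ r).2
      have h3 : |(1 + ρ r * s) * x| ≤ (1 + s) * (‖z r‖ * p) := by
        rw [abs_mul, abs_of_nonneg (by linarith)]
        exact mul_le_mul (by linarith) hxa (abs_nonneg _) (by linarith)
      linarith [neg_abs_le ((1 + ρ r * s) * x)]
    have key : 0 ≤ 2 * ((2 * s / r - (1 + s) * (‖z r‖ * p)) / (1 + s) ^ 2) + 1 / 4 * (r * p ^ 2) := by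
      have : 2 * ((2 * s / r - (1 + s) * (‖z r‖ * p)) / (1 + s) ^ 2) + 1 / 4 * (r * p ^ 2) =
          (2 * (‖z r‖ / (1 + s)) - r * p / 2) ^ 2 / r := by
        have : s = ‖z r‖ ^ 2 := rfl
        have h1s' : 1 + s ≠ 0 := h1s.ne'
        rw [sub_sq, mul_pow, div_pow, ← this]
        field_simp
        ring
      rw [this]; positivity
    have mono : (2 * s / r - (1 + s) * (‖z r‖ * p)) / (1 + s) ^ 2 ≤
        (2 * s / r + (1 + ρ r * s) * x) / (1 + s) ^ 2 := by
      gcongr; linarith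
    have e2 : -(0 + (2 * s / r + (1 + ρ r * s) * x)) / (1 + s) ^ 2 =
      -((2 * s / r + (1 + ρ r * s) * x) / (1 + s) ^ 2) := by ring
    rw [e2]
    linarith

theorem IsRiccati.norm_sq_le {ψ z : ℝ → ℂ} (hz : IsRiccati ψ z) (hψ : MemLp ψ 2 radialMeasure)
    {r : ℝ} (hr : 0 < r) : 2 * (‖z r‖ ^ 2 / (1 + ‖z r‖ ^ 2)) ≤ radNorm ψ ^ 2 / 4 :=
  riccati_height_le (ρ := fun _ => 1) hψ (fun _ => ⟨zero_le_one, le_rfl⟩)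
    (hz.hasACDeriv.congr_deriv fun r _ => by simp) hz.tendsto hr

/-- The constant in the stability estimate for the Riccati equation. -/
def riccatiConst (K m : ℝ) : ℝ := (1 + K ^ 2) * Real.exp (K ^ 2 * m ^ 2)

theorem riccatiConst_nonneg (K m : ℝ) : 0 ≤ riccatiConst K m := by
  unfold riccatiConst; positivity

/-- Bounded decaying solutions of the Riccati equation depend Lipschitz continuously on `ψ`, both
uniformly and in `L²(dr / r)`. -/
theorem IsRiccati.stability {ψ ψ' z z' : ℝ → ℂ} {K : ℝ} (hz : IsRiccati ψ z)
    (hz' : IsRiccati ψ' z') (hψ : MemLp ψ 2 radialMeasure) (hψ' : MemLp ψ' 2 radialMeasure)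
    (hK : ∀ r, 0 < r → ‖z r‖ ≤ K) (hK' : ∀ r, 0 < r → ‖z' r‖ ≤ K) :
    (∀ r, 0 < r → ‖z r - z' r‖ ≤
      riccatiConst K (radNorm ψ) * radNorm (fun r => ψ r - ψ' r)) ∧
    MemLp (fun r => (z r - z' r) / r) 2 radialMeasure ∧
    radNorm (fun r => (z r - z' r) / r) ≤
      riccatiConst K (radNorm ψ) * radNorm (fun r => ψ r - ψ' r) := by
  have hK0 : 0 ≤ K := (norm_nonneg _).trans (hK 1 one_pos)
  have hd := hz.hasACDeriv.sub hz'.hasACDeriv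
  have hy := hd.norm_sq
  have hm : MemLp (fun r => ψ r - ψ' r) 2 radialMeasure := hψ.sub hψ'
  have hlim : Tendsto (fun r => ‖z r - z' r‖ ^ 2) atTop (𝓝 0) := by
    simpa using (hz.tendsto.sub hz'.tendsto).norm.pow 2
  have hG := gronwall_at_infinity (C := 2 * K ^ 2) hψ (by positivity) hy
    (fun r _ => by positivity) hlim
    (h := fun r => (1 + K ^ 2) ^ 2 / 2 * (r * ‖ψ r - ψ' r‖ ^ 2))
    ((MemLp.integrableOn_sq hm).const_mul _) (fun r hr => by positivity) ?_
  · rw [integral_const_mul, ← radNorm_sq hm] at hG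
    obtain ⟨h1, h2, h3⟩ := hG
    have hR := riccatiConst_nonneg K (radNorm ψ)
    have hN := radNorm_nonneg (fun r => ψ r - ψ' r)
    have hc : Real.exp (2 * K ^ 2 * radNorm ψ ^ 2) * ((1 + K ^ 2) ^ 2 / 2 *
        radNorm (fun r => ψ r - ψ' r) ^ 2) ≤
        (riccatiConst K (radNorm ψ) * radNorm (fun r => ψ r - ψ' r)) ^ 2 := by
      have : Real.exp (2 * K ^ 2 * radNorm ψ ^ 2) = Real.exp (K ^ 2 * radNorm ψ ^ 2) ^ 2 := by
        rw [← Real.exp_nat_mul]; congr 1; push_cast; ring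
      rw [riccatiConst, this]
      have : 0 ≤ Real.exp (K ^ 2 * radNorm ψ ^ 2) ^ 2 * ((1 + K ^ 2) ^ 2 / 2 *
        radNorm (fun r => ψ r - ψ' r) ^ 2) := by positivity
      nlinarith
    have hmeas : AEStronglyMeasurable (fun r => (z r - z' r) / (r : ℂ))
        (volume.restrict (Ioi 0)) := by
      refine ContinuousOn.aestronglyMeasurable (hd.continuousOn.div
        Complex.continuous_ofReal.continuousOn fun r hr => ?_) measurableSet_Ioi
      exact_mod_cast ne_of_gt (show (0:ℝ) < r from hr)
    have hcongr : ∀ r ∈ Ioi (0:ℝ), ‖z r - z' r‖ ^ 2 / r = r * ‖(z r - z' r) / (r : ℂ)‖ ^ 2 := by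
      intro r hr
      have hr : (0:ℝ) < r := hr
      rw [norm_div, Complex.norm_real, Real.norm_of_nonneg hr.le]
      field_simp
    have hmem : MemLp (fun r => (z r - z' r) / (r : ℂ)) 2 radialMeasure := by
      rw [memLp_radial_iff hmeas]
      exact h2.congr_fun hcongr measurableSet_Ioi
    refine ⟨fun r hr => ?_, hmem, ?_⟩
    · exact abs_le_of_sq_le_sq' ((h1 r hr).trans hc) (by positivity) |>.2
    · refine abs_le_of_sq_le_sq' ?_ (by positivity) |>.2
      rw [radNorm_sq hmem, ← setIntegral_congr_fun measurableSet_Ioi hcongr]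
      exact h3.trans hc
  · filter_upwards [ae_restrict_mem measurableSet_Ioi] with r hr
    have hr : 0 < r := hr
    set δ := z r - z' r with hδ
    set p := ‖ψ r‖ with hp
    set η := ψ r - ψ' r with hη
    have hδδ : star δ * δ = ((‖δ‖ ^ 2 : ℝ) : ℂ) := by
      rw [Complex.star_def, ← Complex.normSq_eq_conj_mul_self, Complex.normSq_eq_norm_sq]
    have e1 : 2 * (star δ * (z r / r + (ψ r + star (ψ r) * z r ^ 2) / 2 -
        (z' r / r + (ψ' r + star (ψ' r) * z' r ^ 2) / 2))).re =
        2 * (‖δ‖ ^ 2 / r) + ‖δ‖ ^ 2 * (star (ψ r) * (z r + z' r)).re +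
        (star δ * (η + star η * z' r ^ 2)).re := by
      have : star δ * (z r / r + (ψ r + star (ψ r) * z r ^ 2) / 2 -
        (z' r / r + (ψ' r + star (ψ' r) * z' r ^ 2) / 2)) =
        ((‖δ‖ ^ 2 / r : ℝ) : ℂ) + ((‖δ‖ ^ 2 / 2 : ℝ) : ℂ) * (star (ψ r) * (z r + z' r)) +
        ((1 / 2 : ℝ) : ℂ) * (star δ * (η + star η * z' r ^ 2)) := by
        have t1 : ((‖δ‖ ^ 2 / r : ℝ) : ℂ) = star δ * δ / r := by rw [hδδ]; push_cast; ring
        have t2 : ((‖δ‖ ^ 2 / 2 : ℝ) : ℂ) = star δ * δ / 2 := by rw [hδδ]; push_cast; ring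
        have t3 : star η = star (ψ r) - star (ψ' r) := star_sub _ _
        rw [t1, t2, t3, hη]
        push_cast
        rw [hδ]; ring
      rw [this]
      simp only [Complex.add_re, Complex.ofReal_re, Complex.re_ofReal_mul]
      ring
    rw [e1]
    have b1 : |(star (ψ r) * (z r + z' r)).re| ≤ p * (2 * K) := by
      refine (Complex.abs_re_le_norm _).trans ?_
      rw [norm_mul, norm_star]
      refine mul_le_mul_of_nonneg_left ((norm_add_le _ _).trans ?_) (norm_nonneg _)
      linarith [hK r hr, hK' r hr]
    have b2 : |(star δ * (η + star η * z' r ^ 2)).re| ≤ ‖δ‖ * (‖η‖ * (1 + K ^ 2)) := by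
      refine (Complex.abs_re_le_norm _).trans ?_
      rw [norm_mul, norm_star]
      refine mul_le_mul_of_nonneg_left ((norm_add_le _ _).trans ?_) (norm_nonneg _)
      rw [norm_mul, norm_star, norm_pow]
      have := hK' r hr
      have : ‖z' r‖ ^ 2 ≤ K ^ 2 := by gcongr
      nlinarith [norm_nonneg η]
    have b1' := (abs_le.1 b1).1
    have b2' := (abs_le.1 b2).1
    have c1 : ‖δ‖ ^ 2 * (-(p * (2 * K))) ≤ ‖δ‖ ^ 2 * (star (ψ r) * (z r + z' r)).re :=
      mul_le_mul_of_nonneg_left b1' (sq_nonneg _)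
    -- Young's inequality, splitting one half of `‖δ‖² / r` off for each of the two error terms
    have y1 : 2 * K * p ≤ 1 / (2 * r) + 2 * K ^ 2 * (r * p ^ 2) := by
      have : 1 / (2 * r) + 2 * K ^ 2 * (r * p ^ 2) - 2 * K * p = (1 - 2 * K * r * p) ^ 2 / (2 * r) := by
        field_simp; ring
      have : 0 ≤ (1 - 2 * K * r * p) ^ 2 / (2 * r) := by positivity
      linarith
    have y2 : ‖δ‖ * (‖η‖ * (1 + K ^ 2)) ≤
        ‖δ‖ ^ 2 / (2 * r) + (1 + K ^ 2) ^ 2 / 2 * (r * ‖η‖ ^ 2) := by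
      have : ‖δ‖ ^ 2 / (2 * r) + (1 + K ^ 2) ^ 2 / 2 * (r * ‖η‖ ^ 2) -
          ‖δ‖ * (‖η‖ * (1 + K ^ 2)) = (‖δ‖ - r * ‖η‖ * (1 + K ^ 2)) ^ 2 / (2 * r) := by
        field_simp; ring
      have : 0 ≤ (‖δ‖ - r * ‖η‖ * (1 + K ^ 2)) ^ 2 / (2 * r) := by positivity
      linarith
    have y3 := mul_le_mul_of_nonneg_left y1 (sq_nonneg ‖δ‖)
    have y4 : ‖δ‖ ^ 2 * (1 / (2 * r) + 2 * K ^ 2 * (r * p ^ 2)) =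
      ‖δ‖ ^ 2 / (2 * r) + 2 * K ^ 2 * (r * p ^ 2) * ‖δ‖ ^ 2 := by ring
    have y5 : ‖δ‖ ^ 2 / r = ‖δ‖ ^ 2 / (2 * r) + ‖δ‖ ^ 2 / (2 * r) := by field_simp; ring
    linarith

/-! ### Existence for the Riccati equation -/

theorem integrableOn_rpow_neg_three {r : ℝ} (hr : 0 < r) :
    IntegrableOn (fun s : ℝ => s ^ (-3 : ℝ)) (Ioi r) ∧
      ∫ s in Ioi r, s ^ (-3 : ℝ) = 1 / (2 * r ^ 2) := by
  refine ⟨integrableOn_Ioi_rpow_of_lt (by norm_num) hr, ?_⟩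
  rw [integral_Ioi_rpow_of_lt (by norm_num) hr]
  have : r ^ ((-3:ℝ) + 1) = (r ^ 2)⁻¹ := by
    rw [show (-3:ℝ) + 1 = -(2:ℕ) by norm_num, Real.rpow_neg hr.le, Real.rpow_natCast]
  rw [this]; field_simp; norm_num

theorem norm_div_le_young {F : Type*} [NormedAddCommGroup F] (f : F) {κ s : ℝ} (hκ : 0 < κ)
    (hs : 0 < s) : ‖f‖ / s ≤ 1 / 2 * (κ * (s * ‖f‖ ^ 2) + κ⁻¹ * s ^ (-3 : ℝ)) := by
  have : s ^ (-3:ℝ) = (s ^ 3)⁻¹ := by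
    rw [show (-3:ℝ) = -(3:ℕ) by norm_num, Real.rpow_neg hs.le, Real.rpow_natCast]
  rw [this]
  have e : 1 / 2 * (κ * (s * ‖f‖ ^ 2) + κ⁻¹ * (s ^ 3)⁻¹) - ‖f‖ / s =
      (κ * s ^ 2 * ‖f‖ - 1) ^ 2 / (2 * κ * s ^ 3) := by field_simp; ring
  have : 0 ≤ (κ * s ^ 2 * ‖f‖ - 1) ^ 2 / (2 * κ * s ^ 3) := by positivity
  linarith

/-- A Hardy-type bound for the tail operator `f ↦ r ∫_r^∞ ‖f‖ / s`, in the form of Young's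
inequality with a free parameter `κ`. -/
theorem tail_hardy {F : Type*} [NormedAddCommGroup F] {f : ℝ → F} (hf : MemLp f 2 radialMeasure)
    {r κ : ℝ} (hr : 0 < r) (hκ : 0 < κ) :
    IntegrableOn (fun s => ‖f s‖ / s) (Ioi r) ∧
      r * ∫ s in Ioi r, ‖f s‖ / s ≤
        1 / 2 * (κ * (∫ s in Ioi r, s * ‖f s‖ ^ 2) + 1 / (2 * κ)) := by
  have hi3 := integrableOn_rpow_neg_three hr
  have hi2 : IntegrableOn (fun s => s * ‖f s‖ ^ 2) (Ioi r) :=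
    (MemLp.integrableOn_sq hf).mono_set (Ioi_subset_Ioi hr.le)
  have hκ' : 0 < κ / r := div_pos hκ hr
  have hI : IntegrableOn (fun s => 1 / 2 * (κ / r * (s * ‖f s‖ ^ 2) +
      (κ / r)⁻¹ * s ^ (-3 : ℝ))) (Ioi r) :=
    ((hi2.const_mul _).add (hi3.1.const_mul _)).const_mul _
  have hle : ∀ s ∈ Ioi r, ‖f s‖ / s ≤ 1 / 2 * (κ / r * (s * ‖f s‖ ^ 2) +
      (κ / r)⁻¹ * s ^ (-3 : ℝ)) := fun s hs => norm_div_le_young _ hκ' (hr.trans hs)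
  have hmeas : AEStronglyMeasurable (fun s => ‖f s‖ / s) (volume.restrict (Ioi r)) := by
    have := (MemLp.aesm hf).mono_set (Ioi_subset_Ioi hr.le)
    exact (this.norm.aemeasurable.div measurable_id.aemeasurable).aestronglyMeasurable
  have hint : IntegrableOn (fun s => ‖f s‖ / s) (Ioi r) := by
    refine hI.mono' hmeas ((ae_restrict_iff' measurableSet_Ioi).2 (Eventually.of_forall ?_))
    intro s hs
    rw [Real.norm_of_nonneg (div_nonneg (norm_nonneg _) (hr.trans hs).le)]
    exact hle s hs
  refine ⟨hint, ?_⟩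
  have h1 := setIntegral_mono_on hint hI measurableSet_Ioi hle
  rw [integral_const_mul, integral_add (hi2.const_mul _) (hi3.1.const_mul _),
    integral_const_mul, integral_const_mul, hi3.2] at h1
  refine (mul_le_mul_of_nonneg_left h1 hr.le).trans (le_of_eq ?_)
  field_simp

/-- The radial retraction of `ℂ` onto the closed ball of radius `K`. -/
def retract (K : ℝ) (z : ℂ) : ℂ := ((max 1 (‖z‖ / K))⁻¹ : ℝ) • z

theorem norm_retract_le {K : ℝ} (hK : 0 < K) (z : ℂ) : ‖retract K z‖ ≤ K := by
  have h1 : 0 < max 1 (‖z‖ / K) := lt_max_of_lt_left one_pos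
  rw [retract, norm_smul, norm_inv, Real.norm_of_nonneg h1.le, inv_mul_le_iff₀ h1]
  calc ‖z‖ = ‖z‖ / K * K := by field_simp
    _ ≤ _ := mul_le_mul_of_nonneg_right (le_max_right _ _) hK.le

theorem norm_retract_sub_le {K : ℝ} (hK : 0 < K) (z w : ℂ) :
    ‖retract K z - retract K w‖ ≤ 2 * ‖z - w‖ := by
  have hz : 1 ≤ max 1 (‖z‖ / K) := le_max_left _ _
  have hw : 1 ≤ max 1 (‖w‖ / K) := le_max_left _ _
  have hm : |max 1 (‖w‖ / K) - max 1 (‖z‖ / K)| ≤ ‖z - w‖ / K := by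
    have h1 := abs_max_sub_max_le_abs (‖w‖ / K) (‖z‖ / K) 1
    rw [max_comm _ (1:ℝ), max_comm _ (1:ℝ)] at h1
    refine h1.trans ?_
    rw [← sub_div, abs_div, abs_of_pos hK, norm_sub_rev]
    gcongr
    exact abs_norm_sub_norm_le w z
  have hwK := norm_retract_le hK w
  set a := max 1 (‖z‖ / K) with ha
  set b := max 1 (‖w‖ / K) with hb
  have ha0 : 0 < a := by linarith
  have hb0 : 0 < b := by linarith
  have e : retract K z - retract K w =
      (a⁻¹ : ℝ) • (z - w) + (a⁻¹ * (b - a) : ℝ) • retract K w := by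
    simp only [retract, ← ha, ← hb, smul_smul, smul_sub]
    rw [show a⁻¹ * (b - a) * b⁻¹ = a⁻¹ - b⁻¹ by field_simp, sub_smul]
    abel
  have hai : a⁻¹ ≤ 1 := inv_le_one_of_one_le₀ hz
  have hai0 : 0 ≤ a⁻¹ := by positivity
  rw [e]
  refine (norm_add_le _ _).trans ?_
  rw [norm_smul, norm_smul, norm_mul, Real.norm_of_nonneg hai0, Real.norm_eq_abs]
  have h1 : a⁻¹ * ‖z - w‖ ≤ 1 * ‖z - w‖ := mul_le_mul_of_nonneg_right hai (norm_nonneg _)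
  have h2 : a⁻¹ * |b - a| * ‖retract K w‖ ≤ 1 * (‖z - w‖ / K) * K := by
    gcongr
  have h3 : 1 * (‖z - w‖ / K) * K = ‖z - w‖ := by field_simp
  linarith

theorem continuous_retract {K : ℝ} (hK : 0 < K) : Continuous (retract K) := by
  have : LipschitzWith 2 (retract K) := LipschitzWith.of_dist_le_mul fun z w => by
    simpa [dist_eq_norm] using norm_retract_sub_le hK z w
  exact this.continuous

theorem norm_retract_sq_sub_le {K : ℝ} (hK : 0 < K) (z w : ℂ) :
    ‖retract K z ^ 2 - retract K w ^ 2‖ ≤ 4 * K * ‖z - w‖ := by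
  rw [sq_sub_sq, norm_mul]
  have h1 := norm_retract_sub_le hK z w
  have h2 : ‖retract K z + retract K w‖ ≤ 2 * K := by
    refine (norm_add_le _ _).trans ?_
    linarith [norm_retract_le hK z, norm_retract_le hK w]
  calc _ ≤ (2 * K) * (2 * ‖z - w‖) := by gcongr
    _ = _ := by ring

theorem retract_sq_eq {K : ℝ} (z : ℂ) :
    retract K z ^ 2 = ((max 1 (‖z‖ / K))⁻¹ ^ 2 : ℝ) * z ^ 2 := by
  rw [retract, Complex.real_smul, mul_pow]; push_cast; ring

theorem retract_eq_self {K : ℝ} (hK : 0 < K) {z : ℂ} (hz : ‖z‖ ≤ K) : retract K z = z := by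
  have : ‖z‖ / K ≤ 1 := (div_le_one hK).2 hz
  simp [retract, max_eq_left this]

/-- The exponential weight `exp (l ∫_r^∞ s ‖ψ‖²)`, which makes the integral form of the truncated
Riccati equation a contraction on the whole half-line. -/
def expWeight (ψ : ℝ → ℂ) (l r : ℝ) : ℝ := Real.exp (l * ∫ x in Ioi r, x * ‖ψ x‖ ^ 2)

theorem expWeight_pos (ψ : ℝ → ℂ) (l r : ℝ) : 0 < expWeight ψ l r := Real.exp_pos _

/-- The right-hand side of the integral form of the truncated Riccati equation. -/
def riccatiIntegral (ψ : ℝ → ℂ) (K : ℝ) (z : ℝ → ℂ) (r : ℝ) : ℂ :=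
  -(r * ∫ s in Ioi r, (ψ s + star (ψ s) * retract K (z s) ^ 2) / (2 * s))

section Existence

variable {ψ : ℝ → ℂ} {K l : ℝ}

theorem expWeight_hasACDeriv (hψ : MemLp ψ 2 radialMeasure) : HasACDeriv (expWeight ψ l)
    (fun r => -(l * (r * ‖ψ r‖ ^ 2)) * expWeight ψ l r) :=
  (((HasACDeriv.const l).mul (hasACDeriv_tail_sq hψ)).rexp).congr_deriv fun r _ => by
    simp only [expWeight]; ring

theorem one_le_expWeight (hl : 0 ≤ l) {r : ℝ} (hr : 0 < r) : 1 ≤ expWeight ψ l r :=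
  Real.one_le_exp (mul_nonneg hl (tail_sq_nonneg ψ hr.le))

theorem expWeight_le (hψ : MemLp ψ 2 radialMeasure) (hl : 0 ≤ l) {r : ℝ} (hr : 0 < r) :
    expWeight ψ l r ≤ Real.exp (l * radNorm ψ ^ 2) :=
  Real.exp_le_exp.2 (mul_le_mul_of_nonneg_left (tail_sq_le hψ hr.le) hl)

theorem memLp_expWeight_mul (hψ : MemLp ψ 2 radialMeasure) (hl : 0 ≤ l) :
    MemLp (fun r => expWeight ψ l r * ‖ψ r‖) 2 radialMeasure := by
  refine (radNorm_le_mul (C := Real.exp (l * radNorm ψ ^ 2)) ?_ hψ (Real.exp_pos _).le ?_).1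
  · exact ((expWeight_hasACDeriv hψ).continuousOn.aestronglyMeasurable measurableSet_Ioi).mul
      (MemLp.aesm hψ).norm
  · filter_upwards [ae_restrict_mem measurableSet_Ioi] with r hr
    rw [norm_mul, norm_norm, Real.norm_of_nonneg (expWeight_pos ψ l r).le]
    exact mul_le_mul_of_nonneg_right (expWeight_le hψ hl hr) (norm_nonneg _)

/-- Minus the derivative of the squared weight is `2 l` times the integrand. -/
theorem integral_expWeight_sq_le (hψ : MemLp ψ 2 radialMeasure) (hl : 0 < l) {r : ℝ} (hr : 0 < r) :
    ∫ s in Ioi r, s * ‖expWeight ψ l s * ‖ψ s‖‖ ^ 2 ≤ expWeight ψ l r ^ 2 / (2 * l) := by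
  have hm := memLp_expWeight_mul hψ hl.le
  have hE := expWeight_hasACDeriv (l := l) hψ
  have hd : HasACDeriv (fun r => (2 * l)⁻¹ * (expWeight ψ l r * expWeight ψ l r) -
      ∫ s in Ioi r, s * ‖expWeight ψ l s * ‖ψ s‖‖ ^ 2) (fun _ => 0) := by
    refine (((HasACDeriv.const (2 * l)⁻¹).mul (hE.mul hE)).sub
      (hasACDeriv_tail_sq hm)).congr_deriv fun r _ => ?_
    rw [norm_mul, mul_pow, norm_norm, Real.norm_eq_abs, sq_abs]
    field_simp
    ring
  have hlim : Tendsto (fun r => (2 * l)⁻¹ * (expWeight ψ l r * expWeight ψ l r) -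
      ∫ s in Ioi r, s * ‖expWeight ψ l s * ‖ψ s‖‖ ^ 2) atTop (𝓝 (2 * l)⁻¹) := by
    have h1 := (tendsto_tail_zero (MemLp.integrableOn_sq hψ)).const_mul l
    have h2 : Tendsto (expWeight ψ l) atTop (𝓝 (Real.exp (l * 0))) :=
      (Real.continuous_exp.tendsto _).comp h1
    have h3 := ((h2.mul h2).const_mul (2 * l)⁻¹).sub
      (tendsto_tail_zero (MemLp.integrableOn_sq hm))
    simpa using h3
  have h := hd.eq_lim_of_zero hlim hr
  have : 0 ≤ (2 * l)⁻¹ := by positivity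
  have e : expWeight ψ l r ^ 2 / (2 * l) = (2 * l)⁻¹ * (expWeight ψ l r * expWeight ψ l r) := by
    field_simp
  rw [e]; linarith

theorem norm_riccati_integrand_le (hK : 0 < K) (z : ℝ → ℂ) {s : ℝ} (hs : 0 < s) :
    ‖(ψ s + star (ψ s) * retract K (z s) ^ 2) / (2 * (s : ℂ))‖ ≤
      (1 + K ^ 2) / 2 * (‖ψ s‖ / s) := by
  have h1 : ‖ψ s + star (ψ s) * retract K (z s) ^ 2‖ ≤ ‖ψ s‖ * (1 + K ^ 2) := by
    refine (norm_add_le _ _).trans ?_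
    rw [norm_mul, norm_star, norm_pow]
    have : ‖retract K (z s)‖ ^ 2 ≤ K ^ 2 := by gcongr; exact norm_retract_le hK _
    nlinarith [norm_nonneg (ψ s)]
  rw [norm_div, norm_mul, Complex.norm_real, Real.norm_of_nonneg hs.le]
  simp only [Complex.norm_ofNat]
  calc _ ≤ ‖ψ s‖ * (1 + K ^ 2) / (2 * s) := by gcongr
    _ = _ := by ring

theorem integrableOn_riccati_integrand (hψ : MemLp ψ 2 radialMeasure) (hK : 0 < K)
    {z : ℝ → ℂ} (hz : ContinuousOn z (Ioi 0)) {r : ℝ} (hr : 0 < r) :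
    IntegrableOn (fun s : ℝ => (ψ s + star (ψ s) * retract K (z s) ^ 2) / (2 * (s : ℂ)))
      (Ioi r) := by
  have h1 := (tail_hardy hψ hr one_pos).1.const_mul ((1 + K ^ 2) / 2)
  refine h1.mono' ?_ ((ae_restrict_iff' measurableSet_Ioi).2 (Eventually.of_forall
    fun s hs => norm_riccati_integrand_le hK z (hr.trans hs)))
  have hm := (MemLp.aesm hψ)
  have hzm : AEStronglyMeasurable (fun s => retract K (z s)) (volume.restrict (Ioi 0)) :=
    ((continuous_retract hK).comp_continuousOn hz).aestronglyMeasurable measurableSet_Ioi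
  have h2 : AEStronglyMeasurable (fun s : ℝ => (ψ s + star (ψ s) * retract K (z s) ^ 2) /
      (2 * (s : ℂ))) (volume.restrict (Ioi 0)) := by
    have h3 : AEMeasurable (fun s : ℝ => 2 * (s : ℂ)) (volume.restrict (Ioi 0)) :=
      (by fun_prop : Measurable fun s : ℝ => 2 * (s : ℂ)).aemeasurable
    exact ((hm.add (hm.star.mul (hzm.pow 2))).aemeasurable.div h3).aestronglyMeasurable
  exact h2.mono_set (Ioi_subset_Ioi hr.le)

theorem riccatiIntegral_hasACDeriv (hψ : MemLp ψ 2 radialMeasure) (hK : 0 < K)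
    {z : ℝ → ℂ} (hz : ContinuousOn z (Ioi 0)) :
    HasACDeriv (riccatiIntegral ψ K z) (fun r => riccatiIntegral ψ K z r / r +
      (ψ r + star (ψ r) * retract K (z r) ^ 2) / 2) := by
  have h1 := HasACDeriv.tail fun r hr => integrableOn_riccati_integrand hψ hK hz hr
  have hid : HasACDeriv (fun r : ℝ => (r : ℂ)) (fun _ => 1) :=
    HasACDeriv.of_hasDerivAt (fun r _ => Complex.ofRealCLM.hasDerivAt) continuousOn_const
  refine (hid.mul h1).neg.congr_deriv fun r hr => ?_
  have : (r : ℂ) ≠ 0 := by exact_mod_cast hr.ne'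
  rw [riccatiIntegral]
  field_simp
  ring

theorem norm_riccatiIntegral_le (hψ : MemLp ψ 2 radialMeasure) (hK : 0 < K)
    {z : ℝ → ℂ} {r κ : ℝ} (hr : 0 < r) (hκ : 0 < κ) :
    ‖riccatiIntegral ψ K z r‖ ≤ (1 + K ^ 2) / 2 *
      (1 / 2 * (κ * (∫ s in Ioi r, s * ‖ψ s‖ ^ 2) + 1 / (2 * κ))) := by
  obtain ⟨h1, h2⟩ := tail_hardy hψ hr hκ
  rw [riccatiIntegral, norm_neg, norm_mul, Complex.norm_real, Real.norm_of_nonneg hr.le]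
  have h3 := norm_integral_le_of_norm_le (h1.const_mul ((1 + K ^ 2) / 2))
    ((ae_restrict_iff' measurableSet_Ioi).2 (Eventually.of_forall
    fun s hs => norm_riccati_integrand_le (ψ := ψ) hK z (hr.trans hs)))
  rw [integral_const_mul] at h3
  calc _ ≤ r * ((1 + K ^ 2) / 2 * ∫ s in Ioi r, ‖ψ s‖ / s) := by gcongr
    _ = (1 + K ^ 2) / 2 * (r * ∫ s in Ioi r, ‖ψ s‖ / s) := by ring
    _ ≤ _ := by gcongr

theorem tendsto_riccatiIntegral (hψ : MemLp ψ 2 radialMeasure) (hK : 0 < K) (z : ℝ → ℂ) :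
    Tendsto (riccatiIntegral ψ K z) atTop (𝓝 0) := by
  have hP := tendsto_tail_zero (MemLp.integrableOn_sq hψ)
  have h1 : Tendsto (fun r : ℝ => (1 + K ^ 2) / 2 *
      √((∫ s in Ioi r, s * ‖ψ s‖ ^ 2) + r⁻¹)) atTop (𝓝 0) := by
    have := (((Real.continuous_sqrt.tendsto _).comp
      (hP.add tendsto_inv_atTop_zero)).const_mul ((1 + K ^ 2) / 2))
    simpa using this
  refine squeeze_zero_norm' ?_ h1
  filter_upwards [eventually_gt_atTop 0] with r hr
  set P := ∫ s in Ioi r, s * ‖ψ s‖ ^ 2 with hPd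
  have hP0 : 0 ≤ P := tail_sq_nonneg ψ hr.le
  have hq : 0 < P + r⁻¹ := by positivity
  -- the two terms in the Hardy bound balance for `κ = (P + r⁻¹)^(-1/2)`
  have h2 := norm_riccatiIntegral_le (z := z) hψ hK hr (inv_pos.2 (Real.sqrt_pos.2 hq))
  refine h2.trans (mul_le_mul_of_nonneg_left ?_ (by positivity))
  rw [← hPd]
  have hs := Real.sqrt_pos.2 hq
  have hss := Real.mul_self_sqrt hq.le
  set t := √(P + r⁻¹)
  have : P ≤ t * t := by rw [hss]; linarith [inv_pos.2 hr]
  have e1 : t⁻¹ * P ≤ t := by rw [inv_mul_le_iff₀ hs]; exact this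
  have e2 : 1 / (2 * t⁻¹) = t / 2 := by field_simp
  rw [e2]; linarith

/-- The extension by zero to the line of a function on the half-line. -/
def extendZero (y : Ioi (0 : ℝ) → ℂ) (r : ℝ) : ℂ := if h : 0 < r then y ⟨r, h⟩ else 0

theorem continuousOn_extendZero {y : Ioi (0 : ℝ) → ℂ} (hy : Continuous y) :
    ContinuousOn (extendZero y) (Ioi 0) := by
  rw [continuousOn_iff_continuous_domRestrict]
  convert hy using 1
  ext ⟨r, hr⟩
  have : (0:ℝ) < r := hr
  simp [extendZero, this]

/-- The contraction whose fixed point, multiplied by the weight, solves the truncated equation. -/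
def riccatiMap (ψ : ℝ → ℂ) (K l : ℝ) (y : Ioi (0 : ℝ) → ℂ) (r : ℝ) : ℂ :=
  ((expWeight ψ l r)⁻¹ : ℝ) * riccatiIntegral ψ K (fun s => expWeight ψ l s * extendZero y s) r

theorem norm_riccatiIntegral_sub_le (hψ : MemLp ψ 2 radialMeasure) (hK : 0 < K)
    (y y' : BoundedContinuousFunction (Ioi (0 : ℝ)) ℂ) {r : ℝ} (hr : 0 < r) :
    ‖riccatiIntegral ψ K (fun s => expWeight ψ (4 * K ^ 2) s * extendZero y s) r -
      riccatiIntegral ψ K (fun s => expWeight ψ (4 * K ^ 2) s * extendZero y' s) r‖ ≤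
      expWeight ψ (4 * K ^ 2) r * (1 / 2 * ‖y - y'‖) := by
  set l := 4 * K ^ 2 with hl
  have hl0 : 0 < l := by positivity
  have hE := expWeight_hasACDeriv (l := l) hψ
  have hc : ∀ y : BoundedContinuousFunction (Ioi (0 : ℝ)) ℂ,
      ContinuousOn (fun s => (expWeight ψ l s : ℂ) * extendZero y s) (Ioi 0) := fun y =>
    (Complex.continuous_ofReal.comp_continuousOn hE.continuousOn).mul
      (continuousOn_extendZero y.continuous)
  have h1 := integrableOn_riccati_integrand hψ hK (hc y) hr
  have h2 := integrableOn_riccati_integrand hψ hK (hc y') hr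
  have hω : 0 < expWeight ψ l r := Real.exp_pos _
  obtain ⟨h3, h4⟩ := tail_hardy (memLp_expWeight_mul hψ hl0.le) hr
    (κ := 2 * K / expWeight ψ l r) (by positivity)
  have e : riccatiIntegral ψ K (fun s => expWeight ψ l s * extendZero y s) r -
      riccatiIntegral ψ K (fun s => expWeight ψ l s * extendZero y' s) r = -(r * ∫ s in Ioi r,
      ((ψ s + star (ψ s) * retract K (expWeight ψ l s * extendZero y s) ^ 2) / (2 * (s : ℂ)) -
      (ψ s + star (ψ s) * retract K (expWeight ψ l s * extendZero y' s) ^ 2) / (2 * (s : ℂ)))) := by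
    rw [integral_sub h1 h2, riccatiIntegral, riccatiIntegral]; ring
  have hpt : ∀ s ∈ Ioi r,
      ‖(ψ s + star (ψ s) * retract K (expWeight ψ l s * extendZero y s) ^ 2) / (2 * (s : ℂ)) -
      (ψ s + star (ψ s) * retract K (expWeight ψ l s * extendZero y' s) ^ 2) / (2 * (s : ℂ))‖ ≤
      2 * K * ‖y - y'‖ * (‖expWeight ψ l s * ‖ψ s‖‖ / s) := by
    intro s hs
    have hs0 : 0 < s := hr.trans hs
    have e2 : (ψ s + star (ψ s) * retract K (expWeight ψ l s * extendZero y s) ^ 2) /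
        (2 * (s : ℂ)) -
        (ψ s + star (ψ s) * retract K (expWeight ψ l s * extendZero y' s) ^ 2) / (2 * (s : ℂ)) =
        star (ψ s) * (retract K (expWeight ψ l s * extendZero y s) ^ 2 -
        retract K (expWeight ψ l s * extendZero y' s) ^ 2) / (2 * (s : ℂ)) := by ring
    have h5 := norm_retract_sq_sub_le hK (expWeight ψ l s * extendZero y s)
      (expWeight ψ l s * extendZero y' s)
    have hωs : 0 < expWeight ψ l s := Real.exp_pos _
    have h6 : ‖(expWeight ψ l s : ℂ) * extendZero y s - expWeight ψ l s * extendZero y' s‖ ≤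
        expWeight ψ l s * ‖y - y'‖ := by
      rw [← mul_sub, norm_mul, Complex.norm_real, Real.norm_of_nonneg hωs.le]
      gcongr
      simpa [extendZero, hs0] using (y - y').norm_coe_le_norm ⟨s, hs0⟩
    rw [e2, norm_div, norm_mul, norm_star, norm_mul, Complex.norm_real,
      Real.norm_of_nonneg hs0.le, norm_mul, norm_norm, Real.norm_of_nonneg hωs.le]
    simp only [Complex.norm_ofNat]
    calc _ ≤ ‖ψ s‖ * (4 * K * (expWeight ψ l s * ‖y - y'‖)) / (2 * s) := by
          gcongr
          exact h5.trans (by gcongr)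
      _ = _ := by field_simp; ring
  have h7 := norm_integral_le_of_norm_le (h3.const_mul (2 * K * ‖y - y'‖))
    ((ae_restrict_iff' measurableSet_Ioi).2 (Eventually.of_forall hpt))
  rw [integral_const_mul] at h7
  rw [e, norm_neg, norm_mul, Complex.norm_real, Real.norm_of_nonneg hr.le]
  have h8 := integral_expWeight_sq_le hψ hl0 hr
  calc _ ≤ r * (2 * K * ‖y - y'‖ * ∫ s in Ioi r, ‖expWeight ψ l s * ‖ψ s‖‖ / s) := by gcongr
    _ = 2 * K * ‖y - y'‖ * (r * ∫ s in Ioi r, ‖expWeight ψ l s * ‖ψ s‖‖ / s) := by ring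
    _ ≤ 2 * K * ‖y - y'‖ * (1 / 2 * (2 * K / expWeight ψ l r *
        (expWeight ψ l r ^ 2 / (2 * l)) + 1 / (2 * (2 * K / expWeight ψ l r)))) := by
      refine mul_le_mul_of_nonneg_left (h4.trans ?_) (by positivity)
      gcongr
    _ = _ := by rw [hl]; field_simp; ring

/-- The truncated Riccati equation has a solution decaying at infinity, on all of `(0, ∞)` and
without a restriction on the size of `ψ`. -/
theorem exists_truncated_riccati (hψ : MemLp ψ 2 radialMeasure) (hK : 0 < K) :
    ∃ z : ℝ → ℂ, HasACDeriv z (fun r => z r / r +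
      (ψ r + star (ψ r) * retract K (z r) ^ 2) / 2) ∧ Tendsto z atTop (𝓝 0) := by
  set l := 4 * K ^ 2 with hl
  have hl0 : 0 < l := by positivity
  have hE := expWeight_hasACDeriv (l := l) hψ
  have hωp : ∀ r, 0 < expWeight ψ l r := fun r => Real.exp_pos _
  have hc : ∀ y : BoundedContinuousFunction (Ioi (0 : ℝ)) ℂ,
      ContinuousOn (fun s => (expWeight ψ l s : ℂ) * extendZero y s) (Ioi 0) := fun y =>
    (Complex.continuous_ofReal.comp_continuousOn hE.continuousOn).mul
      (continuousOn_extendZero y.continuous)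
  have hcont : ∀ y : BoundedContinuousFunction (Ioi (0 : ℝ)) ℂ,
      ContinuousOn (riccatiMap ψ K l y) (Ioi 0) := fun y =>
    (Complex.continuous_ofReal.comp_continuousOn (hE.continuousOn.inv₀ fun r _ => (hωp r).ne')).mul
      (riccatiIntegral_hasACDeriv hψ hK (hc y)).continuousOn
  set B := (1 + K ^ 2) / 2 * (1 / 2 * (1 * radNorm ψ ^ 2 + 1 / (2 * 1))) with hB
  have hbd : ∀ (y : BoundedContinuousFunction (Ioi (0 : ℝ)) ℂ) (r : Ioi (0 : ℝ)),
      ‖riccatiMap ψ K l y r‖ ≤ B := by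
    intro y r
    have hr : (0:ℝ) < r := r.2
    have h1 := norm_riccatiIntegral_le (z := fun s => expWeight ψ l s * extendZero y s)
      hψ hK hr one_pos
    have h2 : (expWeight ψ l r)⁻¹ ≤ 1 := inv_le_one_of_one_le₀ (one_le_expWeight hl0.le hr)
    rw [riccatiMap, norm_mul, Complex.norm_real, Real.norm_of_nonneg (inv_pos.2 (hωp _)).le]
    have h3 : (1 + K ^ 2) / 2 *
        (1 / 2 * (1 * (∫ s in Ioi (r:ℝ), s * ‖ψ s‖ ^ 2) + 1 / (2 * 1))) ≤ B := by
      rw [hB]; gcongr; exact tail_sq_le hψ hr.le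
    calc _ ≤ 1 * B := mul_le_mul h2 (h1.trans h3) (norm_nonneg _) zero_le_one
      _ = B := one_mul B
  let T : BoundedContinuousFunction (Ioi (0 : ℝ)) ℂ → BoundedContinuousFunction (Ioi (0 : ℝ)) ℂ :=
    fun y => BoundedContinuousFunction.ofNormedAddCommGroup (fun r => riccatiMap ψ K l y r)
      (continuousOn_iff_continuous_domRestrict.1 (hcont y)) B (hbd y)
  have hT : ContractingWith (1 / 2) T := by
    refine ⟨by norm_num, LipschitzWith.of_dist_le_mul fun y y' => ?_⟩
    rw [dist_eq_norm, dist_eq_norm]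
    refine (BoundedContinuousFunction.norm_le (by positivity)).2 fun r => ?_
    have hr : (0:ℝ) < r := r.2
    have h1 := norm_riccatiIntegral_sub_le hψ hK y y' hr
    change ‖riccatiMap ψ K l y r - riccatiMap ψ K l y' r‖ ≤ _
    rw [riccatiMap, riccatiMap, ← mul_sub, norm_mul, Complex.norm_real,
      Real.norm_of_nonneg (inv_pos.2 (hωp _)).le, inv_mul_le_iff₀ (hωp _)]
    simpa using h1
  set y := hT.fixedPoint T with hy
  have hfix : T y = y := hT.fixedPoint_isFixedPt
  have hz : ∀ r, 0 < r → riccatiIntegral ψ K (fun s => expWeight ψ l s * extendZero y s) r =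
      expWeight ψ l r * extendZero y r := by
    intro r hr
    have h1 : riccatiMap ψ K l y r = y ⟨r, hr⟩ := congrArg (fun f => f ⟨r, hr⟩) hfix
    have h2 : extendZero y r = riccatiMap ψ K l y r := by rw [h1]; simp [extendZero, hr]
    have h3 : (expWeight ψ l r : ℂ) ≠ 0 := by exact_mod_cast (hωp r).ne'
    rw [h2, riccatiMap]
    push_cast
    rw [mul_inv_cancel_left₀ h3]
  refine ⟨riccatiIntegral ψ K (fun s => expWeight ψ l s * extendZero y s), ?_,
    tendsto_riccatiIntegral hψ hK _⟩
  refine (riccatiIntegral_hasACDeriv hψ hK (hc y)).congr_deriv fun r hr => ?_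
  rw [hz r hr]

end Existence

theorem lt_eight_of_lt {m : ℝ} (hm : 0 ≤ m) (h : m < 2 * √2) : m ^ 2 < 8 := by
  have h1 : m ^ 2 < (2 * √2) ^ 2 := by gcongr
  rwa [mul_pow, Real.sq_sqrt (by norm_num), show (2:ℝ) ^ 2 * 2 = 8 by norm_num] at h1

/-- The bound for the stereographic coordinate in terms of the bound `M < 2√2` for `‖ψ‖`. -/
def slopeBound (M : ℝ) : ℝ := √(M ^ 2 / (8 - M ^ 2))

theorem norm_le_slopeBound {z : ℂ} {m M : ℝ} (hm : 0 ≤ m) (hmM : m ≤ M) (hM : M < 2 * √2)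
    (h : 2 * (‖z‖ ^ 2 / (1 + ‖z‖ ^ 2)) ≤ m ^ 2 / 4) : ‖z‖ ≤ slopeBound M := by
  have hM8 := lt_eight_of_lt (hm.trans hmM) hM
  have hmM2 : m ^ 2 ≤ M ^ 2 := by gcongr
  apply Real.le_sqrt_of_sq_le
  rw [le_div_iff₀ (by linarith)]
  have hp : 0 < 1 + ‖z‖ ^ 2 := by positivity
  have h2 : ‖z‖ ^ 2 / (1 + ‖z‖ ^ 2) ≤ M ^ 2 / 8 := by linarith
  rw [div_le_iff₀ hp] at h2
  linarith

theorem slopeBound_nonneg (M : ℝ) : 0 ≤ slopeBound M := Real.sqrt_nonneg _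

theorem IsRiccati.norm_le_slopeBound {ψ z : ℝ → ℂ} (hz : IsRiccati ψ z)
    (hψ : MemLp ψ 2 radialMeasure) {M : ℝ} (hmM : radNorm ψ ≤ M) (hM : M < 2 * √2) (r : ℝ)
    (hr : 0 < r) : ‖z r‖ ≤ slopeBound M :=
  EquivariantMap.norm_le_slopeBound (radNorm_nonneg ψ) hmM hM (hz.norm_sq_le hψ hr)

/-- Below the threshold the truncation is inactive. -/
theorem exists_isRiccati {ψ : ℝ → ℂ} (hψ : MemLp ψ 2 radialMeasure) (h : radNorm ψ < 2 * √2) :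
    ∃ z, IsRiccati ψ z := by
  set K := slopeBound (radNorm ψ) + 1 with hKd
  have hK : 0 < K := by have := slopeBound_nonneg (radNorm ψ); linarith
  obtain ⟨z, hz, hlim⟩ := exists_truncated_riccati hψ hK
  refine ⟨z, hz.congr_deriv fun r hr => ?_, hlim⟩
  have h1 := riccati_height_le (ρ := fun r => (max 1 (‖z r‖ / K))⁻¹ ^ 2) hψ (fun r => ?_)
    (hz.congr_deriv fun r _ => by rw [retract_sq_eq]) hlim hr
  · have h2 := norm_le_slopeBound (radNorm_nonneg ψ) le_rfl h h1
    rw [retract_eq_self hK (h2.trans (by linarith))]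
  · have h3 : (max 1 (‖z r‖ / K))⁻¹ ≤ 1 := inv_le_one_of_one_le₀ (le_max_left _ _)
    have h4 : 0 ≤ (max 1 (‖z r‖ / K))⁻¹ := inv_nonneg.2 (zero_le_one.trans (le_max_left _ _))
    exact ⟨by positivity, pow_le_one₀ h4 h3⟩

/-! ### Vectors of `ℝ³` as pairs of a complex and a real number -/

/-- The vector of `ℝ³` with horizontal part `a ∈ ℂ = ℝ²` and vertical component `h`. -/
def vec (a : ℂ) (h : ℝ) : Space := !₂[a.re, a.im, h]

@[simp] theorem vec_zero (a : ℂ) (h : ℝ) : vec a h 0 = a.re := rfl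
@[simp] theorem vec_one (a : ℂ) (h : ℝ) : vec a h 1 = a.im := rfl
@[simp] theorem vec_two (a : ℂ) (h : ℝ) : vec a h 2 = h := rfl

theorem space_ext {x y : Space} (h0 : x 0 = y 0) (h1 : x 1 = y 1) (h2 : x 2 = y 2) : x = y := by
  ext i; fin_cases i <;> assumption

/-- The horizontal part of a vector of `ℝ³`, as a complex number. -/
def horiz (y : Space) : ℂ := ⟨y 0, y 1⟩

theorem vec_horiz (y : Space) : vec (horiz y) (y 2) = y := space_ext rfl rfl rfl

theorem inner_space (x y : Space) : inner ℝ x y = x 0 * y 0 + x 1 * y 1 + x 2 * y 2 := by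
  simp [PiLp.inner_apply, Fin.sum_univ_three, mul_comm]

theorem norm_sq_space (x : Space) : ‖x‖ ^ 2 = x 0 ^ 2 + x 1 ^ 2 + x 2 ^ 2 := by
  rw [EuclideanSpace.real_norm_sq_eq, Fin.sum_univ_three]

theorem inner_vec (a b : ℂ) (h k : ℝ) :
    inner ℝ (vec a h) (vec b k) = (a * star b).re + h * k := by
  rw [inner_space]; simp

theorem norm_sq_vec (a : ℂ) (h : ℝ) : ‖vec a h‖ ^ 2 = ‖a‖ ^ 2 + h ^ 2 := by
  rw [norm_sq_space, ← Complex.normSq_eq_norm_sq, Complex.normSq_apply]; simp; ring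

theorem cross_zero (a b : Space) : cross a b 0 = a 1 * b 2 - a 2 * b 1 := by
  simp [cross, cross_apply]
theorem cross_one (a b : Space) : cross a b 1 = a 2 * b 0 - a 0 * b 2 := by
  simp [cross, cross_apply]
theorem cross_two (a b : Space) : cross a b 2 = a 0 * b 1 - a 1 * b 0 := by
  simp [cross, cross_apply]

theorem cross_vec (a b : ℂ) (h k : ℝ) :
    cross (vec a h) (vec b k) = vec (Complex.I * (h * b - k * a)) (star a * b).im := by
  refine space_ext ?_ ?_ ?_
  · rw [cross_zero]; simp; ring
  · rw [cross_one]; simp; ring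
  · rw [cross_two]; simp; ring

theorem genR_apply (y : Space) : genR y = vec (Complex.I * horiz y) 0 := by
  refine space_ext ?_ ?_ ?_
  · rw [genR, cross_zero]; simp [vecK, horiz]
  · rw [genR, cross_one]; simp [vecK, horiz]
  · rw [genR, cross_two]; simp [vecK]

theorem horiz_vec (a : ℂ) (h : ℝ) : horiz (vec a h) = a := rfl

theorem vec_add (a b : ℂ) (h k : ℝ) : vec a h + vec b k = vec (a + b) (h + k) :=
  space_ext (by simp) (by simp) (by simp)

theorem vec_sub (a b : ℂ) (h k : ℝ) : vec a h - vec b k = vec (a - b) (h - k) :=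
  space_ext (by simp) (by simp) (by simp)

theorem smul_vec (t : ℝ) (a : ℂ) (h : ℝ) : t • vec a h = vec (t * a) (t * h) :=
  space_ext (by simp) (by simp) (by simp)

theorem vec_eq (a : ℂ) (h : ℝ) : vec a h = a.re • vecI + a.im • vecJ + h • vecK :=
  space_ext (by simp [vecI, vecJ, vecK]) (by simp [vecI, vecJ, vecK]) (by simp [vecI, vecJ, vecK])

theorem continuous_vec : Continuous fun p : ℂ × ℝ => vec p.1 p.2 := by
  simp only [vec_eq]
  exact (((Complex.continuous_re.comp continuous_fst).smul continuous_const).add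
    ((Complex.continuous_im.comp continuous_fst).smul continuous_const)).add
    (continuous_snd.smul continuous_const)

theorem tendsto_vec {f : ℝ → ℂ} {h : ℝ → ℝ} {a : ℂ} {k : ℝ} {l : Filter ℝ}
    (hf : Tendsto f l (𝓝 a)) (hh : Tendsto h l (𝓝 k)) :
    Tendsto (fun r => vec (f r) (h r)) l (𝓝 (vec a k)) :=
  (continuous_vec.tendsto (a, k)).comp (hf.prodMk_nhds hh)

theorem HasACDeriv.vec {f f' : ℝ → ℂ} {h h' : ℝ → ℝ} (hf : HasACDeriv f f')
    (hh : HasACDeriv h h') : HasACDeriv (fun r => vec (f r) (h r)) (fun r => vec (f' r) (h' r)) := by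
  simp only [vec_eq]
  refine (((hf.re.smul (.const vecI)).add (hf.im.smul (.const vecJ))).add
    (hh.smul (.const vecK))).congr_deriv fun r _ => ?_
  simp

theorem HasACDeriv.apply {f g : ℝ → Space} (h : HasACDeriv f g) (i : Fin 3) :
    HasACDeriv (fun r => f r i) (fun r => g r i) :=
  h.clm (EuclideanSpace.proj (𝕜 := ℝ) i : Space →L[ℝ] ℝ)

theorem HasACDeriv.horiz {f g : ℝ → Space} (h : HasACDeriv f g) :
    HasACDeriv (fun r => horiz (f r)) (fun r => EquivariantMap.horiz (g r)) := by
  have e : ∀ y : Space, EquivariantMap.horiz y = (y 0 : ℂ) + (y 1 : ℂ) * Complex.I :=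
    fun y => by apply Complex.ext <;> simp [EquivariantMap.horiz]
  simp only [e]
  exact ((h.apply 0).ofReal.add ((h.apply 1).ofReal.mul (.const Complex.I))).congr_deriv
    fun r _ => by simp

/-! ### The frame in terms of the stereographic coordinate -/

/-- The conformal factor `1 / (1 + ‖z‖²)` of the stereographic projection. -/
def conf (z : ℂ) : ℝ := (1 + ‖z‖ ^ 2)⁻¹

/-- The vertical component of the point of the sphere with stereographic coordinate `z`; the pole
`-k` corresponds to `z = 0`. -/
def height (z : ℂ) : ℝ := 1 - 2 * conf z

/-- The coefficient `q = ψ + 2 z / (r (1 + ‖z‖²))` of the moving-frame equations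
`u' = q₁ v + q₂ w`, `v' = -q₁ u`, `w' = -q₂ u`. -/
def connCoeff (ψ z : ℝ → ℂ) (r : ℝ) : ℂ := ψ r + 2 * z r * conf (z r) / r

/-- The horizontal factor `N`, equal to the horizontal part of `v + i w` for the normalized Coulomb
frame; it solves `N' = -q z̄ N` with `N → 2` at infinity. -/
def gaugeFactor (ψ z : ℝ → ℂ) (r : ℝ) : ℂ :=
  2 * Complex.exp (∫ s in Ioi r, connCoeff ψ z s * star (z s))

/-- The radial profile with horizontal part `z̄ N` reconstructed from a solution `z` of the Riccati
equation. -/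
def profile (ψ z : ℝ → ℂ) (r : ℝ) : Space :=
  vec (star (z r) * gaugeFactor ψ z r) (height (z r))

/-- The first vector of the reconstructed frame. -/
def frameV (ψ z : ℝ → ℂ) (r : ℝ) : Space :=
  vec ((1 - star (z r) ^ 2) * gaugeFactor ψ z r / 2) (2 * conf (z r) * (z r).re)

/-- The second vector of the reconstructed frame. -/
def frameW (ψ z : ℝ → ℂ) (r : ℝ) : Space :=
  vec (-Complex.I * ((1 + star (z r) ^ 2) * gaugeFactor ψ z r) / 2) (2 * conf (z r) * (z r).im)

theorem conf_pos (z : ℂ) : 0 < conf z := by unfold conf; positivity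

theorem conf_le_one (z : ℂ) : conf z ≤ 1 :=
  inv_le_one_of_one_le₀ (by have := sq_nonneg ‖z‖; linarith)

theorem conf_mul (z : ℂ) : conf z * (1 + ‖z‖ ^ 2) = 1 :=
  inv_mul_cancel₀ (by positivity)

theorem star_mul_self_eq (z : ℂ) : star z * z = ((‖z‖ ^ 2 : ℝ) : ℂ) := by
  rw [Complex.star_def, ← Complex.normSq_eq_conj_mul_self, Complex.normSq_eq_norm_sq]

theorem conf_mul_complex (z : ℂ) : (conf z : ℂ) * (1 + star z * z) = 1 := by
  rw [star_mul_self_eq]; exact_mod_cast conf_mul z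

theorem re_eq_half (a : ℂ) : ((a.re : ℝ) : ℂ) = (a + star a) / 2 := by
  rw [Complex.re_eq_add_conj]; rfl

theorem im_eq_half (a : ℂ) : ((a.im : ℝ) : ℂ) = -Complex.I * (a - star a) / 2 := by
  rw [Complex.im_eq_sub_conj, Complex.star_def, div_eq_div_iff (by simp) (by simp)]
  linear_combination (2 * (a - (starRingEnd ℂ) a)) * Complex.I_sq

/-- The Riccati right-hand side in terms of `q`. -/
theorem riccati_rhs_eq (ψ z : ℝ → ℂ) {r : ℝ} (hr : 0 < r) :
    z r / r + (ψ r + star (ψ r) * z r ^ 2) / 2 =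
      (connCoeff ψ z r + star (connCoeff ψ z r) * z r ^ 2) / 2 := by
  have h1 := conf_mul_complex (z r)
  have h2 : (r : ℂ) ≠ 0 := by exact_mod_cast hr.ne'
  have h3 : star (connCoeff ψ z r) = star (ψ r) + 2 * star (z r) * conf (z r) / r := by
    rw [connCoeff]
    simp [Complex.conj_ofReal]
  rw [h3, connCoeff]
  field_simp
  linear_combination (-2 * z r) * h1

theorem tendsto_conf {z : ℝ → ℂ} {l : Filter ℝ} (hz : Tendsto z l (𝓝 0)) :
    Tendsto (fun r => conf (z r)) l (𝓝 1) := by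
  have h1 := ((hz.norm.pow 2).const_add 1).inv₀ (by simp)
  simpa [conf] using h1

section Reconstruction

variable {ψ z : ℝ → ℂ}

theorem memLp_zero_radial : MemLp (fun _ : ℝ => (0 : ℂ)) 2 radialMeasure := MemLp.zero

theorem IsRiccati.memLp_div (hz : IsRiccati ψ z) (hψ : MemLp ψ 2 radialMeasure) {K : ℝ}
    (hK : ∀ r, 0 < r → ‖z r‖ ≤ K) : MemLp (fun r => z r / r) 2 radialMeasure ∧
      radNorm (fun r => z r / r) ≤ riccatiConst K (radNorm ψ) * radNorm ψ := by
  have hK0 : 0 ≤ K := (norm_nonneg _).trans (hK 1 one_pos)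
  have := (hz.stability IsRiccati.zero hψ memLp_zero_radial hK fun r _ => by simpa using hK0).2
  simpa using this

theorem continuousOn_conf {z : ℝ → ℂ} {s : Set ℝ} (hz : ContinuousOn z s) :
    ContinuousOn (fun r => conf (z r)) s := by
  unfold conf
  exact ContinuousOn.inv₀ (by fun_prop) fun r _ => by positivity

theorem IsRiccati.memLp_connCoeff (hz : IsRiccati ψ z) (hψ : MemLp ψ 2 radialMeasure) {K : ℝ}
    (hK : ∀ r, 0 < r → ‖z r‖ ≤ K) : MemLp (connCoeff ψ z) 2 radialMeasure ∧
      radNorm (connCoeff ψ z) ≤ 1 * radNorm ψ + 2 * radNorm (fun r => z r / r) := by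
  have hzc := hz.hasACDeriv.continuousOn
  refine radNorm_le_add ?_ hψ (hz.memLp_div hψ hK).1 zero_le_one zero_le_two ?_
  · refine (MemLp.aesm hψ).add (ContinuousOn.aestronglyMeasurable ?_ measurableSet_Ioi)
    refine ContinuousOn.div ?_ Complex.continuous_ofReal.continuousOn fun r hr => ?_
    · exact (continuousOn_const.mul hzc).mul
        (Complex.continuous_ofReal.comp_continuousOn (continuousOn_conf hzc))
    · exact_mod_cast ne_of_gt (show (0:ℝ) < r from hr)
  · refine Eventually.of_forall fun r => (norm_add_le _ _).trans ?_
    rw [one_mul]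
    gcongr
    rw [norm_div, norm_div, norm_mul, norm_mul, Complex.norm_real (conf _),
      Real.norm_of_nonneg (conf_pos _).le, Complex.norm_ofNat]
    have : 2 * ‖z r‖ * conf (z r) ≤ 2 * ‖z r‖ * 1 := by
      gcongr; exact conf_le_one _
    calc _ ≤ 2 * ‖z r‖ * 1 / ‖(r:ℂ)‖ := by gcongr
      _ = _ := by ring

theorem IsRiccati.integrable_conn (hz : IsRiccati ψ z) (hψ : MemLp ψ 2 radialMeasure) {K : ℝ}
    (hK : ∀ r, 0 < r → ‖z r‖ ≤ K) :
    IntegrableOn (fun r => connCoeff ψ z r * star (z r)) (Ioi 0) := by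
  have h1 := (hz.memLp_connCoeff hψ hK).1
  refine (integral_mul_le_radNorm h1 (hz.memLp_div hψ hK).1 ?_ ?_).1
  · exact (MemLp.aesm h1).mul
      ((hz.hasACDeriv.continuousOn.aestronglyMeasurable measurableSet_Ioi).star)
  · filter_upwards [ae_restrict_mem measurableSet_Ioi] with r hr
    have hr : (0:ℝ) < r := hr
    rw [norm_mul, norm_star, norm_div, Complex.norm_real, Real.norm_of_nonneg hr.le]
    refine le_of_eq ?_
    field_simp

theorem IsRiccati.hasACDeriv_conn (hz : IsRiccati ψ z) : HasACDeriv z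
    (fun r => (connCoeff ψ z r + star (connCoeff ψ z r) * z r ^ 2) / 2) :=
  hz.hasACDeriv.congr_deriv fun _ hr => riccati_rhs_eq ψ z hr

theorem IsRiccati.hasACDeriv_conf (hz : IsRiccati ψ z) : HasACDeriv (fun r => conf (z r))
    (fun r => -(conf (z r) * (connCoeff ψ z r * star (z r)).re)) := by
  have h1 := ((HasACDeriv.const (1:ℝ)).add hz.hasACDeriv_conn.norm_sq).inv
    fun r _ => by positivity
  refine h1.congr_deriv fun r _ => ?_
  set q := connCoeff ψ z r
  have e : 2 * (star (z r) * ((q + star q * z r ^ 2) / 2)).re =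
      (1 + ‖z r‖ ^ 2) * (q * star (z r)).re := by
    apply Complex.ofReal_injective
    push_cast
    rw [re_eq_half, re_eq_half]
    have := star_mul_self_eq (z r)
    push_cast at this
    rw [← this]
    simp only [star_mul', star_div₀, star_add, star_pow, star_star, star_ofNat]
    ring
  rw [e, conf]
  field_simp
  ring

theorem IsRiccati.hasACDeriv_gaugeFactor (hz : IsRiccati ψ z) (hψ : MemLp ψ 2 radialMeasure)
    {K : ℝ} (hK : ∀ r, 0 < r → ‖z r‖ ≤ K) : HasACDeriv (gaugeFactor ψ z)
    (fun r => -(connCoeff ψ z r * star (z r)) * gaugeFactor ψ z r) := by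
  have h1 := HasACDeriv.tail fun a ha => (hz.integrable_conn hψ hK).mono_set
    (Ioi_subset_Ioi (le_of_lt ha))
  refine ((HasACDeriv.const (2:ℂ)).mul h1.cexp).congr_deriv fun r _ => ?_
  rw [gaugeFactor]; ring

theorem IsRiccati.tendsto_gaugeFactor (hz : IsRiccati ψ z) (hψ : MemLp ψ 2 radialMeasure)
    {K : ℝ} (hK : ∀ r, 0 < r → ‖z r‖ ≤ K) : Tendsto (gaugeFactor ψ z) atTop (𝓝 2) := by
  have h1 := tendsto_tail_zero (hz.integrable_conn hψ hK)
  have h2 := ((Complex.continuous_exp.tendsto _).comp h1).const_mul 2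
  rw [Complex.exp_zero, mul_one] at h2
  exact h2

/-- The modulus of `N` is determined by `z`, so that only its phase carries information on `ψ`. -/
theorem IsRiccati.gaugeFactor_mul_star (hz : IsRiccati ψ z) (hψ : MemLp ψ 2 radialMeasure)
    {K : ℝ} (hK : ∀ r, 0 < r → ‖z r‖ ≤ K) {r : ℝ} (hr : 0 < r) :
    gaugeFactor ψ z r * star (gaugeFactor ψ z r) = 4 * (conf (z r) : ℂ) ^ 2 := by
  have hN := hz.hasACDeriv_gaugeFactor hψ hK
  have hc := hz.hasACDeriv_conf.inv fun r _ => (conf_pos (z r)).ne'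
  have hP := (hN.mul hN.conj).mul (hc.ofReal.mul hc.ofReal)
  have hlimc : Tendsto (fun r => ((conf (z r))⁻¹ : ℝ)) atTop (𝓝 1) := by
    simpa using (tendsto_conf hz.tendsto).inv₀ one_ne_zero
  have hlimc' := (Complex.continuous_ofReal.tendsto _).comp hlimc
  have hNl := hz.tendsto_gaugeFactor hψ hK
  have hlim := (hNl.mul (hNl.star)).mul (hlimc'.mul hlimc')
  have h0 := (hP.congr_deriv (g' := fun _ => 0) fun r _ => ?_).eq_lim_of_zero hlim hr
  · have hc0 : (conf (z r) : ℂ) ≠ 0 := by exact_mod_cast (conf_pos (z r)).ne'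
    simp only [Complex.ofReal_inv, Complex.ofReal_one, mul_one,
      star_ofNat] at h0
    field_simp at h0
    rw [h0]; ring
  · have hc0 : (conf (z r) : ℂ) ≠ 0 := by exact_mod_cast (conf_pos (z r)).ne'
    push_cast
    rw [re_eq_half]
    simp only [star_mul', star_neg, star_star]
    field_simp
    ring

theorem IsRiccati.hasACDeriv_profile (hz : IsRiccati ψ z) (hψ : MemLp ψ 2 radialMeasure)
    {K : ℝ} (hK : ∀ r, 0 < r → ‖z r‖ ≤ K) : HasACDeriv (profile ψ z) (fun r =>
      vec (gaugeFactor ψ z r * (star (connCoeff ψ z r) - connCoeff ψ z r * star (z r) ^ 2) / 2)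
        (2 * conf (z r) * (connCoeff ψ z r * star (z r)).re)) := by
  refine ((hz.hasACDeriv_conn.conj.mul (hz.hasACDeriv_gaugeFactor hψ hK)).vec
    ((HasACDeriv.const (1:ℝ)).sub ((HasACDeriv.const (2:ℝ)).mul
      hz.hasACDeriv_conf))).congr_deriv fun r _ => ?_
  congr 1
  · simp only [star_mul', star_div₀, star_add, star_pow, star_star, star_ofNat]
    ring
  · ring

theorem IsRiccati.hasACDeriv_frameV (hz : IsRiccati ψ z) (hψ : MemLp ψ 2 radialMeasure)
    {K : ℝ} (hK : ∀ r, 0 < r → ‖z r‖ ≤ K) : HasACDeriv (frameV ψ z) (fun r =>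
      -(connCoeff ψ z r).re • profile ψ z r) := by
  have hs := hz.hasACDeriv_conn.conj
  refine (((((HasACDeriv.const (1:ℂ)).sub (hs.mul hs)).mul
    (hz.hasACDeriv_gaugeFactor hψ hK)).mul (.const (1 / 2 : ℂ))).vec
    (((HasACDeriv.const (2:ℝ)).mul hz.hasACDeriv_conf).mul hz.hasACDeriv_conn.re)
      |>.congr_fun fun r _ => ?_).congr_deriv fun r _ => ?_
  · rw [frameV]; congr 1; ring
  · rw [profile, smul_vec]
    congr 1
    · push_cast
      rw [re_eq_half]
      simp only [star_mul', star_div₀, star_add, star_pow, star_star, star_ofNat]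
      ring
    · apply Complex.ofReal_injective
      rw [height]
      push_cast
      simp only [re_eq_half]
      simp only [star_mul', star_div₀, star_add, star_pow, star_star, star_ofNat]
      linear_combination (-(connCoeff ψ z r + star (connCoeff ψ z r)) / 2) *
        conf_mul_complex (z r)

theorem IsRiccati.exists_hasACDeriv_frameW (hz : IsRiccati ψ z) (hψ : MemLp ψ 2 radialMeasure)
    {K : ℝ} (hK : ∀ r, 0 < r → ‖z r‖ ≤ K) : ∃ g, HasACDeriv (frameW ψ z) g := by
  have hs := hz.hasACDeriv_conn.conj
  refine ⟨_, ((((HasACDeriv.const (1:ℂ)).add (hs.mul hs)).mul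
    (hz.hasACDeriv_gaugeFactor hψ hK)).mul (.const (-Complex.I / 2))).vec
    (((HasACDeriv.const (2:ℝ)).mul hz.hasACDeriv_conf).mul hz.hasACDeriv_conn.im)
      |>.congr_fun fun r _ => ?_⟩
  rw [frameW]; congr 1; ring

end Reconstruction

theorem inner_cross_left (a b : Space) : inner ℝ (cross a b) a = 0 := by
  rw [inner_space, cross_zero, cross_one, cross_two]; ring

theorem inner_cross_right (a b : Space) : inner ℝ (cross a b) b = 0 := by
  rw [inner_space, cross_zero, cross_one, cross_two]; ring

theorem inner_cross_self (a b : Space) :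
    inner ℝ (cross a b) (cross a b) = ‖a‖ ^ 2 * ‖b‖ ^ 2 - inner ℝ a b ^ 2 := by
  rw [norm_sq_space, norm_sq_space, inner_space, inner_space, cross_zero, cross_one, cross_two]
  ring

section FrameAlgebra

variable {z N : ℂ} {c : ℝ}

theorem frame_norm_u (hc : (c : ℂ) * (1 + star z * z) = 1) (hN : N * star N = 4 * (c : ℂ) ^ 2) :
    ‖vec (star z * N) (1 - 2 * c)‖ ^ 2 = 1 := by
  rw [norm_sq_vec]
  apply Complex.ofReal_injective
  push_cast
  have e : ((‖star z * N‖ : ℂ)) ^ 2 = star (star z * N) * (star z * N) := by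
    rw [star_mul_self_eq]; push_cast; rfl
  rw [e]
  simp only [star_mul', star_star]
  linear_combination (star z * z) * hN + 4 * c * hc

theorem frame_norm_v (hc : (c : ℂ) * (1 + star z * z) = 1) (hN : N * star N = 4 * (c : ℂ) ^ 2) :
    ‖vec ((1 - star z ^ 2) * N / 2) (2 * c * z.re)‖ ^ 2 = 1 := by
  rw [norm_sq_vec]
  apply Complex.ofReal_injective
  push_cast
  have e : ((‖(1 - star z ^ 2) * N / 2‖ : ℂ)) ^ 2 =
      star ((1 - star z ^ 2) * N / 2) * ((1 - star z ^ 2) * N / 2) := by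
    rw [star_mul_self_eq]; push_cast; rfl
  rw [e, re_eq_half]
  simp only [star_mul', star_div₀, star_sub, star_pow, star_star, star_ofNat, star_one]
  linear_combination ((1 - z ^ 2) * (1 - star z ^ 2) / 4) * hN + (c * (1 + star z * z) + 1) * hc

theorem frame_inner_v_u (hc : (c : ℂ) * (1 + star z * z) = 1)
    (hN : N * star N = 4 * (c : ℂ) ^ 2) :
    inner ℝ (vec ((1 - star z ^ 2) * N / 2) (2 * c * z.re)) (vec (star z * N) (1 - 2 * c)) = 0 := by
  rw [inner_vec]
  apply Complex.ofReal_injective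
  push_cast
  rw [re_eq_half, re_eq_half]
  simp only [star_mul', star_div₀, star_sub, star_pow, star_star, star_ofNat, star_one]
  linear_combination ((z * (1 - star z ^ 2) + star z * (1 - z ^ 2)) / 4) * hN -
    c * (z + star z) * hc

theorem frame_w_eq (hc : (c : ℂ) * (1 + star z * z) = 1) (hN : N * star N = 4 * (c : ℂ) ^ 2) :
    vec (-Complex.I * ((1 + star z ^ 2) * N) / 2) (2 * c * z.im) =
      cross (vec (star z * N) (1 - 2 * c)) (vec ((1 - star z ^ 2) * N / 2) (2 * c * z.re)) := by
  rw [cross_vec]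
  congr 1
  · push_cast
    rw [re_eq_half]
    linear_combination (Complex.I * N) * hc
  · apply Complex.ofReal_injective
    push_cast
    rw [im_eq_half, im_eq_half]
    simp only [star_mul', star_div₀, star_sub, star_pow, star_star, star_ofNat, star_one]
    linear_combination (Complex.I * ((z - z * star z ^ 2) - (star z - star z * z ^ 2)) / 4) * hN +
      Complex.I * c * (z - star z) * hc

/-- The moving-frame equation `u' = q₁ v + q₂ w`. -/
theorem frame_deriv_u (q : ℂ) :
    vec (N * (star q - q * star z ^ 2) / 2) (2 * c * (q * star z).re) =
      q.re • vec ((1 - star z ^ 2) * N / 2) (2 * c * z.re) +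
      q.im • vec (-Complex.I * ((1 + star z ^ 2) * N) / 2) (2 * c * z.im) := by
  rw [smul_vec, smul_vec, vec_add]
  congr 1
  · rw [re_eq_half, im_eq_half]
    linear_combination (-(q - star q) * (1 + star z ^ 2) * N / 4) * Complex.I_sq
  · simp; ring

end FrameAlgebra

/-- On the unit sphere `u × R u = k - u₃ u`, so that this field has the coordinates of `k` in any
frame of the tangent plane. -/
theorem cross_genR {u : Space} (hu : ‖u‖ ^ 2 = 1) : cross u (genR u) = vecK - u 2 • u := by
  rw [norm_sq_space] at hu
  rw [genR_apply]
  refine space_ext ?_ ?_ ?_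
  · rw [cross_zero]; simp [vecK, horiz]
  · rw [cross_one]; simp [vecK, horiz]
  · rw [cross_two]; simp [vecK, horiz]; linarith

theorem inner_vecK (y : Space) : inner ℝ vecK y = y 2 := by
  rw [inner_space]; simp [vecK]

/-- The reconstructed frame is a normalized Coulomb frame, in which `W⁻` has the coordinate `ψ`. -/
theorem IsRiccati.isNormalizedCoulombFrame {ψ z : ℝ → ℂ} (hz : IsRiccati ψ z)
    (hψ : MemLp ψ 2 radialMeasure) {K : ℝ} (hK : ∀ r, 0 < r → ‖z r‖ ≤ K) :
    IsNormalizedCoulombFrame (profile ψ z) (frameV ψ z) (frameW ψ z) ∧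
    ∀ᵐ r ∂(volume.restrict (Ioi (0 : ℝ))),
      ψ r = frameCoord (fieldWMinus (profile ψ z) r) (frameV ψ z r) (frameW ψ z r) := by
  have hu := hz.hasACDeriv_profile hψ hK
  have hv := hz.hasACDeriv_frameV hψ hK
  obtain ⟨gw, hw⟩ := hz.exists_hasACDeriv_frameW hψ hK
  have hc := fun r => conf_mul_complex (z r)
  have hN := fun r (hr : (0:ℝ) < r) => hz.gaugeFactor_mul_star hψ hK hr
  have nu : ∀ r, 0 < r → ‖profile ψ z r‖ ^ 2 = 1 := fun r hr => frame_norm_u (hc r) (hN r hr)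
  have nv : ∀ r, 0 < r → ‖frameV ψ z r‖ ^ 2 = 1 := fun r hr => frame_norm_v (hc r) (hN r hr)
  have vu : ∀ r, 0 < r → inner ℝ (frameV ψ z r) (profile ψ z r) = 0 :=
    fun r hr => frame_inner_v_u (hc r) (hN r hr)
  have we : ∀ r, 0 < r → frameW ψ z r = cross (profile ψ z r) (frameV ψ z r) :=
    fun r hr => frame_w_eq (hc r) (hN r hr)
  have wu : ∀ r, 0 < r → inner ℝ (frameW ψ z r) (profile ψ z r) = 0 := fun r hr => by
    rw [we r hr, inner_cross_left]
  have wv : ∀ r, 0 < r → inner ℝ (frameW ψ z r) (frameV ψ z r) = 0 := fun r hr => by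
    rw [we r hr, inner_cross_right]
  have ww : ∀ r, 0 < r → inner ℝ (frameW ψ z r) (frameW ψ z r) = (1:ℝ) := fun r hr => by
    rw [we r hr, inner_cross_self, nu r hr, nv r hr, real_inner_comm, vu r hr]; norm_num
  have norm_one : ∀ y : Space, ‖y‖ ^ 2 = 1 → ‖y‖ = 1 := fun y hy =>
    (pow_eq_one_iff_of_nonneg (norm_nonneg y) two_ne_zero).1 hy
  have hzl := hz.tendsto
  have hNl := hz.tendsto_gaugeFactor hψ hK
  have hcl := tendsto_conf hzl
  refine ⟨⟨hu.ac, hv.ac, hw.ac, fun r hr => norm_one _ (nu r hr), fun r hr => norm_one _ (nv r hr),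
    vu, we, ?_, ?_, ?_⟩, ?_⟩
  · filter_upwards [hv.ae, ae_restrict_mem measurableSet_Ioi] with r h1 h2
    rw [h1.deriv, inner_smul_left, real_inner_comm, wu r h2, mul_zero]
  · have h1 := tendsto_vec (((((hzl.star).pow 2).const_sub 1).mul hNl).div_const 2)
      ((hcl.const_mul 2).mul ((Complex.continuous_re.tendsto _).comp hzl))
    have e : vec ((1 - star (0:ℂ) ^ 2) * 2 / 2) (2 * 1 * (0:ℂ).re) = vecI :=
      space_ext (by simp [vecI]) (by simp [vecI]) (by simp [vecI])
    rw [e] at h1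
    exact h1
  · have h1 := tendsto_vec ((((((hzl.star).pow 2).const_add 1).mul hNl).const_mul (-Complex.I)).div_const 2)
      ((hcl.const_mul 2).mul ((Complex.continuous_im.tendsto _).comp hzl))
    have e : vec (-Complex.I * ((1 + star (0:ℂ) ^ 2) * 2) / 2) (2 * 1 * (0:ℂ).im) = -vecJ :=
      space_ext (by simp [vecJ]) (by simp [vecJ]) (by simp [vecJ])
    rw [e] at h1
    exact h1
  · filter_upwards [hu.ae, ae_restrict_mem measurableSet_Ioi] with r h1 hr
    have hr : (0:ℝ) < r := hr
    have hd : deriv (profile ψ z) r = (connCoeff ψ z r).re • frameV ψ z r +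
        (connCoeff ψ z r).im • frameW ψ z r := by
      rw [h1.deriv]; exact frame_deriv_u _
    have hvv : inner ℝ (frameV ψ z r) (frameV ψ z r) = (1:ℝ) := by
      rw [real_inner_self_eq_norm_sq, nv r hr]
    have i1 : inner ℝ (fieldWMinus (profile ψ z) r) (frameV ψ z r) =
        (connCoeff ψ z r).re - r⁻¹ * (2 * conf (z r) * (z r).re) := by
      rw [fieldWMinus, cross_genR (nu r hr), hd, inner_sub_left, inner_add_left, inner_smul_left,
        inner_smul_left, inner_smul_left, inner_sub_left, inner_smul_left, inner_vecK, hvv,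
        wv r hr, real_inner_comm, vu r hr]
      simp [frameV]
    have i2 : inner ℝ (fieldWMinus (profile ψ z) r) (frameW ψ z r) =
        (connCoeff ψ z r).im - r⁻¹ * (2 * conf (z r) * (z r).im) := by
      rw [fieldWMinus, cross_genR (nu r hr), hd, inner_sub_left, inner_add_left, inner_smul_left,
        inner_smul_left, inner_smul_left, inner_sub_left, inner_smul_left, inner_vecK, ww r hr,
        real_inner_comm, wv r hr, real_inner_comm, wu r hr]
      simp [frameW]
    rw [frameCoord, i1, i2]
    push_cast
    have e1 : ((connCoeff ψ z r).re : ℂ) + (connCoeff ψ z r).im * Complex.I =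
        ψ r + 2 * z r * conf (z r) / r := Complex.re_add_im _
    have e2 := Complex.re_add_im (z r)
    linear_combination -e1 + (2 * conf (z r) / r : ℂ) * e2

/-! ### From a normalized Coulomb frame to the Riccati equation -/

theorem LocallyAC.hasACDeriv {f : ℝ → Space} (hf : LocallyAC f) : HasACDeriv f (deriv f) := by
  refine ⟨hf, ?_⟩
  have hi : ∀ i : Fin 3, ∀ᵐ r ∂(volume.restrict (Ioi (0 : ℝ))),
      DifferentiableAt ℝ (fun r => f r i) r := fun i => by
    refine ae_mem_Ioi_of_interval fun a b ha hab => ?_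
    refine AbsolutelyContinuousOnInterval.ae_differentiableAt (ac_of_dist_le (C := 1)
      (fun x _ y _ => ?_) (hf a b ha hab))
    rw [one_mul, dist_eq_norm, dist_eq_norm]
    exact PiLp.norm_apply_le (f x - f y) i
  filter_upwards [hi 0, hi 1, hi 2] with r h0 h1 h2
  refine DifferentiableAt.hasDerivAt ?_
  rw [differentiableAt_euclidean]
  intro i
  fin_cases i <;> assumption

/-- The completeness relation of an orthonormal frame `(u, v, u × v)`. -/
theorem frame_complete {u v w : Space} (hu : ‖u‖ ^ 2 = 1) (hv : ‖v‖ ^ 2 = 1)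
    (huv : inner ℝ v u = 0) (hw : w = cross u v) (i j : Fin 3) :
    u i * u j + v i * v j + w i * w j = if i = j then 1 else 0 := by
  have e1 := inner_cross_left u v
  have e2 := inner_cross_right u v
  have e3 := inner_cross_self u v
  rw [hu, hv, real_inner_comm v u, huv] at e3
  rw [← hw] at e1 e2 e3
  rw [norm_sq_space] at hu hv
  rw [inner_space] at huv e1 e2 e3
  let A : Matrix (Fin 3) (Fin 3) ℝ := Matrix.of ![u, v, w]
  have hA : A * A.transpose = 1 := by
    ext a b
    rw [Matrix.mul_apply, Fin.sum_univ_three, Matrix.one_apply]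
    fin_cases a <;> fin_cases b <;> simp [A] <;> linarith
  have hA2 : A.transpose * A = 1 := mul_eq_one_comm.1 hA
  have hA' := congrFun (congrFun hA2 i) j
  rw [Matrix.mul_apply, Fin.sum_univ_three, Matrix.one_apply] at hA'
  simpa [A] using hA'

theorem frame_expand {u v w : Space} (hu : ‖u‖ ^ 2 = 1) (hv : ‖v‖ ^ 2 = 1)
    (huv : inner ℝ v u = 0) (hw : w = cross u v) (y : Space) :
    y = (inner ℝ y u : ℝ) • u + (inner ℝ y v : ℝ) • v + (inner ℝ y w : ℝ) • w := by
  have h := frame_complete hu hv huv hw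
  have key : ∀ j, y j = inner ℝ y u * u j + inner ℝ y v * v j + inner ℝ y w * w j := by
    intro j
    have : y j = ∑ i : Fin 3, y i * (if i = j then 1 else 0) := by simp
    rw [this, Fin.sum_univ_three, ← h 0 j, ← h 1 j, ← h 2 j, inner_space, inner_space, inner_space]
    ring
  ext j
  simpa using key j

/-- The cyclic relation `u = v × w`. -/
theorem cross_frame {u v w : Space} (hv : ‖v‖ ^ 2 = 1)
    (huv : inner ℝ v u = 0) (hw : w = cross u v) : cross v w = u := by
  rw [norm_sq_space] at hv
  rw [inner_space] at huv
  refine space_ext ?_ ?_ ?_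
  · rw [cross_zero, hw, cross_two, cross_one]; linear_combination u 0 * hv - v 0 * huv
  · rw [cross_one, hw, cross_two, cross_zero]; linear_combination u 1 * hv - v 1 * huv
  · rw [cross_two, hw, cross_one, cross_zero]; linear_combination u 2 * hv - v 2 * huv

theorem HasACDeriv.inner_deriv_eq_zero {f f' g g' : ℝ → Space} (hf : HasACDeriv f f')
    (hg : HasACDeriv g g') {c : ℝ} (h : ∀ r, 0 < r → inner ℝ (f r) (g r) = c) :
    ∀ᵐ r ∂(volume.restrict (Ioi (0 : ℝ))), inner ℝ (f' r) (g r) + inner ℝ (f r) (g' r) = 0 := by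
  filter_upwards [hf.ae, hg.ae, ae_restrict_mem measurableSet_Ioi] with r h1 h2 hr
  have h3 := h1.inner ℝ h2
  have h4 : HasDerivAt (fun r => inner ℝ (f r) (g r)) 0 r := by
    refine (hasDerivAt_const r c).congr_of_eventuallyEq ?_
    filter_upwards [Ioi_mem_nhds (show (0:ℝ) < r from hr)] with s hs using h s hs
  rw [add_comm]
  exact h3.unique h4

/-- The moving-frame equations of a Coulomb frame whose field `W⁻` has the coordinate `ψ`, with
`q = ψ + (v₃ + i w₃) / r`. -/
theorem IsNormalizedCoulombFrame.frame_equations {ub v w : ℝ → Space} {ψ : ℝ → ℂ}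
    (hF : IsNormalizedCoulombFrame ub v w)
    (hψ : ∀ᵐ r ∂(volume.restrict (Ioi (0 : ℝ))),
      ψ r = frameCoord (fieldWMinus ub r) (v r) (w r)) :
    let q : ℝ → ℂ := fun r => ψ r + ((v r 2 : ℂ) + w r 2 * Complex.I) / r
    HasACDeriv ub (fun r => (q r).re • v r + (q r).im • w r) ∧
      HasACDeriv v (fun r => -(q r).re • ub r) ∧ HasACDeriv w (fun r => -(q r).im • ub r) := by
  intro q
  have du := hF.locallyAC_u.hasACDeriv
  have dv := hF.locallyAC_v.hasACDeriv
  have dw := hF.locallyAC_w.hasACDeriv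
  have nu : ∀ r, 0 < r → ‖ub r‖ ^ 2 = 1 := fun r hr => by rw [hF.norm_u r hr]; norm_num
  have nv : ∀ r, 0 < r → ‖v r‖ ^ 2 = 1 := fun r hr => by rw [hF.norm_v r hr]; norm_num
  have uu : ∀ r, 0 < r → inner ℝ (ub r) (ub r) = (1:ℝ) := fun r hr => by
    rw [real_inner_self_eq_norm_sq, nu r hr]
  have vv : ∀ r, 0 < r → inner ℝ (v r) (v r) = (1:ℝ) := fun r hr => by
    rw [real_inner_self_eq_norm_sq, nv r hr]
  have wu : ∀ r, 0 < r → inner ℝ (w r) (ub r) = (0:ℝ) := fun r hr => by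
    rw [hF.w_eq r hr, inner_cross_left]
  have wv : ∀ r, 0 < r → inner ℝ (w r) (v r) = (0:ℝ) := fun r hr => by
    rw [hF.w_eq r hr, inner_cross_right]
  have ww : ∀ r, 0 < r → inner ℝ (w r) (w r) = (1:ℝ) := fun r hr => by
    rw [hF.w_eq r hr, inner_cross_self, nu r hr, nv r hr, real_inner_comm, hF.inner_v_u r hr]
    norm_num
  have main : ∀ᵐ r ∂(volume.restrict (Ioi (0 : ℝ))),
      deriv ub r = (q r).re • v r + (q r).im • w r ∧ deriv v r = -(q r).re • ub r ∧
        deriv w r = -(q r).im • ub r := by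
    filter_upwards [hψ, hF.coulomb, du.inner_deriv_eq_zero du uu, dv.inner_deriv_eq_zero dv vv,
      dw.inner_deriv_eq_zero dw ww, dv.inner_deriv_eq_zero du hF.inner_v_u,
      dw.inner_deriv_eq_zero du wu, dw.inner_deriv_eq_zero dv wv,
      ae_restrict_mem measurableSet_Ioi] with r hr hc huu hvv hww hvu hwu hwv hr0
    have hr0 : 0 < r := hr0
    have hexp := frame_expand (nu r hr0) (nv r hr0) (hF.inner_v_u r hr0) (hF.w_eq r hr0)
    have i1 : inner ℝ (fieldWMinus ub r) (v r) = inner ℝ (deriv ub r) (v r) - r⁻¹ * v r 2 := by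
      rw [fieldWMinus, cross_genR (nu r hr0), inner_sub_left, inner_smul_left, inner_sub_left,
        inner_smul_left, inner_vecK, real_inner_comm, real_inner_comm (v r) (ub r),
        hF.inner_v_u r hr0]
      simp
    have i2 : inner ℝ (fieldWMinus ub r) (w r) = inner ℝ (deriv ub r) (w r) - r⁻¹ * w r 2 := by
      rw [fieldWMinus, cross_genR (nu r hr0), inner_sub_left, inner_smul_left, inner_sub_left,
        inner_smul_left, inner_vecK, real_inner_comm, real_inner_comm (w r) (ub r), wu r hr0]
      simp
    have hq : q r = (inner ℝ (deriv ub r) (v r) : ℝ) + (inner ℝ (deriv ub r) (w r) : ℝ) *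
        Complex.I := by
      simp only [q]
      rw [hr, frameCoord, i1, i2]
      push_cast
      ring
    have q1 : (q r).re = inner ℝ (deriv ub r) (v r) := by rw [hq]; simp
    have q2 : (q r).im = inner ℝ (deriv ub r) (w r) := by rw [hq]; simp
    have a1 : inner ℝ (deriv ub r) (ub r) = 0 := by
      linarith [real_inner_comm (deriv ub r) (ub r)]
    have b1 : inner ℝ (deriv v r) (v r) = 0 := by linarith [real_inner_comm (deriv v r) (v r)]
    have c1 : inner ℝ (deriv w r) (w r) = 0 := by linarith [real_inner_comm (deriv w r) (w r)]
    have b2 : inner ℝ (deriv v r) (ub r) = -(q r).re := by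
      linarith [real_inner_comm (deriv ub r) (v r)]
    have c2 : inner ℝ (deriv w r) (ub r) = -(q r).im := by
      linarith [real_inner_comm (deriv ub r) (w r)]
    have c3 : inner ℝ (deriv w r) (v r) = 0 := by linarith [real_inner_comm (deriv v r) (w r)]
    refine ⟨?_, ?_, ?_⟩
    · rw [hexp (deriv ub r), a1, ← q1, ← q2, zero_smul, zero_add]
    · rw [hexp (deriv v r), b1, b2, hc, zero_smul, zero_smul, add_zero, add_zero]
    · rw [hexp (deriv w r), c1, c2, c3, zero_smul, zero_smul, add_zero, add_zero]
  refine ⟨du.congr_ae ?_, dv.congr_ae ?_, dw.congr_ae ?_⟩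
  · filter_upwards [main] with r h using h.1
  · filter_upwards [main] with r h using h.2.1
  · filter_upwards [main] with r h using h.2.2

theorem tendsto_apply {f : ℝ → Space} {y : Space} {l : Filter ℝ} (h : Tendsto f l (𝓝 y))
    (i : Fin 3) : Tendsto (fun r => f r i) l (𝓝 (y i)) :=
  ((EuclideanSpace.proj (𝕜 := ℝ) i : Space →L[ℝ] ℝ).continuous.tendsto y).comp h

theorem IsNormalizedCoulombFrame.tendsto_height {ub v w : ℝ → Space}
    (hF : IsNormalizedCoulombFrame ub v w) : Tendsto (fun r => ub r 2) atTop (𝓝 (-1)) := by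
  have h1 := ((tendsto_apply hF.tendsto_v 0).mul (tendsto_apply hF.tendsto_w 1)).sub
    ((tendsto_apply hF.tendsto_v 1).mul (tendsto_apply hF.tendsto_w 0))
  have e : vecI 0 * (-vecJ) 1 - vecI 1 * (-vecJ) 0 = -1 := by simp [vecI, vecJ]
  rw [e] at h1
  refine h1.congr' ?_
  filter_upwards [eventually_gt_atTop 0] with r hr
  have := cross_frame (by rw [hF.norm_v r hr]; norm_num) (hF.inner_v_u r hr) (hF.w_eq r hr)
  rw [← this, cross_two]

/-- The profile of a map represented by `ψ` stays away from the pole `k` below the threshold: its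
height decreases at most at the rate `r ‖ψ‖² / 4`, and it tends to `-1`. -/
theorem IsNormalizedCoulombFrame.height_le {ub v w : ℝ → Space} {ψ : ℝ → ℂ}
    (hF : IsNormalizedCoulombFrame ub v w) (hm : MemLp ψ 2 radialMeasure)
    (hψ : ∀ᵐ r ∂(volume.restrict (Ioi (0 : ℝ))),
      ψ r = frameCoord (fieldWMinus ub r) (v r) (w r)) {r : ℝ} (hr : 0 < r) :
    ub r 2 ≤ -1 + radNorm ψ ^ 2 / 4 := by
  obtain ⟨du, -, -⟩ := hF.frame_equations hψ
  have hlim := hF.tendsto_height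
  have hd := (du.apply 2).sub ((HasACDeriv.const (1 / 4 : ℝ)).mul (hasACDeriv_tail_sq hm))
  have hlim' := hlim.sub ((tendsto_tail_zero (MemLp.integrableOn_sq hm)).const_mul (1 / 4))
  have h := hd.le_lim_of_nonneg ?_ hlim' hr
  · have := tail_sq_le hm hr.le
    linarith
  · filter_upwards [ae_restrict_mem measurableSet_Ioi] with r hr
    have hr : 0 < r := hr
    set a := v r 2
    set b := w r 2
    have e0 : ((a : ℂ) + b * Complex.I) / r =
        ((a / r : ℝ) : ℂ) + ((b / r : ℝ) : ℂ) * Complex.I := by push_cast; ring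
    have e1 : (ψ r + ((a : ℂ) + b * Complex.I) / r).re = (ψ r).re + a / r := by
      rw [e0]; simp
    have e2 : (ψ r + ((a : ℂ) + b * Complex.I) / r).im = (ψ r).im + b / r := by
      rw [e0]; simp
    have e3 : ‖ψ r‖ ^ 2 = (ψ r).re ^ 2 + (ψ r).im ^ 2 := by
      rw [← Complex.normSq_eq_norm_sq, Complex.normSq_apply]; ring
    simp only [PiLp.add_apply, PiLp.smul_apply, smul_eq_mul]
    rw [e1, e2, e3]
    have : ((ψ r).re + a / r) * a + ((ψ r).im + b / r) * b -
        (0 * (∫ x in Ioi r, x * ‖ψ x‖ ^ 2) + 1 / 4 * -(r * ((ψ r).re ^ 2 + (ψ r).im ^ 2))) =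
        ((r * (ψ r).re / 2 + a) ^ 2 + (r * (ψ r).im / 2 + b) ^ 2) / r := by
      field_simp; ring
    rw [this]; positivity

/-- A map represented by `ψ` below the threshold has the profile reconstructed from a solution of
the Riccati equation. -/
theorem IsNormalizedCoulombFrame.exists_isRiccati {ub v w : ℝ → Space} {ψ : ℝ → ℂ}
    (hF : IsNormalizedCoulombFrame ub v w) (hm : MemLp ψ 2 radialMeasure)
    (hm8 : radNorm ψ < 2 * √2)
    (hψ : ∀ᵐ r ∂(volume.restrict (Ioi (0 : ℝ))),
      ψ r = frameCoord (fieldWMinus ub r) (v r) (w r)) :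
    ∃ z, IsRiccati ψ z ∧ ∀ r, 0 < r → ub r = profile ψ z r := by
  obtain ⟨du, dv, dw⟩ := hF.frame_equations hψ
  set q : ℝ → ℂ := fun r => ψ r + ((v r 2 : ℂ) + w r 2 * Complex.I) / r with hq
  have nu : ∀ r, 0 < r → ‖ub r‖ ^ 2 = 1 := fun r hr => by rw [hF.norm_u r hr]; norm_num
  have nv : ∀ r, 0 < r → ‖v r‖ ^ 2 = 1 := fun r hr => by rw [hF.norm_v r hr]; norm_num
  have hcomp := fun r (hr : (0:ℝ) < r) =>
    frame_complete (nu r hr) (nv r hr) (hF.inner_v_u r hr) (hF.w_eq r hr)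
  have hcyc := fun r (hr : (0:ℝ) < r) => cross_frame (nv r hr) (hF.inner_v_u r hr) (hF.w_eq r hr)
  have hpos : ∀ r, 0 < r → 0 < 1 - ub r 2 := fun r hr => by
    have h1 := hF.height_le hm hψ hr
    have h2 := lt_eight_of_lt (radNorm_nonneg ψ) hm8
    linarith
  set ζ : ℝ → ℂ := fun r => (v r 2 : ℂ) + w r 2 * Complex.I with hζ
  set z : ℝ → ℂ := fun r => ζ r * ((1 - ub r 2)⁻¹ : ℝ) with hz
  have hζζ : ∀ r, 0 < r → star (ζ r) * ζ r = ((1 - ub r 2 : ℝ) : ℂ) * ((1 + ub r 2 : ℝ) : ℂ) := by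
    intro r hr
    have h1 := hcomp r hr 2 2
    simp only [if_true] at h1
    have h2 : ((ub r 2 * ub r 2 + v r 2 * v r 2 + w r 2 * w r 2 : ℝ) : ℂ) = 1 := by
      rw [h1]; norm_num
    push_cast at h2 ⊢
    simp only [hζ, star_add, star_mul', Complex.star_def, Complex.conj_ofReal, Complex.conj_I]
    linear_combination h2 - (w r 2 : ℂ) ^ 2 * Complex.I_sq
  have hne : ∀ r, 0 < r → ((1 - ub r 2 : ℝ) : ℂ) ≠ 0 := fun r hr =>
    Complex.ofReal_ne_zero.2 (hpos r hr).ne'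
  have hsz : ∀ r, star (z r) = star (ζ r) * ((1 - ub r 2)⁻¹ : ℝ) := fun r => by
    simp only [hz, star_mul', Complex.star_def, Complex.conj_ofReal]
  have hconf : ∀ r, 0 < r → conf (z r) = (1 - ub r 2) / 2 := by
    intro r hr
    have h1 := conf_mul_complex (z r)
    have h2 := hne r hr
    apply Complex.ofReal_injective
    rw [hsz] at h1
    simp only [hz] at h1 ⊢
    have h3 : (1 + star (ζ r) * (((1 - ub r 2)⁻¹ : ℝ) : ℂ) * (ζ r * (((1 - ub r 2)⁻¹ : ℝ) : ℂ))) =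
        2 / ((1 - ub r 2 : ℝ) : ℂ) := by
      have h4 := hζζ r hr
      rw [Complex.ofReal_inv]
      field_simp
      rw [h4]; push_cast; ring
    rw [h3] at h1
    field_simp at h1
    rw [Complex.ofReal_div, ← h1]
    push_cast; ring_nf
  have hzc : ∀ r, 0 < r → 2 * z r * conf (z r) = ζ r := fun r hr => by
    rw [hconf r hr]
    have h2 := hne r hr
    simp only [hz]
    rw [Complex.ofReal_inv, Complex.ofReal_div]
    field_simp
    push_cast; ring
  have hconn : ∀ r, 0 < r → connCoeff ψ z r = q r := fun r hr => by
    rw [connCoeff, hzc r hr]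
  have dζ : HasACDeriv ζ (fun r => -q r * ub r 2) := by
    refine ((dv.apply 2).ofReal.add ((dw.apply 2).ofReal.mul (.const Complex.I))).congr_deriv
      fun r _ => ?_
    have e := Complex.re_add_im (q r)
    simp only [PiLp.smul_apply, smul_eq_mul]
    push_cast
    linear_combination (-(ub r 2 : ℂ)) * e
  have dh : HasACDeriv (fun r => ub r 2) (fun r => (q r * star (ζ r)).re) := by
    refine (du.apply 2).congr_deriv fun r _ => ?_
    simp [hζ]
  have dz : HasACDeriv z (fun r => (q r + star (q r) * z r ^ 2) / 2) := by
    refine (dζ.mul (((HasACDeriv.const (1:ℝ)).sub dh).inv fun r hr =>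
      (hpos r hr).ne').ofReal).congr_deriv fun r hr => ?_
    have h2 := hne r hr
    have h4 := hζζ r hr
    simp only [hz]
    push_cast at h2 h4 ⊢
    rw [re_eq_half]
    simp only [star_mul', star_star]
    field_simp
    linear_combination (q r) * h4
  have hRic : IsRiccati ψ z := by
    refine ⟨dz.congr_deriv fun r hr => ?_, ?_⟩
    · rw [riccati_rhs_eq ψ z hr, hconn r hr]
    · have h1 := (tendsto_apply hF.tendsto_v 2)
      have h2 := (tendsto_apply hF.tendsto_w 2)
      have h3 := (((Complex.continuous_ofReal.tendsto _).comp h1).add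
        (((Complex.continuous_ofReal.tendsto _).comp h2).mul_const Complex.I)).mul
        ((Complex.continuous_ofReal.tendsto _).comp
          ((hF.tendsto_height.const_sub 1).inv₀ (by norm_num)))
      have e : ((vecI 2 : ℂ) + ((-vecJ) 2 : ℝ) * Complex.I) * ((1 - -1)⁻¹ : ℝ) = 0 := by
        simp [vecI, vecJ]
      rw [e] at h3
      exact h3
  have hK := hRic.norm_le_slopeBound hm le_rfl hm8
  -- the horizontal part of `v + i w` solves the same linear equation as the gauge factor
  set N : ℝ → ℂ := fun r => horiz (v r) + Complex.I * horiz (w r) with hN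
  have hU : ∀ r, 0 < r → star (z r) * N r = horiz (ub r) := by
    intro r hr
    have h0 := hcomp r hr 0 2
    have h1 := hcomp r hr 1 2
    have c0 : v r 1 * w r 2 - v r 2 * w r 1 = ub r 0 := by rw [← hcyc r hr, cross_zero]
    have c1 : v r 2 * w r 0 - v r 0 * w r 2 = ub r 1 := by rw [← hcyc r hr, cross_one]
    simp only [Fin.reduceEq, if_false] at h0 h1
    have key : star (ζ r) * N r = ((1 - ub r 2 : ℝ) : ℂ) * horiz (ub r) := by
      apply Complex.ext
      · simp [hζ, hN, horiz]; linarith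
      · simp [hζ, hN, horiz]; linarith
    rw [hsz, Complex.ofReal_inv, mul_right_comm, key]
    have h2 := hne r hr
    field_simp
  have dN : HasACDeriv N (fun r => -(q r * star (z r)) * N r) := by
    refine (dv.horiz.add ((HasACDeriv.const Complex.I).mul dw.horiz)).congr_deriv fun r hr => ?_
    rw [neg_mul, mul_assoc, hU r hr]
    apply Complex.ext <;> simp [horiz] <;> ring_nf
  have hlimN : Tendsto N atTop (𝓝 2) := by
    have t : ∀ {f : ℝ → Space} {y : Space}, Tendsto f atTop (𝓝 y) →
        Tendsto (fun r => horiz (f r)) atTop (𝓝 (horiz y)) := by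
      intro f y h
      have e : ∀ y : Space, horiz y = (y 0 : ℂ) + (y 1 : ℂ) * Complex.I :=
        fun y => by apply Complex.ext <;> simp [horiz]
      simp only [e]
      exact ((Complex.continuous_ofReal.tendsto _).comp (tendsto_apply h 0)).add
        (((Complex.continuous_ofReal.tendsto _).comp (tendsto_apply h 1)).mul_const _)
    have h1 := (t hF.tendsto_v).add ((t hF.tendsto_w).const_mul Complex.I)
    have e : horiz vecI + Complex.I * horiz (-vecJ) = 2 := by
      apply Complex.ext
      · simp [horiz, vecI, vecJ]; norm_num
      · simp [horiz, vecI, vecJ]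
    rwa [e] at h1
  have dG := hRic.hasACDeriv_gaugeFactor hm hK
  have hGN : ∀ r, 0 < r → N r = gaugeFactor ψ z r := by
    intro r hr
    have hi := fun a (ha : (0:ℝ) < a) => (hRic.integrable_conn hm hK).mono_set
      (Ioi_subset_Ioi (le_of_lt ha))
    have hD := dN.mul ((HasACDeriv.tail hi).neg).cexp
    have hlim := hlimN.mul ((Complex.continuous_exp.tendsto _).comp
      (tendsto_tail_zero (hRic.integrable_conn hm hK)).neg)
    have h0 := (hD.congr_deriv (g' := fun _ => 0) fun r hr => ?_).eq_lim_of_zero hlim hr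
    · rw [neg_zero, Complex.exp_zero, mul_one] at h0
      rw [gaugeFactor, ← h0, mul_assoc, ← Complex.exp_add]
      simp
    · rw [hconn r hr]; ring
  refine ⟨z, hRic, fun r hr => ?_⟩
  rw [profile, ← hGN r hr, hU r hr, height, hconf r hr]
  rw [show 1 - 2 * ((1 - ub r 2) / 2) = ub r 2 by ring, vec_horiz]

/-! ### The energy identity -/

/-- The radial derivative of the reconstructed profile. -/
def profileDeriv (ψ z : ℝ → ℂ) (r : ℝ) : Space :=
  vec (gaugeFactor ψ z r * (star (connCoeff ψ z r) - connCoeff ψ z r * star (z r) ^ 2) / 2)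
    (2 * conf (z r) * (connCoeff ψ z r * star (z r)).re)

/-- As `1 / r` is not integrable at the origin, `f / r` can be so only if `f` has limit zero. -/
theorem eq_zero_of_integrable_div {f : ℝ → ℝ} {L : ℝ}
    (hi : IntegrableOn (fun r => f r / r) (Ioi 0)) (hf : Tendsto f (𝓝[>] 0) (𝓝 L)) : L = 0 := by
  by_contra hL
  have hL' : 0 < |L| := abs_pos.2 hL
  have h1 : ∀ᶠ r in 𝓝[>] (0:ℝ), |L| / 2 < |f r| :=
    hf.abs.eventually (lt_mem_nhds (by linarith))
  obtain ⟨δ, hδ, h2⟩ := mem_nhdsGT_iff_exists_Ioc_subset.1 h1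
  have hδ : (0:ℝ) < δ := hδ
  have h3 : IntegrableOn (fun r : ℝ => r⁻¹) (Ioc 0 δ) := by
    refine ((hi.mono_set Ioc_subset_Ioi_self).norm.const_mul (2 / |L|)).mono'
      measurable_inv.aestronglyMeasurable ((ae_restrict_iff' measurableSet_Ioc).2
      (Eventually.of_forall fun r hr => ?_))
    have hr0 : 0 < r := hr.1
    have h4 : |L| / 2 < |f r| := h2 hr
    rw [Real.norm_of_nonneg (inv_nonneg.2 hr0.le), Real.norm_eq_abs, abs_div, abs_of_pos hr0]
    rw [← one_div, div_mul_div_comm]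
    rw [div_le_div_iff₀ hr0 (by positivity)]
    nlinarith
  rw [← intervalIntegrable_iff_integrableOn_Ioc_of_le hδ.le] at h3
  rcases intervalIntegrable_inv_iff.1 h3 with h | h
  · exact hδ.ne h
  · exact h left_mem_uIcc

theorem tendsto_setIntegral_Ioi_zero {E : Type*} [NormedAddCommGroup E] [NormedSpace ℝ E]
    {f : ℝ → E} (hf : IntegrableOn f (Ioi 0)) :
    Tendsto (fun a => ∫ x in Ioi a, f x) (𝓝[>] 0) (𝓝 (∫ x in Ioi 0, f x)) := by
  have h := (aecover_Ioi_of_Ioi (μ := volume) (A := (0:ℝ)) (l := 𝓝[>] (0:ℝ)) (a := fun a => a)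
    (tendsto_nhdsWithin_of_tendsto_nhds tendsto_id)).integral_tendsto_of_countably_generated hf
  refine h.congr' ?_
  filter_upwards [self_mem_nhdsWithin] with a ha
  rw [Measure.restrict_restrict_of_subset (Ioi_subset_Ioi (le_of_lt ha))]

section Energy

variable {ψ z : ℝ → ℂ}

theorem norm_conf_mul_le (z : ℂ) : conf z * ‖z‖ ≤ 1 / 2 := by
  have h1 := conf_mul z
  have h2 := conf_pos z
  nlinarith [sq_nonneg (1 - ‖z‖)]

/-- The height of the profile has the same limit `-1` at both ends. -/
theorem IsRiccati.integral_height_deriv (hz : IsRiccati ψ z) (hψ : MemLp ψ 2 radialMeasure)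
    {K : ℝ} (hK : ∀ r, 0 < r → ‖z r‖ ≤ K) :
    IntegrableOn (fun r => 2 * conf (z r) * (connCoeff ψ z r * star (z r)).re) (Ioi 0) ∧
    ∫ r in Ioi 0, 2 * conf (z r) * (connCoeff ψ z r * star (z r)).re = 0 := by
  have hq := hz.integrable_conn hψ hK
  have hzc := hz.hasACDeriv.continuousOn
  have hi : IntegrableOn (fun r => 2 * conf (z r) * (connCoeff ψ z r * star (z r)).re)
      (Ioi 0) := by
    refine (hq.norm.const_mul 2).mono' ?_ (Eventually.of_forall fun r => ?_)
    · exact ((continuousOn_const.mul (continuousOn_conf hzc)).aestronglyMeasurable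
        measurableSet_Ioi).mul
        (Complex.continuous_re.comp_aestronglyMeasurable hq.aestronglyMeasurable)
    · rw [norm_mul, norm_mul, Real.norm_of_nonneg (conf_pos _).le, Real.norm_ofNat]
      have h1 := conf_le_one (z r)
      have h2 := Complex.abs_re_le_norm (connCoeff ψ z r * star (z r))
      have h3 := (conf_pos (z r)).le
      calc _ ≤ 2 * 1 * ‖connCoeff ψ z r * star (z r)‖ := by
            gcongr
            exact h2
        _ = _ := by ring
  refine ⟨hi, ?_⟩
  have hd : HasACDeriv (fun r => 1 - conf (z r))
      (fun r => conf (z r) * (connCoeff ψ z r * star (z r)).re) :=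
    ((HasACDeriv.const (1:ℝ)).sub hz.hasACDeriv_conf).congr_deriv fun r _ => by ring
  have hi' : IntegrableOn (fun r => conf (z r) * (connCoeff ψ z r * star (z r)).re) (Ioi 0) := by
    refine (hi.const_mul (1 / 2)).congr (Eventually.of_forall fun r => ?_)
    simp only; ring
  have hsum := hd.add (HasACDeriv.tail fun a ha => hi'.mono_set (Ioi_subset_Ioi (le_of_lt ha)))
  have hlim := ((tendsto_conf hz.tendsto).const_sub 1).add (tendsto_tail_zero hi')
  have heq : ∀ a, 0 < a → 1 - conf (z a) =
      -∫ r in Ioi a, conf (z r) * (connCoeff ψ z r * star (z r)).re := fun a ha => by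
    have := (hsum.congr_deriv (g' := fun _ => 0) fun r _ => by ring).eq_lim_of_zero hlim ha
    linarith
  have ht : Tendsto (fun a => 1 - conf (z a)) (𝓝[>] 0)
      (𝓝 (-∫ r in Ioi 0, conf (z r) * (connCoeff ψ z r * star (z r)).re)) := by
    refine (tendsto_setIntegral_Ioi_zero hi').neg.congr' ?_
    filter_upwards [self_mem_nhdsWithin] with a ha using (heq a ha).symm
  have hdiv : IntegrableOn (fun r => (1 - conf (z r)) / r) (Ioi 0) := by
    refine (MemLp.integrableOn_sq (hz.memLp_div hψ hK).1).mono' ?_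
      ((ae_restrict_iff' measurableSet_Ioi).2 (Eventually.of_forall fun r hr => ?_))
    · exact ((continuousOn_const.sub (continuousOn_conf hzc)).div continuousOn_id
        fun r hr => ne_of_gt hr).aestronglyMeasurable measurableSet_Ioi
    · have hr : (0:ℝ) < r := hr
      have h1 := conf_mul (z r)
      have h2 := conf_le_one (z r)
      have h3 := sq_nonneg ‖z r‖
      rw [Real.norm_of_nonneg (div_nonneg (by linarith) hr.le), norm_div, Complex.norm_real,
        Real.norm_of_nonneg hr.le, div_pow]
      have h4 : r * (‖z r‖ ^ 2 / r ^ 2) = ‖z r‖ ^ 2 / r := by field_simp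
      rw [h4]
      gcongr
      nlinarith
  have h0 := eq_zero_of_integrable_div hdiv ht
  have : ∫ r in Ioi 0, 2 * conf (z r) * (connCoeff ψ z r * star (z r)).re =
      2 * ∫ r in Ioi 0, conf (z r) * (connCoeff ψ z r * star (z r)).re := by
    rw [← integral_const_mul]
    congr 1; ext r; ring
  rw [this]; linarith

theorem norm_gaugeFactor (hz : IsRiccati ψ z) (hψ : MemLp ψ 2 radialMeasure)
    {K : ℝ} (hK : ∀ r, 0 < r → ‖z r‖ ≤ K) {r : ℝ} (hr : 0 < r) :
    ‖gaugeFactor ψ z r‖ = 2 * conf (z r) := by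
  have h := congrArg norm (hz.gaugeFactor_mul_star hψ hK hr)
  rw [norm_mul, norm_star, norm_mul, norm_pow, Complex.norm_real,
    Real.norm_of_nonneg (conf_pos _).le, Complex.norm_ofNat] at h
  have h2 : ‖gaugeFactor ψ z r‖ ^ 2 = (2 * conf (z r)) ^ 2 := by rw [sq, h]; ring
  exact (pow_left_inj₀ (norm_nonneg _) (by have := conf_pos (z r); positivity) two_ne_zero).1 h2

/-- The radial derivative is `q` in the frame, hence of the same length. -/
theorem norm_profileDeriv (hz : IsRiccati ψ z) (hψ : MemLp ψ 2 radialMeasure)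
    {K : ℝ} (hK : ∀ r, 0 < r → ‖z r‖ ≤ K) {r : ℝ} (hr : 0 < r) :
    ‖profileDeriv ψ z r‖ ^ 2 = ‖connCoeff ψ z r‖ ^ 2 := by
  rw [profileDeriv, norm_sq_vec]
  have hN := hz.gaugeFactor_mul_star hψ hK hr
  have hc := conf_mul_complex (z r)
  set q := connCoeff ψ z r
  set N := gaugeFactor ψ z r
  set c := conf (z r)
  set ζ := z r
  apply Complex.ofReal_injective
  push_cast
  have e : ∀ a : ℂ, ((‖a‖ : ℂ)) ^ 2 = star a * a := fun a => by
    rw [star_mul_self_eq]; push_cast; rfl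
  rw [e, e, re_eq_half]
  simp only [star_mul', star_div₀, star_sub, star_pow, star_star, star_ofNat]
  linear_combination ((q - star q * ζ ^ 2) * (star q - q * star ζ ^ 2) / 4) * hN +
    (q * star q) * (c * (1 + star ζ * ζ) + 1) * hc

theorem norm_sq_genR_profile (hz : IsRiccati ψ z) (hψ : MemLp ψ 2 radialMeasure)
    {K : ℝ} (hK : ∀ r, 0 < r → ‖z r‖ ≤ K) {r : ℝ} (hr : 0 < r) :
    ‖genR (profile ψ z r)‖ ^ 2 = 4 * conf (z r) ^ 2 * ‖z r‖ ^ 2 := by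
  rw [genR_apply, profile, horiz_vec, norm_sq_vec, norm_mul, norm_mul, norm_star,
    norm_gaugeFactor hz hψ hK hr, Complex.norm_I]
  ring

/-- The energy density of the profile is that of `ψ` up to a total derivative. -/
theorem energy_density_eq (hz : IsRiccati ψ z) (hψ : MemLp ψ 2 radialMeasure)
    {K : ℝ} (hK : ∀ r, 0 < r → ‖z r‖ ≤ K) {r : ℝ} (hr : 0 < r) :
    r * ‖profileDeriv ψ z r‖ ^ 2 + r * ‖r⁻¹ • genR (profile ψ z r)‖ ^ 2 =
      r * ‖ψ r‖ ^ 2 + 2 * (2 * conf (z r) * (connCoeff ψ z r * star (z r)).re) := by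
  rw [norm_profileDeriv hz hψ hK hr, norm_smul, mul_pow, norm_sq_genR_profile hz hψ hK hr,
    Real.norm_of_nonneg (inv_nonneg.2 hr.le)]
  have hr0 : (r : ℂ) ≠ 0 := Complex.ofReal_ne_zero.2 hr.ne'
  have e : ∀ a : ℂ, ((‖a‖ : ℂ)) ^ 2 = star a * a := fun a => by
    rw [star_mul_self_eq]; push_cast; rfl
  have h3 : star (connCoeff ψ z r) = star (ψ r) + 2 * star (z r) * conf (z r) / r := by
    rw [connCoeff]
    simp [Complex.conj_ofReal]
  apply Complex.ofReal_injective
  push_cast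
  rw [re_eq_half, e, e, e]
  simp only [star_mul', star_star]
  rw [h3, connCoeff]
  field_simp
  ring

theorem memLp_profileDeriv (hz : IsRiccati ψ z) (hψ : MemLp ψ 2 radialMeasure)
    {K : ℝ} (hK : ∀ r, 0 < r → ‖z r‖ ≤ K) : MemLp (profileDeriv ψ z) 2 radialMeasure := by
  have hu := hz.hasACDeriv_profile hψ hK
  have hm : AEStronglyMeasurable (profileDeriv ψ z) (volume.restrict (Ioi 0)) := by
    refine (aestronglyMeasurable_deriv (profile ψ z) _).congr ?_
    filter_upwards [hu.ae] with r hr using hr.deriv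
  refine (radNorm_le_mul hm (hz.memLp_connCoeff hψ hK).1 zero_le_one ?_).1
  filter_upwards [ae_restrict_mem measurableSet_Ioi] with r hr
  have := norm_profileDeriv hz hψ hK hr
  rw [one_mul]
  exact ((pow_left_inj₀ (norm_nonneg _) (norm_nonneg _) two_ne_zero).1 this).le

theorem HasACDeriv.aesm_genR_div {f g : ℝ → Space} (h : HasACDeriv f g) :
    AEStronglyMeasurable (fun r => r⁻¹ • genR (f r)) (volume.restrict (Ioi 0)) := by
  refine ContinuousOn.aestronglyMeasurable ?_ measurableSet_Ioi
  refine ContinuousOn.smul (continuousOn_id.inv₀ fun r hr => ne_of_gt hr) ?_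
  simp only [genR_apply]
  exact (((HasACDeriv.const Complex.I).mul h.horiz).vec (HasACDeriv.const (0:ℝ))).continuousOn

theorem memLp_genR_profile (hz : IsRiccati ψ z) (hψ : MemLp ψ 2 radialMeasure)
    {K : ℝ} (hK : ∀ r, 0 < r → ‖z r‖ ≤ K) :
    MemLp (fun r => r⁻¹ • genR (profile ψ z r)) 2 radialMeasure := by
  refine (radNorm_le_mul (hz.hasACDeriv_profile hψ hK).aesm_genR_div (hz.memLp_div hψ hK).1
    zero_le_two ?_).1
  filter_upwards [ae_restrict_mem measurableSet_Ioi] with r hr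
  have hr : (0:ℝ) < r := hr
  rw [genR_apply, profile, horiz_vec, norm_smul, norm_div, Complex.norm_real]
  have e : ‖vec (Complex.I * (star (z r) * gaugeFactor ψ z r)) 0‖ =
      2 * conf (z r) * ‖z r‖ := by
    have h1 := norm_sq_genR_profile hz hψ hK hr
    rw [genR_apply, profile, horiz_vec] at h1
    have := conf_pos (z r)
    refine (pow_left_inj₀ (norm_nonneg _) (by positivity) two_ne_zero).1 ?_
    rw [h1]; ring
  rw [e, norm_inv]
  have h2 := conf_le_one (z r)
  have h3 : 0 ≤ ‖r‖⁻¹ * ‖z r‖ := by positivity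
  calc ‖r‖⁻¹ * (2 * conf (z r) * ‖z r‖) = 2 * (conf (z r) * (‖r‖⁻¹ * ‖z r‖)) := by ring
    _ ≤ 2 * (1 * (‖r‖⁻¹ * ‖z r‖)) := by gcongr
    _ = _ := by ring

theorem energy_profile_eq (hz : IsRiccati ψ z) (hψ : MemLp ψ 2 radialMeasure)
    {K : ℝ} (hK : ∀ r, 0 < r → ‖z r‖ ≤ K) :
    radNorm (profileDeriv ψ z) ^ 2 + radNorm (fun r => r⁻¹ • genR (profile ψ z r)) ^ 2 =
      radNorm ψ ^ 2 := by
  have h1 := memLp_profileDeriv hz hψ hK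
  have h2 := memLp_genR_profile hz hψ hK
  obtain ⟨h3, h4⟩ := hz.integral_height_deriv hψ hK
  rw [radNorm_sq h1, radNorm_sq h2, radNorm_sq hψ,
    ← integral_add (MemLp.integrableOn_sq h1) (MemLp.integrableOn_sq h2),
    setIntegral_congr_fun measurableSet_Ioi fun r hr => energy_density_eq hz hψ hK hr,
    integral_add (MemLp.integrableOn_sq hψ) (h3.const_mul 2), integral_const_mul, h4]
  ring

end Energy

/-! ### Lipschitz dependence of the profile -/

/-- The exponential is a contraction on the left half-plane. -/
theorem norm_cexp_sub_le {a b : ℂ} (ha : a.re ≤ 0) (hb : b.re ≤ 0) :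
    ‖Complex.exp a - Complex.exp b‖ ≤ ‖a - b‖ := by
  have := Convex.norm_image_sub_le_of_norm_hasDerivWithin_le (𝕜 := ℂ) (f := Complex.exp)
    (f' := Complex.exp) (s := {c : ℂ | c.re ≤ 0}) (C := 1)
    (fun x _ => (Complex.hasDerivAt_exp x).hasDerivWithinAt)
    (fun x hx => by rw [Complex.norm_exp]; exact Real.exp_le_one_iff.2 hx)
    (convex_halfSpace_re_le 0) hb ha
  simpa using this

theorem abs_conf_sub_le (z w : ℂ) : |conf z - conf w| ≤ ‖z - w‖ := by
  have hz := conf_mul z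
  have hw := conf_mul w
  have e : conf z - conf w = conf z * conf w * ((‖w‖ - ‖z‖) * (‖w‖ + ‖z‖)) := by
    linear_combination conf z * (-hw) + conf w * hz
  have h1 := norm_conf_mul_le z
  have h2 := norm_conf_mul_le w
  have h3 := conf_le_one z
  have h4 := conf_le_one w
  have h5 := (conf_pos z).le
  have h6 := (conf_pos w).le
  have h7 : |‖w‖ - ‖z‖| ≤ ‖z - w‖ := by rw [norm_sub_rev]; exact abs_norm_sub_norm_le w z
  have h8 : conf z * conf w * (‖w‖ + ‖z‖) ≤ 1 := by
    have a1 : conf z * (conf w * ‖w‖) ≤ 1 * (1 / 2) := by gcongr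
    have a2 : conf w * (conf z * ‖z‖) ≤ 1 * (1 / 2) := by gcongr
    linarith
  have h9 : 0 ≤ conf z * conf w * (‖w‖ + ‖z‖) := by positivity
  rw [e, show conf z * conf w * ((‖w‖ - ‖z‖) * (‖w‖ + ‖z‖)) =
    (conf z * conf w * (‖w‖ + ‖z‖)) * (‖w‖ - ‖z‖) by ring, abs_mul, abs_of_nonneg h9]
  calc _ ≤ 1 * ‖z - w‖ := by gcongr
    _ = _ := one_mul _

theorem norm_mul_conf_sub_le {z w : ℂ} {K : ℝ} (hw : ‖w‖ ≤ K) :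
    ‖z * conf z - w * conf w‖ ≤ (1 + K) * ‖z - w‖ := by
  have e : z * conf z - w * conf w = (z - w) * conf z + w * ((conf z - conf w : ℝ) : ℂ) := by
    push_cast; ring
  rw [e]
  refine (norm_add_le _ _).trans ?_
  rw [norm_mul, norm_mul, Complex.norm_real, Complex.norm_real, Real.norm_of_nonneg
    (conf_pos z).le, Real.norm_eq_abs]
  have h1 := conf_le_one z
  have h2 := abs_conf_sub_le z w
  have h3 : 0 ≤ K := (norm_nonneg w).trans hw
  calc _ ≤ ‖z - w‖ * 1 + K * ‖z - w‖ := by gcongr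
    _ = _ := by ring

theorem norm_vec_le (a : ℂ) (h : ℝ) : ‖vec a h‖ ≤ ‖a‖ + |h| := by
  refine abs_le_of_sq_le_sq' ?_ (by positivity) |>.2
  rw [norm_sq_vec, ← sq_abs h]
  nlinarith [norm_nonneg a, abs_nonneg h]

/-- The horizontal part of the difference of two profile derivatives. -/
theorem norm_rotated_sub_le {q q' N N' z z' : ℂ} {K a b : ℝ} (hz : ‖z‖ ≤ K) (hz' : ‖z'‖ ≤ K)
    (ha : ‖z - z'‖ ≤ a) (hb : ‖N - N'‖ ≤ b) (hN' : ‖N'‖ ≤ 2) :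
    ‖N * (star q - q * star z ^ 2) / 2 - N' * (star q' - q' * star z' ^ 2) / 2‖ ≤
      (b * ((1 + K ^ 2) * ‖q‖) +
        2 * ((1 + K ^ 2) * ‖q - q'‖ + ‖q'‖ * (a * (2 * K)))) / 2 := by
  have hK : 0 ≤ K := (norm_nonneg z).trans hz
  have ha0 : 0 ≤ a := (norm_nonneg _).trans ha
  have hb0 : 0 ≤ b := (norm_nonneg _).trans hb
  have hzz : ‖z‖ ^ 2 ≤ K ^ 2 := by gcongr
  have n1 : ∀ p : ℂ, ‖star p - p * star z ^ 2‖ ≤ (1 + K ^ 2) * ‖p‖ := fun p => by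
    refine (norm_sub_le _ _).trans ?_
    rw [norm_mul, norm_pow, norm_star, norm_star]
    nlinarith [norm_nonneg p]
  have n2 : ‖star (q - q') - (q - q') * star z ^ 2 - q' * (star (z - z') * star (z + z'))‖ ≤
      (1 + K ^ 2) * ‖q - q'‖ + ‖q'‖ * (a * (2 * K)) := by
    refine (norm_sub_le _ _).trans (add_le_add (n1 _) ?_)
    rw [norm_mul, norm_mul, norm_star, norm_star]
    have : ‖z + z'‖ ≤ 2 * K := (norm_add_le _ _).trans (by linarith)
    gcongr
  have e1 : N * (star q - q * star z ^ 2) / 2 - N' * (star q' - q' * star z' ^ 2) / 2 =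
      ((N - N') * (star q - q * star z ^ 2) + N' * (star (q - q') -
      (q - q') * star z ^ 2 - q' * (star (z - z') * star (z + z')))) / 2 := by
    simp only [star_sub, star_add]; ring
  rw [e1, norm_div, Complex.norm_ofNat]
  gcongr
  refine (norm_add_le _ _).trans ?_
  rw [norm_mul, norm_mul]
  have := n1 q
  gcongr

/-- The vertical part of the difference of two profile derivatives. -/
theorem abs_vertical_sub_le {q q' z z' : ℂ} {K a : ℝ} (hz : ‖z‖ ≤ K) (hz' : ‖z'‖ ≤ K)
    (ha : ‖z - z'‖ ≤ a) :
    |2 * conf z * (q * star z).re - 2 * conf z' * (q' * star z').re| ≤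
      2 * (‖q - q'‖ * K + ‖q'‖ * ((1 + K) * a)) := by
  have hK : 0 ≤ K := (norm_nonneg z).trans hz
  have t : ∀ (c : ℝ) (x : ℂ), 2 * c * x.re = 2 * (x * c).re := fun c x => by simp; ring
  have e2 : 2 * conf z * (q * star z).re - 2 * conf z' * (q' * star z').re =
      2 * ((q - q') * star z * conf z + q' * star (z * conf z - z' * conf z')).re := by
    rw [t, t, ← mul_sub, ← Complex.sub_re]
    congr 2
    simp only [star_sub, star_mul', Complex.star_def, Complex.conj_ofReal]
    ring
  rw [e2, abs_mul, abs_two]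
  gcongr
  refine (Complex.abs_re_le_norm _).trans ((norm_add_le _ _).trans ?_)
  rw [norm_mul, norm_mul, norm_mul, norm_star, norm_star, Complex.norm_real,
    Real.norm_of_nonneg (conf_pos _).le]
  have c1 := conf_le_one z
  have c2 := (conf_pos z).le
  have c3 : ‖z * conf z - z' * conf z'‖ ≤ (1 + K) * a :=
    (norm_mul_conf_sub_le hz').trans (by gcongr)
  calc _ ≤ ‖q - q'‖ * K * 1 + ‖q'‖ * ((1 + K) * a) := by gcongr
    _ = _ := by ring

theorem norm_profileDeriv_sub_le {ψ ψ' z z' : ℝ → ℂ} {r K a b : ℝ} (hz : ‖z r‖ ≤ K)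
    (hz' : ‖z' r‖ ≤ K) (ha : ‖z r - z' r‖ ≤ a)
    (hb : ‖gaugeFactor ψ z r - gaugeFactor ψ' z' r‖ ≤ b) (hN' : ‖gaugeFactor ψ' z' r‖ ≤ 2) :
    ‖profileDeriv ψ z r - profileDeriv ψ' z' r‖ ≤
      ((1 + K ^ 2) + 2 * K) * ‖connCoeff ψ z r - connCoeff ψ' z' r‖ +
      (b * (1 + K ^ 2) + 2 * K * a + 2 * (1 + K) * a) *
        (‖connCoeff ψ z r‖ + ‖connCoeff ψ' z' r‖) := by
  have hK : 0 ≤ K := (norm_nonneg _).trans hz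
  have ha0 : 0 ≤ a := (norm_nonneg _).trans ha
  have hb0 : 0 ≤ b := (norm_nonneg _).trans hb
  have n3 := norm_rotated_sub_le (q := connCoeff ψ z r) (q' := connCoeff ψ' z' r) hz hz' ha hb hN'
  have n4 := abs_vertical_sub_le (q := connCoeff ψ z r) (q' := connCoeff ψ' z' r) hz hz' ha
  rw [profileDeriv, profileDeriv, vec_sub]
  refine (norm_vec_le _ _).trans ((add_le_add n3 n4).trans ?_)
  generalize ‖connCoeff ψ z r - connCoeff ψ' z' r‖ = d
  have hq := norm_nonneg (connCoeff ψ z r)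
  have hq' := norm_nonneg (connCoeff ψ' z' r)
  generalize ‖connCoeff ψ z r‖ = x at *
  generalize ‖connCoeff ψ' z' r‖ = y at *
  have p1 : 0 ≤ b * (1 + K ^ 2) * x := by positivity
  have p2 : 0 ≤ b * (1 + K ^ 2) * y := by positivity
  have p3 : 0 ≤ K * a * x := by positivity
  have p4 : 0 ≤ (1 + K) * a * x := by positivity
  rw [← sub_nonneg]
  refine (by positivity : 0 ≤ b * (1 + K ^ 2) * x / 2 + b * (1 + K ^ 2) * y +
    2 * (K * a * x) + 2 * ((1 + K) * a * x)).trans (le_of_eq ?_)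
  ring

section Difference

variable {ψ ψ' z z' : ℝ → ℂ}

theorem norm_connCoeff_sub_le {K r : ℝ} (hz' : ‖z' r‖ ≤ K) :
    ‖connCoeff ψ z r - connCoeff ψ' z' r‖ ≤
      1 * ‖ψ r - ψ' r‖ + 2 * (1 + K) * ‖(z r - z' r) / r‖ := by
  have e : connCoeff ψ z r - connCoeff ψ' z' r = (ψ r - ψ' r) +
      2 * ((z r * conf (z r) - z' r * conf (z' r)) / r) := by
    rw [connCoeff, connCoeff]; ring
  rw [e, one_mul]
  refine (norm_add_le _ _).trans (add_le_add le_rfl ?_)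
  rw [norm_mul, norm_div, norm_div, Complex.norm_ofNat]
  have := norm_mul_conf_sub_le (z := z r) hz'
  calc _ ≤ 2 * ((1 + K) * ‖z r - z' r‖ / ‖(r:ℂ)‖) := by gcongr
    _ = _ := by ring

theorem IsRiccati.re_integral_conn_nonpos (hz : IsRiccati ψ z) (hψ : MemLp ψ 2 radialMeasure)
    {K : ℝ} (hK : ∀ r, 0 < r → ‖z r‖ ≤ K) {r : ℝ} (hr : 0 < r) :
    (∫ s in Ioi r, connCoeff ψ z s * star (z s)).re ≤ 0 := by
  have h1 := norm_gaugeFactor hz hψ hK hr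
  rw [gaugeFactor, norm_mul, Complex.norm_ofNat, Complex.norm_exp] at h1
  refine Real.exp_le_one_iff.1 ?_
  linarith [conf_le_one (z r)]

theorem IsRiccati.norm_gaugeFactor_sub_le (hz : IsRiccati ψ z) (hz' : IsRiccati ψ' z')
    (hψ : MemLp ψ 2 radialMeasure) (hψ' : MemLp ψ' 2 radialMeasure) {K : ℝ}
    (hK : ∀ r, 0 < r → ‖z r‖ ≤ K) (hK' : ∀ r, 0 < r → ‖z' r‖ ≤ K)
    (hd : MemLp (fun r => connCoeff ψ z r - connCoeff ψ' z' r) 2 radialMeasure)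
    (hδ : MemLp (fun r => (z r - z' r) / r) 2 radialMeasure) {r : ℝ} (hr : 0 < r) :
    ‖gaugeFactor ψ z r - gaugeFactor ψ' z' r‖ ≤
      2 * (radNorm (fun r => connCoeff ψ z r - connCoeff ψ' z' r) * radNorm (fun r => z r / r) +
        radNorm (connCoeff ψ' z') * radNorm (fun r => (z r - z' r) / r)) := by
  have h1 := norm_cexp_sub_le (hz.re_integral_conn_nonpos hψ hK hr)
    (hz'.re_integral_conn_nonpos hψ' hK' hr)
  have iq := hz.integrable_conn hψ hK
  have iq' := hz'.integrable_conn hψ' hK'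
  have mz := (hz.memLp_div hψ hK).1
  have mq' := (hz'.memLp_connCoeff hψ' hK').1
  have hzm : AEStronglyMeasurable (fun r => star (z r)) (volume.restrict (Ioi 0)) :=
    (hz.hasACDeriv.continuousOn.aestronglyMeasurable measurableSet_Ioi).star
  have hzm' : AEStronglyMeasurable (fun r => star (z' r)) (volume.restrict (Ioi 0)) :=
    (hz'.hasACDeriv.continuousOn.aestronglyMeasurable measurableSet_Ioi).star
  obtain ⟨i1, b1⟩ := integral_mul_le_radNorm
    (h := fun r => (connCoeff ψ z r - connCoeff ψ' z' r) * star (z r)) hd mz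
    ((MemLp.aesm hd).mul hzm) (by
      filter_upwards [ae_restrict_mem measurableSet_Ioi] with r hr
      have hr : (0:ℝ) < r := hr
      rw [norm_mul, norm_star, norm_div, Complex.norm_real, Real.norm_of_nonneg hr.le]
      refine le_of_eq ?_
      field_simp)
  obtain ⟨i2, b2⟩ := integral_mul_le_radNorm
    (h := fun r => connCoeff ψ' z' r * (star (z r) - star (z' r))) mq' hδ
    ((MemLp.aesm mq').mul (hzm.sub hzm')) (by
      filter_upwards [ae_restrict_mem measurableSet_Ioi] with r hr
      have hr : (0:ℝ) < r := hr
      rw [← star_sub, norm_mul, norm_star, norm_div, Complex.norm_real,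
        Real.norm_of_nonneg hr.le]
      refine le_of_eq ?_
      field_simp)
  have h3 : IntegrableOn (fun s => ‖(connCoeff ψ z s - connCoeff ψ' z' s) * star (z s)‖ +
      ‖connCoeff ψ' z' s * (star (z s) - star (z' s))‖) (Ioi 0) := i1.norm.add i2.norm
  have h4 : ∀ s, ‖connCoeff ψ z s * star (z s) - connCoeff ψ' z' s * star (z' s)‖ ≤
      ‖(connCoeff ψ z s - connCoeff ψ' z' s) * star (z s)‖ +
      ‖connCoeff ψ' z' s * (star (z s) - star (z' s))‖ := fun s => by
    refine le_trans (le_of_eq ?_) (norm_add_le _ _)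
    congr 1; ring
  rw [gaugeFactor, gaugeFactor, ← mul_sub, norm_mul, Complex.norm_ofNat]
  refine mul_le_mul_of_nonneg_left (h1.trans ?_) zero_le_two
  rw [← integral_sub (iq.mono_set (Ioi_subset_Ioi hr.le)) (iq'.mono_set (Ioi_subset_Ioi hr.le))]
  refine (norm_integral_le_of_norm_le (h3.mono_set (Ioi_subset_Ioi hr.le))
    (Eventually.of_forall h4)).trans ?_
  refine (setIntegral_mono_set h3 (Eventually.of_forall fun s => by
    simp only [Pi.zero_apply]; positivity) (Ioi_subset_Ioi hr.le).eventuallyLE).trans ?_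
  have e := integral_add i1.norm i2.norm
  exact (le_of_eq e).trans (add_le_add b1 b2)

theorem IsRiccati.norm_gaugeFactor_le_two (hz : IsRiccati ψ z) (hψ : MemLp ψ 2 radialMeasure)
    {K : ℝ} (hK : ∀ r, 0 < r → ‖z r‖ ≤ K) {r : ℝ} (hr : 0 < r) : ‖gaugeFactor ψ z r‖ ≤ 2 := by
  rw [norm_gaugeFactor hz hψ hK hr]; linarith [conf_le_one (z r)]

theorem norm_genR_profile_sub_le {r b : ℝ} (hN : ‖gaugeFactor ψ z r‖ ≤ 2)
    (hb : ‖gaugeFactor ψ z r - gaugeFactor ψ' z' r‖ ≤ b) :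
    ‖r⁻¹ • genR (profile ψ z r - profile ψ' z' r)‖ ≤
      2 * ‖(z r - z' r) / r‖ + b * ‖z' r / r‖ := by
  rw [profile, profile, vec_sub, genR_apply, horiz_vec, norm_smul, norm_inv]
  refine (mul_le_mul_of_nonneg_left (norm_vec_le _ _) (by positivity)).trans ?_
  rw [abs_zero, add_zero, norm_mul, Complex.norm_I, one_mul, norm_div, norm_div,
    Complex.norm_real]
  have e : star (z r) * gaugeFactor ψ z r - star (z' r) * gaugeFactor ψ' z' r =
      star (z r - z' r) * gaugeFactor ψ z r +
      star (z' r) * (gaugeFactor ψ z r - gaugeFactor ψ' z' r) := by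
    rw [star_sub]; ring
  have n : ‖star (z r) * gaugeFactor ψ z r - star (z' r) * gaugeFactor ψ' z' r‖ ≤
      ‖z r - z' r‖ * 2 + ‖z' r‖ * b := by
    rw [e]
    refine (norm_add_le _ _).trans ?_
    rw [norm_mul, norm_mul, norm_star, norm_star]
    gcongr
  calc _ ≤ ‖r‖⁻¹ * (‖z r - z' r‖ * 2 + ‖z' r‖ * b) := by gcongr
    _ = _ := by ring

end Difference

/-- The profiles reconstructed from `ψ` and `ψ'`, together with their radial derivatives, differ by
at most a multiple of `ψ - ψ'`, with a constant depending on a bound `M < 2√2` for the norms. -/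
theorem exists_profile_lipschitz {M : ℝ} (hM : M < 2 * √2) : ∃ C : ℝ, 0 ≤ C ∧
    ∀ ψ ψ' z z' : ℝ → ℂ, MemLp ψ 2 radialMeasure → MemLp ψ' 2 radialMeasure →
      radNorm ψ ≤ M → radNorm ψ' ≤ M → IsRiccati ψ z → IsRiccati ψ' z' →
      radNorm (fun r => profileDeriv ψ z r - profileDeriv ψ' z' r) ≤
        C * radNorm (fun r => ψ r - ψ' r) ∧
      radNorm (fun r => r⁻¹ • genR (profile ψ z r - profile ψ' z' r)) ≤
        C * radNorm (fun r => ψ r - ψ' r) := by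
  rcases lt_or_ge M 0 with hM0 | hM0
  · refine ⟨0, le_rfl, fun ψ ψ' z z' hψ hψ' h1 => ?_⟩
    exact absurd (radNorm_nonneg ψ) (not_le.2 (lt_of_le_of_lt h1 hM0))
  obtain ⟨K, hK⟩ : ∃ K, K = slopeBound M := ⟨_, rfl⟩
  obtain ⟨A, hA⟩ : ∃ A, A = riccatiConst K M := ⟨_, rfl⟩
  -- `B` bounds `z / r`, `Q` the connection coefficient, `D * ε` and `F * ε` the differences of the
  -- connection coefficients and of the gauge factors
  obtain ⟨B, hB⟩ : ∃ B, B = A * M := ⟨_, rfl⟩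
  obtain ⟨Q, hQ⟩ : ∃ Q, Q = 1 * M + 2 * B := ⟨_, rfl⟩
  obtain ⟨D, hD⟩ : ∃ D, D = 1 + 2 * (1 + K) * A := ⟨_, rfl⟩
  obtain ⟨F, hF⟩ : ∃ F, F = 2 * (D * B + Q * A) := ⟨_, rfl⟩
  obtain ⟨C₁, hC₁⟩ : ∃ C₁, C₁ = (1 + K ^ 2) + 2 * K := ⟨_, rfl⟩
  obtain ⟨C₂, hC₂⟩ : ∃ C₂, C₂ = F * (1 + K ^ 2) + 2 * K * A + 2 * (1 + K) * A := ⟨_, rfl⟩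
  have hK0 : 0 ≤ K := hK ▸ slopeBound_nonneg M
  have hA0 : 0 ≤ A := hA ▸ riccatiConst_nonneg K M
  have hB0 : 0 ≤ B := by rw [hB]; positivity
  have hQ0 : 0 ≤ Q := by rw [hQ]; positivity
  have hD0 : 0 ≤ D := by rw [hD]; positivity
  have hF0 : 0 ≤ F := by rw [hF]; positivity
  have hC₁0 : 0 ≤ C₁ := by rw [hC₁]; positivity
  have hC₂0 : 0 ≤ C₂ := by rw [hC₂]; positivity
  refine ⟨(C₁ * D + C₂ * (1 * Q + 1 * Q)) + (2 * A + F * B), by positivity, ?_⟩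
  intro ψ ψ' z z' hψ hψ' hm hm' hz hz'
  have hzK : ∀ r, 0 < r → ‖z r‖ ≤ K := hK ▸ hz.norm_le_slopeBound hψ hm hM
  have hzK' : ∀ r, 0 < r → ‖z' r‖ ≤ K := hK ▸ hz'.norm_le_slopeBound hψ' hm' hM
  have hmono : ∀ m, 0 ≤ m → m ≤ M → riccatiConst K m ≤ A := fun m h0 h => by
    rw [hA, riccatiConst, riccatiConst]; gcongr
  have hAm := hmono _ (radNorm_nonneg ψ) hm
  have hAm' := hmono _ (radNorm_nonneg ψ') hm'
  obtain ⟨s1, s2, s3⟩ := hz.stability hz' hψ hψ' hzK hzK'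
  obtain ⟨ε, hε⟩ : ∃ ε, ε = radNorm (fun r => ψ r - ψ' r) := ⟨_, rfl⟩
  rw [← hε] at s1 s3
  rw [← hε]
  have hε0 : 0 ≤ ε := hε ▸ radNorm_nonneg _
  have hδ : ∀ r, 0 < r → ‖z r - z' r‖ ≤ A * ε := fun r hr =>
    (s1 r hr).trans (mul_le_mul_of_nonneg_right hAm hε0)
  have hδr : radNorm (fun r => (z r - z' r) / r) ≤ A * ε :=
    s3.trans (mul_le_mul_of_nonneg_right hAm hε0)
  obtain ⟨mz, nz⟩ := hz.memLp_div hψ hzK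
  obtain ⟨mz', nz'⟩ := hz'.memLp_div hψ' hzK'
  have hzB : radNorm (fun r => z r / r) ≤ B :=
    hB ▸ nz.trans (mul_le_mul hAm hm (radNorm_nonneg _) hA0)
  have hzB' : radNorm (fun r => z' r / r) ≤ B :=
    hB ▸ nz'.trans (mul_le_mul hAm' hm' (radNorm_nonneg _) hA0)
  obtain ⟨mq, nq⟩ := hz.memLp_connCoeff hψ hzK
  obtain ⟨mq', nq'⟩ := hz'.memLp_connCoeff hψ' hzK'
  have hqQ : radNorm (connCoeff ψ z) ≤ Q := nq.trans (by rw [hQ]; gcongr)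
  have hqQ' : radNorm (connCoeff ψ' z') ≤ Q := nq'.trans (by rw [hQ]; gcongr)
  obtain ⟨mdq, ndq⟩ := radNorm_le_add (f := fun r => connCoeff ψ z r - connCoeff ψ' z' r)
    (g := fun r => ψ r - ψ' r) (MemLp.aesm (mq.sub mq')) (hψ.sub hψ') s2
    zero_le_one (by positivity : 0 ≤ 2 * (1 + K)) (by
      filter_upwards [ae_restrict_mem measurableSet_Ioi] with r hr
      exact norm_connCoeff_sub_le (hzK' r hr))
  have hdq : radNorm (fun r => connCoeff ψ z r - connCoeff ψ' z' r) ≤ D * ε := by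
    refine ndq.trans ?_
    calc _ ≤ 1 * ε + 2 * (1 + K) * (A * ε) :=
          add_le_add (by rw [hε]) (by gcongr)
      _ = D * ε := by rw [hD]; ring
  have hN : ∀ r, 0 < r → ‖gaugeFactor ψ z r - gaugeFactor ψ' z' r‖ ≤ F * ε := by
    intro r hr
    refine (hz.norm_gaugeFactor_sub_le hz' hψ hψ' hzK hzK' mdq s2 hr).trans ?_
    have t1 := mul_le_mul hdq hzB (radNorm_nonneg _) (mul_nonneg hD0 hε0)
    have t2 := mul_le_mul hqQ' hδr (radNorm_nonneg _) hQ0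
    calc _ ≤ 2 * (D * ε * B + Q * (A * ε)) := by gcongr
      _ = F * ε := by rw [hF]; ring
  constructor
  · obtain ⟨mS, nS⟩ := radNorm_le_add (f := fun r => ‖connCoeff ψ z r‖ + ‖connCoeff ψ' z' r‖)
      (C := 1) (D := 1) ((MemLp.aesm mq).norm.add (MemLp.aesm mq').norm) mq mq' zero_le_one
      zero_le_one (Eventually.of_forall fun r => by
        rw [Real.norm_of_nonneg (by positivity), one_mul, one_mul])
    have hS : radNorm (fun r => ‖connCoeff ψ z r‖ + ‖connCoeff ψ' z' r‖) ≤ 1 * Q + 1 * Q :=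
      nS.trans (by gcongr)
    obtain ⟨-, h⟩ := radNorm_le_add (f := fun r => profileDeriv ψ z r - profileDeriv ψ' z' r)
      (C := C₁) (D := C₂ * ε)
      (MemLp.aesm ((memLp_profileDeriv hz hψ hzK).sub (memLp_profileDeriv hz' hψ' hzK')))
      mdq mS hC₁0 (by positivity) (by
        filter_upwards [ae_restrict_mem measurableSet_Ioi] with r hr
        refine (norm_profileDeriv_sub_le (hzK r hr) (hzK' r hr) (hδ r hr) (hN r hr)
          (hz'.norm_gaugeFactor_le_two hψ' hzK' hr)).trans (le_of_eq ?_)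
        rw [Real.norm_of_nonneg (by positivity), hC₁, hC₂]
        ring)
    refine h.trans ?_
    have t1 := mul_le_mul_of_nonneg_left hdq hC₁0
    have t2 := mul_le_mul_of_nonneg_left hS (mul_nonneg hC₂0 hε0)
    have t3 : 0 ≤ (2 * A + F * B) * ε := by positivity
    linarith
  · obtain ⟨-, h⟩ := radNorm_le_add
      (f := fun r => r⁻¹ • genR (profile ψ z r - profile ψ' z' r)) (C := 2) (D := F * ε)
      ((hz.hasACDeriv_profile hψ hzK).sub (hz'.hasACDeriv_profile hψ' hzK')).aesm_genR_div
      s2 mz' zero_le_two (by positivity) (by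
        filter_upwards [ae_restrict_mem measurableSet_Ioi] with r hr
        exact norm_genR_profile_sub_le (hz.norm_gaugeFactor_le_two hψ hzK hr) (hN r hr))
    refine h.trans ?_
    have t1 := mul_le_mul_of_nonneg_left hzB' (mul_nonneg hF0 hε0)
    have t2 : 0 ≤ (C₁ * D + C₂ * (1 * Q + 1 * Q)) * ε := by positivity
    linarith

/-! ### Polar coordinates in the plane -/

/-- The point of the plane with polar coordinates `p = (r, θ)`. -/
def polarPoint (p : ℝ × ℝ) : Plane := !₂[p.1 * Real.cos p.2, p.1 * Real.sin p.2]

/-- Lebesgue measure on the range `r > 0`, `-π < θ < π` of the polar coordinates. -/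
def polarMeasure : Measure (ℝ × ℝ) :=
  (volume.restrict (Ioi 0)).prod (volume.restrict (Ioo (-Real.pi) Real.pi))

theorem restrict_polarCoord_target : volume.restrict polarCoord.target = polarMeasure := by
  rw [polarMeasure, Measure.prod_restrict]; rfl

theorem ae_polarMeasure_pos : ∀ᵐ p ∂polarMeasure, 0 < p.1 := by
  rw [← restrict_polarCoord_target]
  filter_upwards [ae_restrict_mem polarCoord.open_target.measurableSet] with p hp using hp.1

/-- The plane as the product of its two coordinate axes. -/
def planeEquiv : ℝ × ℝ ≃ᵐ Plane :=
  (MeasurableEquiv.finTwoArrow (α := ℝ)).symm.trans (MeasurableEquiv.toLp 2 (Fin 2 → ℝ))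

theorem measurePreserving_planeEquiv : MeasurePreserving planeEquiv :=
  (PiLp.volume_preserving_toLp (Fin 2)).comp (volume_preserving_finTwoArrow ℝ).symm

theorem lintegral_polar (F : Plane → ℝ≥0∞) :
    ∫⁻ x, F x = ∫⁻ p, ENNReal.ofReal p.1 * F (polarPoint p) ∂polarMeasure := by
  rw [← measurePreserving_planeEquiv.lintegral_comp_emb planeEquiv.measurableEmbedding,
    ← lintegral_comp_polarCoord_symm, restrict_polarCoord_target]
  rfl

theorem integral_polar {E : Type*} [NormedAddCommGroup E] [NormedSpace ℝ E] (F : Plane → E) :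
    ∫ x, F x = ∫ p, p.1 • F (polarPoint p) ∂polarMeasure := by
  rw [← measurePreserving_planeEquiv.integral_comp planeEquiv.measurableEmbedding,
    ← integral_comp_polarCoord_symm, restrict_polarCoord_target]
  rfl

theorem continuous_polarPoint : Continuous polarPoint := by
  unfold polarPoint
  refine (PiLp.continuous_toLp 2 _).comp (continuous_pi fun i => ?_)
  fin_cases i
  · exact continuous_fst.mul (Real.continuous_cos.comp continuous_snd)
  · exact continuous_fst.mul (Real.continuous_sin.comp continuous_snd)

theorem integrable_polar {F : Plane → Space} (hF : Integrable F) (hm : Measurable F) :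
    Integrable (fun p : ℝ × ℝ => p.1 • F (polarPoint p)) polarMeasure := by
  refine ⟨(measurable_fst.smul
    (hm.comp continuous_polarPoint.measurable)).aestronglyMeasurable, ?_⟩
  have h := hF.2
  rw [HasFiniteIntegral, lintegral_polar] at h
  rw [HasFiniteIntegral]
  refine lt_of_eq_of_lt (lintegral_congr_ae ?_) h
  filter_upwards [ae_polarMeasure_pos] with p hp
  rw [enorm_smul, Real.enorm_eq_ofReal hp.le]

theorem norm_sq_plane (x : Plane) : ‖x‖ ^ 2 = x 0 ^ 2 + x 1 ^ 2 := by
  rw [EuclideanSpace.real_norm_sq_eq, Fin.sum_univ_two]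

theorem norm_polarPoint {p : ℝ × ℝ} (hp : 0 < p.1) : ‖polarPoint p‖ = p.1 := by
  refine (pow_left_inj₀ (norm_nonneg _) hp.le two_ne_zero).1 ?_
  rw [norm_sq_plane]
  simp only [polarPoint, PiLp.toLp_apply, Matrix.cons_val_zero, Matrix.cons_val_one]
  linear_combination p.1 ^ 2 * Real.sin_sq_add_cos_sq p.2

theorem exists_polarPoint {x : Plane} (hx : x ≠ 0) : ∃ p : ℝ × ℝ, 0 < p.1 ∧ x = polarPoint p := by
  have h0 : (⟨x 0, x 1⟩ : ℂ) ≠ 0 := by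
    intro h
    apply hx
    ext i
    fin_cases i
    · exact congrArg Complex.re h
    · exact congrArg Complex.im h
  refine ⟨(‖(⟨x 0, x 1⟩ : ℂ)‖, Complex.arg ⟨x 0, x 1⟩), norm_pos_iff.2 h0, ?_⟩
  ext i
  fin_cases i
  · exact (Complex.norm_mul_cos_arg ⟨x 0, x 1⟩).symm
  · exact (Complex.norm_mul_sin_arg ⟨x 0, x 1⟩).symm

theorem lintegral_norm_plane {H : ℝ → ℝ≥0∞} (hH : Measurable H) :
    ∫⁻ x : Plane, H ‖x‖ = ENNReal.ofReal (2 * Real.pi) * ∫⁻ r, H r ∂radialMeasure := by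
  have e : ∫⁻ p, ENNReal.ofReal p.1 * H ‖polarPoint p‖ ∂polarMeasure =
      ∫⁻ p, ENNReal.ofReal p.1 * H p.1 ∂polarMeasure := by
    refine lintegral_congr_ae ?_
    filter_upwards [ae_polarMeasure_pos] with p hp
    rw [norm_polarPoint hp]
  have hm : Measurable fun p : ℝ × ℝ => ENNReal.ofReal p.1 * H p.1 :=
    (ENNReal.measurable_ofReal.comp measurable_fst).mul (hH.comp measurable_fst)
  rw [lintegral_polar fun x => H ‖x‖, e, polarMeasure, lintegral_prod _ hm.aemeasurable,
    lintegral_radial]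
  simp only [lintegral_const, Measure.restrict_apply_univ, Real.volume_Ioo]
  rw [lintegral_mul_const _ (by fun_prop), mul_comm]
  congr 2; ring

/-! ### Rotations -/

/-- The generator `R` as a continuous linear map. -/
def genRL : Space →L[ℝ] Space := LinearMap.toContinuousLinearMap
  { toFun := genR
    map_add' := fun x y => by
      simp only [genR_apply, vec_add, add_zero]
      congr 1; apply Complex.ext
      · simp [horiz]; ring
      · simp [horiz]
    map_smul' := fun t x => by
      simp only [genR_apply, smul_vec, mul_zero, RingHom.id_apply]
      congr 1; apply Complex.ext <;> simp [horiz] }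

theorem genRL_apply (y : Space) : genRL y = genR y := rfl

theorem genR_zero_coord (y : Space) : genR y 0 = -y 1 := by simp [genR_apply, horiz]
theorem genR_one_coord (y : Space) : genR y 1 = y 0 := by simp [genR_apply, horiz]
theorem genR_two_coord (y : Space) : genR y 2 = 0 := by simp [genR_apply]

/-- Rodrigues' formula `1 + s R + (1 - c) R²` for the rotation about the vertical axis by the angle
with cosine `c` and sine `s`. -/
def rotL (c s : ℝ) (y : Space) : Space := y + s • genRL y + (1 - c) • genRL (genRL y)

theorem rotL_zero (c s : ℝ) (y : Space) : rotL c s y 0 = c * y 0 - s * y 1 := by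
  simp [rotL, genRL_apply, genR_zero_coord, genR_one_coord]; ring
theorem rotL_one (c s : ℝ) (y : Space) : rotL c s y 1 = s * y 0 + c * y 1 := by
  simp [rotL, genRL_apply, genR_zero_coord, genR_one_coord]; ring
theorem rotL_two (c s : ℝ) (y : Space) : rotL c s y 2 = y 2 := by
  simp [rotL, genRL_apply, genR_two_coord]

theorem rotL_cos_sin (θ : ℝ) (y : Space) : rotL (Real.cos θ) (Real.sin θ) y = rotR θ y :=
  space_ext (by rw [rotL_zero]; rfl) (by rw [rotL_one]; rfl) (by rw [rotL_two]; rfl)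

theorem norm_rotL {c s : ℝ} (h : c ^ 2 + s ^ 2 = 1) (y : Space) : ‖rotL c s y‖ = ‖y‖ := by
  refine (pow_left_inj₀ (norm_nonneg _) (norm_nonneg _) two_ne_zero).1 ?_
  rw [norm_sq_space, norm_sq_space, rotL_zero, rotL_one, rotL_two]
  linear_combination (y 0 ^ 2 + y 1 ^ 2) * h

theorem norm_rotR (θ : ℝ) (y : Space) : ‖rotR θ y‖ = ‖y‖ := by
  rw [← rotL_cos_sin, norm_rotL (by rw [add_comm]; exact Real.sin_sq_add_cos_sq θ)]

theorem hasDerivAt_rotR (θ : ℝ) (y : Space) :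
    HasDerivAt (fun t => rotR t y) (rotR θ (genR y)) θ := by
  have h : HasDerivAt (fun t => rotL (Real.cos t) (Real.sin t) y)
      (Real.cos θ • genRL y + (- -Real.sin θ) • genRL (genRL y)) θ :=
    (((Real.hasDerivAt_sin θ).smul_const (genRL y)).const_add y).add
      (((Real.hasDerivAt_cos θ).const_sub 1).smul_const (genRL (genRL y)))
  simp only [rotL_cos_sin] at h
  convert h using 1
  rw [← rotL_cos_sin]
  refine space_ext ?_ ?_ ?_
  · rw [rotL_zero]
    simp [genRL_apply, genR_zero_coord, genR_one_coord]
    ring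
  · rw [rotL_one]
    simp [genRL_apply, genR_zero_coord, genR_one_coord]
    ring
  · rw [rotL_two]
    simp [genRL_apply, genR_two_coord]

theorem HasACDeriv.rotR {f g : ℝ → Space} (h : HasACDeriv f g) (θ : ℝ) :
    HasACDeriv (fun r => rotR θ (f r)) (fun r => EquivariantMap.rotR θ (g r)) := by
  simp only [← rotL_cos_sin]
  have h1 := h.clm genRL
  have h2 := h1.clm genRL
  refine ((h.add ((HasACDeriv.const (Real.sin θ)).smul h1)).add
    ((HasACDeriv.const (1 - Real.cos θ)).smul h2)).congr_deriv fun r _ => ?_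
  simp [rotL]

theorem _root_.Measurable.rotL {α : Type*} [MeasurableSpace α] {c s : α → ℝ} {y : α → Space}
    (hc : Measurable c) (hs : Measurable s) (hy : Measurable y) :
    Measurable fun a => rotL (c a) (s a) (y a) := by
  have h1 : Measurable fun a => genRL (y a) := genRL.measurable.comp hy
  have h2 : Measurable fun a => genRL (genRL (y a)) := genRL.measurable.comp h1
  exact (hy.add (hs.smul h1)).add ((measurable_const.sub hc).smul h2)

/-! ### The weak gradient of an equivariant map -/

theorem HasACDeriv.integral_Ioi_eq_zero {F : Type*} [NormedAddCommGroup F] [NormedSpace ℝ F]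
    [FiniteDimensional ℝ F] {f g : ℝ → F} (h : HasACDeriv f g)
    (hi : IntegrableOn g (Ioi 0)) (h0 : Tendsto f (𝓝[>] 0) (𝓝 0)) (h1 : Tendsto f atTop (𝓝 0)) :
    ∫ r in Ioi 0, g r = 0 := by
  have hsum := h.add (HasACDeriv.tail fun a ha => hi.mono_set (Ioi_subset_Ioi (le_of_lt ha)))
  have hlim := h1.add (tendsto_tail_zero hi)
  rw [add_zero] at hlim
  have heq : ∀ a, 0 < a → f a = -∫ r in Ioi a, g r := fun a ha =>
    eq_neg_of_add_eq_zero_left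
      ((hsum.congr_deriv (g' := fun _ => 0) fun r _ => add_neg_cancel _).eq_lim_of_zero hlim ha)
  have ht : Tendsto f (𝓝[>] 0) (𝓝 (-∫ r in Ioi 0, g r)) := by
    refine (tendsto_setIntegral_Ioi_zero hi).neg.congr' ?_
    filter_upwards [self_mem_nhdsWithin] with a ha using (heq a ha).symm
  exact neg_eq_zero.1 (tendsto_nhds_unique ht h0)

/-- The `j`-th coordinate of the radial unit vector `(c, s)`. -/
def radialCoord (j : Fin 2) (c s : ℝ) : ℝ := ![c, s] j

/-- The `j`-th coordinate of the angular unit vector `(-s, c)`. -/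
def angularCoord (j : Fin 2) (c s : ℝ) : ℝ := ![-s, c] j

/-- The equivariant map with profile `d`. -/
def equivMap (d : ℝ → Space) (x : Plane) : Space := rotL (x 0 / ‖x‖) (x 1 / ‖x‖) (d ‖x‖)

/-- The partial derivatives of the equivariant map whose profile `d` has derivative `g`: in polar
coordinates, the radial derivative is the rotation of `g r` and the angular one that of
`r⁻¹ R d(r)`. -/
def equivGrad (d g : ℝ → Space) (j : Fin 2) (x : Plane) : Space :=
  radialCoord j (x 0 / ‖x‖) (x 1 / ‖x‖) • rotL (x 0 / ‖x‖) (x 1 / ‖x‖) (g ‖x‖) +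
  angularCoord j (x 0 / ‖x‖) (x 1 / ‖x‖) • rotL (x 0 / ‖x‖) (x 1 / ‖x‖) (‖x‖⁻¹ • genR (d ‖x‖))

theorem polarPoint_div_norm {r : ℝ} (hr : 0 < r) (θ : ℝ) :
    polarPoint (r, θ) 0 / ‖polarPoint (r, θ)‖ = Real.cos θ ∧
    polarPoint (r, θ) 1 / ‖polarPoint (r, θ)‖ = Real.sin θ := by
  rw [norm_polarPoint hr]
  exact ⟨mul_div_cancel_left₀ _ hr.ne', mul_div_cancel_left₀ _ hr.ne'⟩

theorem equivMap_polarPoint (d : ℝ → Space) {r : ℝ} (hr : 0 < r) (θ : ℝ) :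
    equivMap d (polarPoint (r, θ)) = rotR θ (d r) := by
  obtain ⟨h0, h1⟩ := polarPoint_div_norm hr θ
  rw [equivMap, h0, h1, norm_polarPoint hr, rotL_cos_sin]

theorem equivGrad_polarPoint (d g : ℝ → Space) (j : Fin 2) {r : ℝ} (hr : 0 < r) (θ : ℝ) :
    equivGrad d g j (polarPoint (r, θ)) =
      radialCoord j (Real.cos θ) (Real.sin θ) • rotR θ (g r) +
      angularCoord j (Real.cos θ) (Real.sin θ) • rotR θ (r⁻¹ • genR (d r)) := by
  obtain ⟨h0, h1⟩ := polarPoint_div_norm hr θ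
  rw [equivGrad, h0, h1, norm_polarPoint hr, rotL_cos_sin, rotL_cos_sin]

theorem hasDerivAt_radialCoord (j : Fin 2) (θ : ℝ) :
    HasDerivAt (fun t => radialCoord j (Real.cos t) (Real.sin t))
      (angularCoord j (Real.cos θ) (Real.sin θ)) θ := by
  fin_cases j
  · exact Real.hasDerivAt_cos θ
  · exact Real.hasDerivAt_sin θ

theorem hasDerivAt_angularCoord (j : Fin 2) (θ : ℝ) :
    HasDerivAt (fun t => angularCoord j (Real.cos t) (Real.sin t))
      (-radialCoord j (Real.cos θ) (Real.sin θ)) θ := by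
  fin_cases j
  · exact (Real.hasDerivAt_sin θ).neg
  · exact Real.hasDerivAt_cos θ

theorem abs_radialCoord_le (j : Fin 2) (θ : ℝ) :
    |radialCoord j (Real.cos θ) (Real.sin θ)| ≤ 1 := by
  fin_cases j
  · exact Real.abs_cos_le_one θ
  · exact Real.abs_sin_le_one θ

theorem abs_angularCoord_le (j : Fin 2) (θ : ℝ) :
    |angularCoord j (Real.cos θ) (Real.sin θ)| ≤ 1 := by
  fin_cases j
  · exact (abs_neg _).trans_le (Real.abs_sin_le_one θ)
  · exact Real.abs_cos_le_one θ

theorem rotR_smul (θ t : ℝ) (y : Space) : rotR θ (t • y) = t • rotR θ y := by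
  simp only [← rotL_cos_sin, rotL, map_smul]
  module

theorem polarPoint_eq (r θ : ℝ) : polarPoint (r, θ) =
    (r * Real.cos θ) • EuclideanSpace.single 0 1 + (r * Real.sin θ) • EuclideanSpace.single 1 1 := by
  ext i; fin_cases i <;> simp [polarPoint]

/-- The radial derivative of `φ` at the point with polar coordinates `p`. -/
def radialDeriv (φ : Plane → ℝ) (p : ℝ × ℝ) : ℝ :=
  Real.cos p.2 * fderiv ℝ φ (polarPoint p) (EuclideanSpace.single 0 1) +
  Real.sin p.2 * fderiv ℝ φ (polarPoint p) (EuclideanSpace.single 1 1)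

/-- The derivative of `φ` in the angular variable at the point with polar coordinates `p`. -/
def angularDeriv (φ : Plane → ℝ) (p : ℝ × ℝ) : ℝ :=
  p.1 * (-Real.sin p.2 * fderiv ℝ φ (polarPoint p) (EuclideanSpace.single 0 1) +
  Real.cos p.2 * fderiv ℝ φ (polarPoint p) (EuclideanSpace.single 1 1))

theorem hasDerivAt_radial {φ : Plane → ℝ} (hφ : ContDiff ℝ 1 φ) (r θ : ℝ) :
    HasDerivAt (fun s => φ (polarPoint (s, θ))) (radialDeriv φ (r, θ)) r := by
  have h : HasDerivAt (fun s => polarPoint (s, θ))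
      ((1 * Real.cos θ) • EuclideanSpace.single 0 1 +
        (1 * Real.sin θ) • EuclideanSpace.single 1 1) r := by
    simp only [polarPoint_eq]
    exact (((hasDerivAt_id r).mul_const _).smul_const _).add
      (((hasDerivAt_id r).mul_const _).smul_const _)
  have h2 := ((hφ.differentiable (by decide)) (polarPoint (r, θ))).hasFDerivAt.comp_hasDerivAt r h
  refine h2.congr_deriv ?_
  simp [radialDeriv]

theorem hasDerivAt_angular {φ : Plane → ℝ} (hφ : ContDiff ℝ 1 φ) (r θ : ℝ) :
    HasDerivAt (fun t => φ (polarPoint (r, t))) (angularDeriv φ (r, θ)) θ := by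
  have h : HasDerivAt (fun t => polarPoint (r, t))
      ((r * -Real.sin θ) • EuclideanSpace.single 0 1 +
        (r * Real.cos θ) • EuclideanSpace.single 1 1) θ := by
    simp only [polarPoint_eq]
    exact (((Real.hasDerivAt_cos θ).const_mul r).smul_const _).add
      (((Real.hasDerivAt_sin θ).const_mul r).smul_const _)
  have h2 := ((hφ.differentiable (by decide)) (polarPoint (r, θ))).hasFDerivAt.comp_hasDerivAt θ h
  refine h2.congr_deriv ?_
  simp [angularDeriv]
  ring

theorem fderiv_single_eq (φ : Plane → ℝ) (j : Fin 2) (r θ : ℝ) :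
    r * fderiv ℝ φ (polarPoint (r, θ)) (EuclideanSpace.single j 1) =
      radialCoord j (Real.cos θ) (Real.sin θ) * (r * radialDeriv φ (r, θ)) +
      angularCoord j (Real.cos θ) (Real.sin θ) * angularDeriv φ (r, θ) := by
  have h := Real.sin_sq_add_cos_sq θ
  simp only [radialDeriv, angularDeriv]
  fin_cases j
  · simp only [radialCoord, angularCoord, Fin.zero_eta, Matrix.cons_val_zero]
    linear_combination (-r * fderiv ℝ φ (polarPoint (r, θ)) (EuclideanSpace.single 0 1)) * h
  · simp only [radialCoord, angularCoord, Fin.mk_one, Matrix.cons_val_one,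
      Matrix.cons_val_fin_one]
    linear_combination (-r * fderiv ℝ φ (polarPoint (r, θ)) (EuclideanSpace.single 1 1)) * h

theorem continuous_fderiv_polarPoint {φ : Plane → ℝ} (hφ : ContDiff ℝ 1 φ) (e : Plane) :
    Continuous fun p => fderiv ℝ φ (polarPoint p) e :=
  ((hφ.continuous_fderiv (by decide)).clm_apply continuous_const).comp continuous_polarPoint

theorem continuous_radialDeriv {φ : Plane → ℝ} (hφ : ContDiff ℝ 1 φ) :
    Continuous (radialDeriv φ) := by
  have h0 := continuous_fderiv_polarPoint hφ (EuclideanSpace.single 0 1)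
  have h1 := continuous_fderiv_polarPoint hφ (EuclideanSpace.single 1 1)
  unfold radialDeriv
  fun_prop

theorem continuous_angularDeriv {φ : Plane → ℝ} (hφ : ContDiff ℝ 1 φ) :
    Continuous (angularDeriv φ) := by
  have h0 := continuous_fderiv_polarPoint hφ (EuclideanSpace.single 0 1)
  have h1 := continuous_fderiv_polarPoint hφ (EuclideanSpace.single 1 1)
  unfold angularDeriv
  fun_prop

/-- A test function and its polar derivatives are bounded and vanish for large radii. -/
theorem exists_test_bound {φ : Plane → ℝ} (hφ : ContDiff ℝ 1 φ) (hc : HasCompactSupport φ) :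
    ∃ R C : ℝ, 0 < R ∧ 0 ≤ C ∧ (∀ x, |φ x| ≤ C) ∧
      (∀ r θ, 0 < r → |angularDeriv φ (r, θ)| ≤ C) ∧
      ∀ r θ, R < r → φ (polarPoint (r, θ)) = 0 ∧ angularDeriv φ (r, θ) = 0 := by
  obtain ⟨R₀, hR₀⟩ := hc.isCompact.isBounded.subset_closedBall 0
  obtain ⟨C₀, hC₀⟩ := hc.exists_bound_of_continuous hφ.continuous
  obtain ⟨C₁, hC₁⟩ := (hc.fderiv (𝕜 := ℝ)).exists_bound_of_continuous
    (hφ.continuous_fderiv (by decide))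
  have hC0 : 0 ≤ C₀ := (norm_nonneg _).trans (hC₀ 0)
  have hC1 : 0 ≤ C₁ := (norm_nonneg _).trans (hC₁ 0)
  have hR : 0 < max R₀ 1 := lt_max_of_lt_right one_pos
  have hz : ∀ r θ, max R₀ 1 < r →
      φ (polarPoint (r, θ)) = 0 ∧ angularDeriv φ (r, θ) = 0 := by
    intro r θ hr
    have hr0 : 0 < r := hR.trans hr
    have hx : polarPoint (r, θ) ∉ tsupport φ := fun h => by
      have := hR₀ h
      rw [mem_closedBall_zero_iff, norm_polarPoint hr0] at this
      exact absurd ((le_max_left R₀ 1).trans_lt hr) (not_lt.2 this)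
    refine ⟨image_eq_zero_of_notMem_tsupport hx, ?_⟩
    rw [angularDeriv, fderiv_of_notMem_tsupport ℝ hx]
    simp
  refine ⟨max R₀ 1, C₀ + max R₀ 1 * (C₁ + C₁), hR, by positivity, fun x => ?_, fun r θ hr => ?_, hz⟩
  · have : 0 ≤ max R₀ 1 * (C₁ + C₁) := by positivity
    exact (hC₀ x).trans (by linarith)
  · rcases lt_or_ge (max R₀ 1) r with h | h
    · rw [(hz r θ h).2, abs_zero]; positivity
    · have hD : ∀ j : Fin 2, |fderiv ℝ φ (polarPoint (r, θ)) (EuclideanSpace.single j 1)| ≤ C₁ :=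
        fun j => by
        rw [← Real.norm_eq_abs]
        refine (ContinuousLinearMap.le_opNorm _ _).trans ?_
        rw [PiLp.norm_single, norm_one, mul_one]
        exact hC₁ _
      rw [angularDeriv, abs_mul, abs_of_pos hr]
      have h2 := abs_add_le (-Real.sin θ * fderiv ℝ φ (polarPoint (r, θ))
        (EuclideanSpace.single 0 1)) (Real.cos θ * fderiv ℝ φ (polarPoint (r, θ))
        (EuclideanSpace.single 1 1))
      rw [abs_mul, abs_mul, abs_neg] at h2
      have h3 := mul_le_mul (Real.abs_sin_le_one θ) (hD 0) (abs_nonneg _) zero_le_one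
      have h4 := mul_le_mul (Real.abs_cos_le_one θ) (hD 1) (abs_nonneg _) zero_le_one
      have h5 := mul_le_mul h (h2.trans (add_le_add h3 h4)) (abs_nonneg _) hR.le
      rw [one_mul] at h5
      exact h5.trans (by linarith)

section WeakGradient

variable {d g : ℝ → Space} {B : ℝ} {φ : Plane → ℝ}

/-- The angular derivative of `β(θ) φ(r, θ) e^{θR} d(r)`, where `β` is a coordinate of the angular
unit vector. -/
def angularFlux (d : ℝ → Space) (φ : Plane → ℝ) (j : Fin 2) (p : ℝ × ℝ) : Space :=
  (angularCoord j (Real.cos p.2) (Real.sin p.2) * φ (polarPoint p)) • rotR p.2 (genR (d p.1)) +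
  (-radialCoord j (Real.cos p.2) (Real.sin p.2) * φ (polarPoint p) +
    angularCoord j (Real.cos p.2) (Real.sin p.2) * angularDeriv φ p) • rotR p.2 (d p.1)

/-- The radial derivative of `α(θ) r φ(r, θ) e^{θR} d(r)`, where `α` is a coordinate of the radial
unit vector. -/
def radialFlux (d g : ℝ → Space) (φ : Plane → ℝ) (j : Fin 2) (p : ℝ × ℝ) : Space :=
  (radialCoord j (Real.cos p.2) (Real.sin p.2) * (p.1 * φ (polarPoint p))) • rotR p.2 (g p.1) +
  (radialCoord j (Real.cos p.2) (Real.sin p.2) *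
    (φ (polarPoint p) + p.1 * radialDeriv φ p)) • rotR p.2 (d p.1)

theorem measurable_radialCoord (j : Fin 2) {α : Type*} [MeasurableSpace α] {c s : α → ℝ}
    (hc : Measurable c) (hs : Measurable s) : Measurable fun a => radialCoord j (c a) (s a) := by
  fin_cases j
  · exact hc
  · exact hs

theorem measurable_angularCoord (j : Fin 2) {α : Type*} [MeasurableSpace α] {c s : α → ℝ}
    (hc : Measurable c) (hs : Measurable s) : Measurable fun a => angularCoord j (c a) (s a) := by
  fin_cases j
  · exact hs.neg
  · exact hc

theorem measurable_rotR {α : Type*} [MeasurableSpace α] {t : α → ℝ} {y : α → Space}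
    (ht : Measurable t) (hy : Measurable y) : Measurable fun a => rotR (t a) (y a) := by
  simp only [← rotL_cos_sin]
  exact (Real.measurable_cos.comp ht).rotL (Real.measurable_sin.comp ht) hy

theorem measurable_genR {α : Type*} [MeasurableSpace α] {y : α → Space}
    (hy : Measurable y) : Measurable fun a => genR (y a) := genRL.measurable.comp hy

theorem measurable_angularFlux (hd : Measurable d) (hφ : ContDiff ℝ 1 φ) (j : Fin 2) :
    Measurable (angularFlux d φ j) := by
  have h1 : Measurable fun p : ℝ × ℝ => angularCoord j (Real.cos p.2) (Real.sin p.2) :=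
    measurable_angularCoord j (by fun_prop) (by fun_prop)
  have h2 : Measurable fun p : ℝ × ℝ => radialCoord j (Real.cos p.2) (Real.sin p.2) :=
    measurable_radialCoord j (by fun_prop) (by fun_prop)
  have h3 : Measurable fun p : ℝ × ℝ => φ (polarPoint p) :=
    (hφ.continuous.comp continuous_polarPoint).measurable
  have h4 := (continuous_angularDeriv hφ).measurable
  have h5 : Measurable fun p : ℝ × ℝ => rotR p.2 (d p.1) :=
    measurable_rotR measurable_snd (hd.comp measurable_fst)
  have h6 : Measurable fun p : ℝ × ℝ => rotR p.2 (genR (d p.1)) :=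
    measurable_rotR measurable_snd (measurable_genR (hd.comp measurable_fst))
  exact ((h1.mul h3).smul h6).add (((h2.neg.mul h3).add (h1.mul h4)).smul h5)

theorem integrable_angularFlux (hd : Measurable d) (hB : ∀ r, 0 < r → ‖d r‖ ≤ B)
    (hφ : ContDiff ℝ 1 φ) (hc : HasCompactSupport φ) (j : Fin 2) :
    Integrable (angularFlux d φ j) polarMeasure := by
  obtain ⟨R, C, hR, hC, hφC, hDC, hz⟩ := exists_test_bound hφ hc
  have hs : Function.support (angularFlux d φ j) ⊆ Iic R ×ˢ univ := by
    intro p hp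
    refine ⟨?_, mem_univ _⟩
    by_contra h
    apply hp
    obtain ⟨h1, h2⟩ := hz p.1 p.2 (not_le.1 h)
    simp [angularFlux, h1, h2]
  rw [← integrableOn_iff_integrable_of_support_subset hs]
  refine Measure.integrableOn_of_bounded (M := C * (‖genRL‖ * B) + (C + C) * B) ?_
    (measurable_angularFlux hd hφ j).aestronglyMeasurable (ae_restrict_of_ae ?_)
  · rw [polarMeasure, Measure.prod_prod, Measure.restrict_apply measurableSet_Iic,
      Measure.restrict_apply_univ, Iic_inter_Ioi, Real.volume_Ioc, Real.volume_Ioo]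
    exact ENNReal.mul_ne_top ENNReal.ofReal_ne_top ENNReal.ofReal_ne_top
  · filter_upwards [ae_polarMeasure_pos] with p hp
    have hB0 : 0 ≤ B := (norm_nonneg _).trans (hB 1 one_pos)
    have a1 := abs_radialCoord_le j p.2
    have a2 := abs_angularCoord_le j p.2
    have a3 := hφC (polarPoint p)
    have a4 : |angularDeriv φ p| ≤ C := hDC p.1 p.2 hp
    have a5 := hB p.1 hp
    have a6 : ‖genR (d p.1)‖ ≤ ‖genRL‖ * B := (genRL.le_opNorm (d p.1)).trans (by gcongr)
    rw [angularFlux]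
    refine (norm_add_le _ _).trans ?_
    rw [norm_smul, norm_smul, norm_rotR, norm_rotR, Real.norm_eq_abs, Real.norm_eq_abs, abs_mul]
    have b1 : |angularCoord j (Real.cos p.2) (Real.sin p.2)| * |φ (polarPoint p)| ≤ 1 * C := by
      gcongr
    have b2 : |-radialCoord j (Real.cos p.2) (Real.sin p.2) * φ (polarPoint p) +
        angularCoord j (Real.cos p.2) (Real.sin p.2) * angularDeriv φ p| ≤ 1 * C + 1 * C := by
      refine (abs_add_le _ _).trans ?_
      rw [abs_mul, abs_mul, abs_neg]
      gcongr
    rw [one_mul] at b1 b2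
    gcongr

theorem integral_angularFlux (d : ℝ → Space) (hφ : ContDiff ℝ 1 φ) (j : Fin 2) (r : ℝ) :
    ∫ θ in Ioo (-Real.pi) Real.pi, angularFlux d φ j (r, θ) = 0 := by
  have hd : ∀ θ, HasDerivAt (fun t => (angularCoord j (Real.cos t) (Real.sin t) *
      φ (polarPoint (r, t))) • rotR t (d r)) (angularFlux d φ j (r, θ)) θ := fun θ => by
    simp only [angularFlux]
    exact ((hasDerivAt_angularCoord j θ).mul (hasDerivAt_angular hφ r θ)).smul (hasDerivAt_rotR θ (d r))
  have c1 : ∀ y, Continuous fun θ => rotR θ y := fun y =>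
    continuous_iff_continuousAt.2 fun θ => (hasDerivAt_rotR θ y).continuousAt
  have c2 : Continuous fun θ => angularCoord j (Real.cos θ) (Real.sin θ) :=
    continuous_iff_continuousAt.2 fun θ => (hasDerivAt_angularCoord j θ).continuousAt
  have c3 : Continuous fun θ => radialCoord j (Real.cos θ) (Real.sin θ) :=
    continuous_iff_continuousAt.2 fun θ => (hasDerivAt_radialCoord j θ).continuousAt
  have c4 : Continuous fun θ => φ (polarPoint (r, θ)) :=
    continuous_iff_continuousAt.2 fun θ => (hasDerivAt_angular hφ r θ).continuousAt
  have c5 : Continuous fun θ => angularDeriv φ (r, θ) :=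
    (continuous_angularDeriv hφ).comp (by fun_prop)
  have hc : Continuous fun θ => angularFlux d φ j (r, θ) := by
    simp only [angularFlux]
    exact ((c2.mul c4).smul (c1 _)).add (((c3.neg.mul c4).add (c2.mul c5)).smul (c1 _))
  have hp : -Real.pi ≤ Real.pi := by linarith [Real.pi_pos]
  rw [← integral_Ioc_eq_integral_Ioo, ← intervalIntegral.integral_of_le hp,
    intervalIntegral.integral_eq_sub_of_hasDerivAt (fun θ _ => hd θ)
      (hc.intervalIntegrable _ _)]
  have e1 : rotR (-Real.pi) (d r) = rotR Real.pi (d r) := by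
    simp only [rotR, Real.cos_neg, Real.sin_neg, Real.sin_pi, neg_zero]
  have e2 : polarPoint (r, -Real.pi) = polarPoint (r, Real.pi) := by
    simp only [polarPoint, Real.cos_neg, Real.sin_neg, Real.sin_pi, neg_zero]
  rw [e1, e2, Real.cos_neg, Real.sin_neg, Real.sin_pi, neg_zero, sub_self]

theorem hasACDeriv_radialFlux (h : HasACDeriv d g) (hφ : ContDiff ℝ 1 φ) (j : Fin 2) (θ : ℝ) :
    HasACDeriv (fun r => (radialCoord j (Real.cos θ) (Real.sin θ) *
      (r * φ (polarPoint (r, θ)))) • rotR θ (d r)) (fun r => radialFlux d g φ j (r, θ)) := by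
  have c1 : Continuous fun r => radialDeriv φ (r, θ) :=
    (continuous_radialDeriv hφ).comp (by fun_prop)
  have c2 : Continuous fun r => φ (polarPoint (r, θ)) :=
    (hφ.continuous.comp continuous_polarPoint).comp (by fun_prop)
  have h1 : HasACDeriv (fun r => radialCoord j (Real.cos θ) (Real.sin θ) *
      (r * φ (polarPoint (r, θ)))) (fun r => radialCoord j (Real.cos θ) (Real.sin θ) *
      (φ (polarPoint (r, θ)) + r * radialDeriv φ (r, θ))) := by
    refine HasACDeriv.of_hasDerivAt (fun r _ => ?_)
      (continuous_const.mul (c2.add (continuous_id.mul c1))).continuousOn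
    refine (((hasDerivAt_id r).mul (hasDerivAt_radial hφ r θ)).const_mul _).congr_deriv ?_
    simp
  exact h1.smul (h.rotR θ)

theorem integral_radialFlux (h : HasACDeriv d g) (hB : ∀ r, 0 < r → ‖d r‖ ≤ B)
    (hφ : ContDiff ℝ 1 φ) (hc : HasCompactSupport φ) (j : Fin 2) (θ : ℝ)
    (hi : IntegrableOn (fun r => radialFlux d g φ j (r, θ)) (Ioi 0)) :
    ∫ r in Ioi 0, radialFlux d g φ j (r, θ) = 0 := by
  obtain ⟨R, C, hR, hC, hφC, -, hz⟩ := exists_test_bound hφ hc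
  refine (hasACDeriv_radialFlux h hφ j θ).integral_Ioi_eq_zero hi ?_ ?_
  · have hlim : Tendsto (fun r : ℝ => 1 * (r * C) * B) (𝓝[>] 0) (𝓝 0) := by
      have : Continuous fun r : ℝ => 1 * (r * C) * B := by fun_prop
      simpa using (this.tendsto 0).mono_left nhdsWithin_le_nhds
    refine squeeze_zero_norm' ?_ hlim
    filter_upwards [self_mem_nhdsWithin] with r hr
    have hr : (0:ℝ) < r := hr
    rw [norm_smul, norm_rotR, Real.norm_eq_abs, abs_mul, abs_mul, abs_of_pos hr]
    have a1 := abs_radialCoord_le j θ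
    have a2 := hφC (polarPoint (r, θ))
    have a3 := hB r hr
    gcongr
  · refine tendsto_const_nhds.congr' ?_
    filter_upwards [eventually_gt_atTop R] with r hr
    rw [(hz r θ hr).1, mul_zero, mul_zero, zero_smul]

/-- In polar coordinates the integrand of the weak formulation is a divergence. -/
theorem flux_eq (d g : ℝ → Space) (φ : Plane → ℝ) (j : Fin 2) {r : ℝ} (hr : 0 < r) (θ : ℝ) :
    r • (fderiv ℝ φ (polarPoint (r, θ)) (EuclideanSpace.single j 1) •
      equivMap d (polarPoint (r, θ)) + φ (polarPoint (r, θ)) •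
      equivGrad d g j (polarPoint (r, θ))) =
    radialFlux d g φ j (r, θ) + angularFlux d φ j (r, θ) := by
  rw [equivMap_polarPoint d hr, equivGrad_polarPoint d g j hr, rotR_smul, smul_add, smul_smul,
    fderiv_single_eq, radialFlux, angularFlux]
  match_scalars <;> (field_simp; try ring)

end WeakGradient

section WeakGradient

variable {d g : ℝ → Space} {B : ℝ}

theorem measurable_coord (i : Fin 2) : Measurable fun x : Plane => x i / ‖x‖ :=
  (EuclideanSpace.proj (𝕜 := ℝ) i : Plane →L[ℝ] ℝ).measurable.div measurable_norm

theorem measurable_equivMap (hd : Measurable d) : Measurable (equivMap d) :=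
  (measurable_coord 0).rotL (measurable_coord 1) (hd.comp measurable_norm)

theorem measurable_equivGrad (hd : Measurable d) (hg : Measurable g) (j : Fin 2) :
    Measurable (equivGrad d g j) :=
  ((measurable_radialCoord j (measurable_coord 0) (measurable_coord 1)).smul
    ((measurable_coord 0).rotL (measurable_coord 1) (hg.comp measurable_norm))).add
  ((measurable_angularCoord j (measurable_coord 0) (measurable_coord 1)).smul
    ((measurable_coord 0).rotL (measurable_coord 1)
      (measurable_norm.inv.smul (measurable_genR (hd.comp measurable_norm)))))

theorem ae_ne_zero : ∀ᵐ x : Plane, x ≠ 0 := by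
  simp [ae_iff, measure_singleton]

theorem sum_norm_sq_combination (c s : ℝ) (h : c ^ 2 + s ^ 2 = 1) (a b : Space) :
    ∑ j, ‖radialCoord j c s • a + angularCoord j c s • b‖ ^ 2 = ‖a‖ ^ 2 + ‖b‖ ^ 2 := by
  rw [Fin.sum_univ_two]
  simp only [radialCoord, angularCoord, Matrix.cons_val_zero, Matrix.cons_val_one,
    Matrix.cons_val_fin_one, norm_add_sq_real, norm_smul, inner_smul_left, inner_smul_right,
    mul_pow, Real.norm_eq_abs, sq_abs, neg_sq]
  simp only [conj_trivial]
  linear_combination (‖a‖ ^ 2 + ‖b‖ ^ 2) * h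

theorem sum_norm_sq_equivGrad (d g : ℝ → Space) {x : Plane} (hx : x ≠ 0) :
    ∑ j, ‖equivGrad d g j x‖ ^ 2 = ‖g ‖x‖‖ ^ 2 + ‖‖x‖⁻¹ • genR (d ‖x‖)‖ ^ 2 := by
  have h : (x 0 / ‖x‖) ^ 2 + (x 1 / ‖x‖) ^ 2 = 1 := by
    have := norm_sq_plane x
    have h0 : ‖x‖ ≠ 0 := norm_ne_zero_iff.2 hx
    field_simp
    exact this.symm
  simp only [equivGrad]
  rw [sum_norm_sq_combination _ _ h, norm_rotL h, norm_rotL h]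

theorem lintegral_sq_radial {F : Type*} [NormedAddCommGroup F] {f : ℝ → F}
    (hf : MemLp f 2 radialMeasure) :
    ∫⁻ r, ENNReal.ofReal (‖f r‖ ^ 2) ∂radialMeasure = ENNReal.ofReal (radNorm f ^ 2) := by
  have hi : Integrable (fun r => ‖f r‖ ^ 2) radialMeasure :=
    (memLp_two_iff_integrable_sq_norm hf.1).1 hf
  rw [← ofReal_integral_eq_lintegral_ofReal hi (Eventually.of_forall fun r => sq_nonneg _),
    integral_radial, radNorm_sq hf]
  rfl

theorem lintegral_equivGrad (hd : Measurable d) (hg : Measurable g)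
    (hg2 : MemLp g 2 radialMeasure) (hd2 : MemLp (fun r => r⁻¹ • genR (d r)) 2 radialMeasure) :
    ∫⁻ x, ∑ j, ‖equivGrad d g j x‖ₑ ^ 2 = ENNReal.ofReal
      (2 * Real.pi * (radNorm g ^ 2 + radNorm (fun r => r⁻¹ • genR (d r)) ^ 2)) := by
  have hm1 : Measurable fun r => ENNReal.ofReal (‖g r‖ ^ 2) :=
    ENNReal.measurable_ofReal.comp (hg.norm.pow_const 2)
  have hm2 : Measurable fun r => ENNReal.ofReal (‖r⁻¹ • genR (d r)‖ ^ 2) :=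
    ENNReal.measurable_ofReal.comp
      ((measurable_inv.smul (measurable_genR hd)).norm.pow_const 2)
  have e : ∫⁻ x, ∑ j, ‖equivGrad d g j x‖ₑ ^ 2 = ∫⁻ x : Plane,
      (fun r => ENNReal.ofReal (‖g r‖ ^ 2) + ENNReal.ofReal (‖r⁻¹ • genR (d r)‖ ^ 2)) ‖x‖ := by
    refine lintegral_congr_ae ?_
    filter_upwards [ae_ne_zero] with x hx
    rw [← ENNReal.ofReal_add (by positivity) (by positivity), ← sum_norm_sq_equivGrad d g hx,
      ENNReal.ofReal_sum_of_nonneg fun j _ => by positivity]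
    refine Finset.sum_congr rfl fun j _ => ?_
    rw [ENNReal.ofReal_pow (norm_nonneg _), ofReal_norm]
  have hm3 : Measurable fun r =>
      ENNReal.ofReal (‖g r‖ ^ 2) + ENNReal.ofReal (‖r⁻¹ • genR (d r)‖ ^ 2) := hm1.add hm2
  rw [e, lintegral_norm_plane hm3, lintegral_add_left hm1, lintegral_sq_radial hg2,
    lintegral_sq_radial hd2, ← ENNReal.ofReal_add (by positivity) (by positivity),
    ← ENNReal.ofReal_mul (by positivity)]

theorem memLp_equivGrad (hd : Measurable d) (hg : Measurable g)
    (hg2 : MemLp g 2 radialMeasure) (hd2 : MemLp (fun r => r⁻¹ • genR (d r)) 2 radialMeasure)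
    (j : Fin 2) : MemLp (equivGrad d g j) 2 volume := by
  refine ⟨(measurable_equivGrad hd hg j).aestronglyMeasurable, ?_⟩
  rw [eLpNorm_lt_top_iff_lintegral_rpow_enorm_lt_top (by simp) (by simp)]
  simp only [ENNReal.toReal_ofNat, ENNReal.rpow_ofNat]
  refine (lintegral_mono fun x => ?_).trans_lt
    ((lintegral_equivGrad hd hg hg2 hd2).trans_lt ENNReal.ofReal_lt_top)
  exact Finset.single_le_sum (f := fun j => ‖equivGrad d g j x‖ₑ ^ 2) (fun _ _ => zero_le)
    (Finset.mem_univ j)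

theorem locallyIntegrable_equivMap (hd : Measurable d) (hB : ∀ r, 0 < r → ‖d r‖ ≤ B) :
    LocallyIntegrable (equivMap d) volume := by
  refine (memLp_top_of_bound (measurable_equivMap hd).aestronglyMeasurable B ?_).locallyIntegrable
    le_top
  filter_upwards [ae_ne_zero] with x hx
  obtain ⟨p, hp, rfl⟩ := exists_polarPoint hx
  rw [equivMap_polarPoint d hp p.2, norm_rotR]
  exact hB p.1 hp

theorem isWeakGradient_equivMap (h : HasACDeriv d g) (hd : Measurable d) (hg : Measurable g)
    (hB : ∀ r, 0 < r → ‖d r‖ ≤ B) (hg2 : MemLp g 2 radialMeasure)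
    (hd2 : MemLp (fun r => r⁻¹ • genR (d r)) 2 radialMeasure) :
    IsWeakGradient (equivMap d) (equivGrad d g) := by
  have hl := locallyIntegrable_equivMap hd hB
  have hl' := fun j => (memLp_equivGrad hd hg hg2 hd2 j).locallyIntegrable one_le_two
  refine ⟨hl, hl', fun j φ hφ hc => ?_⟩
  have hφ1 : ContDiff ℝ 1 φ := hφ.of_le (by exact_mod_cast le_top)
  have cD : Continuous fun x => fderiv ℝ φ x (EuclideanSpace.single j 1) :=
    (hφ1.continuous_fderiv (by decide)).clm_apply continuous_const
  have i1 := hl.integrable_smul_left_of_hasCompactSupport cD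
    (hc.fderiv_apply (𝕜 := ℝ) (EuclideanSpace.single j 1))
  have i2 := (hl' j).integrable_smul_left_of_hasCompactSupport hφ1.continuous hc
  rw [eq_neg_iff_add_eq_zero, ← integral_add i1 i2, integral_polar]
  have hT := integrable_polar (i1.add i2)
    ((cD.measurable.smul (measurable_equivMap hd)).add
      (hφ1.continuous.measurable.smul (measurable_equivGrad hd hg j)))
  have hV := integrable_angularFlux hd hB hφ1 hc j
  have hTe : (fun p : ℝ × ℝ => p.1 • (fderiv ℝ φ (polarPoint p) (EuclideanSpace.single j 1) •
      equivMap d (polarPoint p) + φ (polarPoint p) • equivGrad d g j (polarPoint p)))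
      =ᵐ[polarMeasure] fun p => radialFlux d g φ j p + angularFlux d φ j p := by
    filter_upwards [ae_polarMeasure_pos] with p hp using flux_eq d g φ j hp p.2
  -- the radial flux alone need not be bounded; it is integrable as a difference
  have hU : Integrable (radialFlux d g φ j) polarMeasure := by
    refine (hT.sub hV).congr ?_
    filter_upwards [hTe] with p hp
    simp only [Pi.sub_apply, Pi.add_apply]
    exact sub_eq_of_eq_add hp
  have hV0 : ∫ p, angularFlux d φ j p ∂polarMeasure = 0 := by
    rw [polarMeasure] at hV ⊢
    rw [integral_prod _ hV]
    simp only [integral_angularFlux d hφ1 j, integral_zero]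
  have hU0 : ∫ p, radialFlux d g φ j p ∂polarMeasure = 0 := by
    rw [polarMeasure] at hU ⊢
    rw [integral_prod_symm _ hU]
    refine integral_eq_zero_of_ae ?_
    filter_upwards [hU.prod_left_ae] with θ hθ
    exact integral_radialFlux h hB hφ1 hc j θ hθ
  rw [integral_congr_ae hTe, integral_add hU hV, hU0, hV0, add_zero]

theorem IsWeakGradient.congr {f f' : Plane → Space} {G : Fin 2 → Plane → Space}
    (h : IsWeakGradient f G) (hf : f =ᵐ[volume] f') : IsWeakGradient f' G := by
  refine ⟨h.locallyIntegrable.congr hf, h.locallyIntegrable_grad, fun j φ hφ hc => ?_⟩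
  rw [← h.integral_eq j φ hφ hc]
  refine integral_congr_ae ?_
  filter_upwards [hf] with x hx
  rw [hx]

theorem IsWeakGradient.ae_eq {f : Plane → Space} {G G' : Fin 2 → Plane → Space}
    (h : IsWeakGradient f G) (h' : IsWeakGradient f G') (j : Fin 2) : G j =ᵐ[volume] G' j :=
  ae_eq_of_integral_contDiff_smul_eq (h.locallyIntegrable_grad j) (h'.locallyIntegrable_grad j)
    fun φ hφ hc => neg_injective ((h.integral_eq j φ hφ hc).symm.trans (h'.integral_eq j φ hφ hc))

theorem IsWeakGradient.dirichlet_eq {f : Plane → Space} {G : Fin 2 → Plane → Space}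
    (h : IsWeakGradient f G) : dirichlet f = ∫⁻ x, ∑ j, ‖G j x‖ₑ ^ 2 := by
  refine le_antisymm (iInf₂_le G h) (le_iInf₂ fun G' h' => le_of_eq ?_)
  refine lintegral_congr_ae ?_
  filter_upwards [ae_all_iff.2 fun j => h.ae_eq h' j] with x hx
  simp only [hx]

/-- The Dirichlet integral of an equivariant map in terms of its profile. -/
theorem dirichlet_of_equivariant (h : HasACDeriv d g) (hB : ∀ r, 0 < r → ‖d r‖ ≤ B)
    (hg2 : MemLp g 2 radialMeasure) (hd2 : MemLp (fun r => r⁻¹ • genR (d r)) 2 radialMeasure)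
    {f : Plane → Space} (hf : ∀ᵐ x, ∀ r θ : ℝ, 0 < r →
      x = !₂[r * Real.cos θ, r * Real.sin θ] → f x = rotR θ (d r)) :
    dirichlet f = ENNReal.ofReal
      (2 * Real.pi * (radNorm g ^ 2 + radNorm (fun r => r⁻¹ • genR (d r)) ^ 2)) := by
  -- measurable representatives of the profile and of its derivative
  classical
  let d' : ℝ → Space := (Ioi (0:ℝ)).piecewise d 0
  have hdd : ∀ r, 0 < r → d r = d' r := fun r hr => (piecewise_eq_of_mem _ _ _ hr).symm
  have hm : Measurable d' :=
    h.continuousOn.measurable_piecewise continuousOn_const measurableSet_Ioi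
  have h' : HasACDeriv d' g := h.congr_fun hdd
  have hgae : ∀ᵐ r ∂(volume.restrict (Ioi (0 : ℝ))), g r = deriv d' r := by
    filter_upwards [h'.ae] with r hr using hr.deriv.symm
  have hgr : g =ᵐ[radialMeasure] deriv d' := ae_radialMeasure_iff.2 hgae
  have hdr : (fun r => r⁻¹ • genR (d r)) =ᵐ[radialMeasure] fun r => r⁻¹ • genR (d' r) := by
    filter_upwards [ae_pos] with r hr
    rw [hdd r hr]
  have hB' : ∀ r, 0 < r → ‖d' r‖ ≤ B := fun r hr => hdd r hr ▸ hB r hr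
  have hg2' := (memLp_congr_ae hgr).1 hg2
  have hd2' := (memLp_congr_ae hdr).1 hd2
  have hw := isWeakGradient_equivMap (h'.congr_ae hgae) hm (measurable_deriv d') hB' hg2' hd2'
  have hfe : equivMap d' =ᵐ[volume] f := by
    filter_upwards [hf, ae_ne_zero] with x hx h0
    obtain ⟨p, hp, rfl⟩ := exists_polarPoint h0
    rw [equivMap_polarPoint d' hp p.2, hx p.1 p.2 hp rfl, hdd p.1 hp]
  rw [(hw.congr hfe).dirichlet_eq, lintegral_equivGrad hm (measurable_deriv d') hg2' hd2',
    radNorm, radNorm, radNorm, radNorm, eLpNorm_congr_ae hgr, eLpNorm_congr_ae hdr]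

end WeakGradient

/-! ### The correspondence between fields and maps -/

theorem rotR_sub (θ : ℝ) (x y : Space) : rotR θ (x - y) = rotR θ x - rotR θ y := by
  simp only [← rotL_cos_sin, rotL, map_sub]
  module

/-- The profile depends on `ψ` only. -/
theorem IsRiccati.profile_eq {ψ z z' : ℝ → ℂ} (hz : IsRiccati ψ z) (hz' : IsRiccati ψ z')
    (hψ : MemLp ψ 2 radialMeasure) (h : radNorm ψ < 2 * √2) {r : ℝ} (hr : 0 < r) :
    profile ψ z r = profile ψ z' r := by
  have hK := hz.norm_le_slopeBound hψ le_rfl h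
  have hK' := hz'.norm_le_slopeBound hψ le_rfl h
  have he : ∀ s, 0 < s → z s = z' s := fun s hs => by
    have h1 := (hz.stability hz' hψ hψ hK hK').1 s hs
    have h2 : radNorm (fun r => ψ r - ψ r) = 0 := by simp [radNorm]
    rw [h2, mul_zero] at h1
    exact sub_eq_zero.1 (norm_le_zero_iff.1 h1)
  have hN : gaugeFactor ψ z r = gaugeFactor ψ z' r := by
    rw [gaugeFactor, gaugeFactor]
    congr 2
    refine setIntegral_congr_fun measurableSet_Ioi fun s hs => ?_
    simp only [connCoeff, he s (hr.trans hs)]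
  rw [profile, profile, hN, he r hr]

theorem Represents.exists_isRiccati {ψ : RadialL2} {u : Plane → Sphere2} (hu : Represents ψ u)
    (h : ‖ψ‖ < 2 * √2) : ∃ z, IsRiccati ψ z ∧ IsEquivariant u (profile ψ z) := by
  obtain ⟨ub, v, w, he, hF, hψ⟩ := hu
  obtain ⟨z, hz, hz'⟩ := hF.exists_isRiccati (Lp.memLp ψ) (by rwa [radNorm_coe])
    (ae_radialMeasure_iff.1 hψ)
  refine ⟨z, hz, ?_⟩
  filter_upwards [he] with x hx r θ hr hxr
  rw [hx r θ hr hxr, hz' r hr]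

theorem IsEquivariant.ae_eq {u u' : Plane → Sphere2} {d d' : ℝ → Space} (h : IsEquivariant u d)
    (h' : IsEquivariant u' d') (hd : ∀ r, 0 < r → d r = d' r) : u =ᵐ[volume] u' := by
  filter_upwards [h, h', ae_ne_zero] with x hx hx' h0
  obtain ⟨p, hp, hxp⟩ := exists_polarPoint h0
  exact Subtype.ext (by rw [hx p.1 p.2 hp hxp, hx' p.1 p.2 hp hxp, hd p.1 hp])

theorem exists_isEquivariant {d : ℝ → Space} (hd : ∀ r, 0 < r → ‖d r‖ = 1) :
    ∃ u : Plane → Sphere2, IsEquivariant u d := by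
  have : ∀ x : Plane, ∃ y : Sphere2, x ≠ 0 → (y : Space) = equivMap d x := by
    intro x
    by_cases hx : x = 0
    · exact ⟨⟨d 1, by simp [hd 1 one_pos]⟩, fun h => absurd hx h⟩
    · obtain ⟨p, hp, rfl⟩ := exists_polarPoint hx
      refine ⟨⟨equivMap d (polarPoint p), ?_⟩, fun _ => rfl⟩
      rw [mem_sphere_zero_iff_norm, equivMap_polarPoint d hp p.2, norm_rotR, hd p.1 hp]
  choose u hu using this
  refine ⟨u, Eventually.of_forall fun x r θ hr hx => ?_⟩
  have hx : x = polarPoint (r, θ) := hx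
  subst hx
  have h0 : polarPoint (r, θ) ≠ 0 := norm_pos_iff.1 (by rw [norm_polarPoint hr]; exact hr)
  rw [hu _ h0, equivMap_polarPoint d hr]

theorem energy_of_isEquivariant {ψ : RadialL2} {z : ℝ → ℂ} (hz : IsRiccati ψ z)
    (h : ‖ψ‖ < 2 * √2) {u : Plane → Sphere2} (hu : IsEquivariant u (profile ψ z)) :
    energy u = ENNReal.ofReal (Real.pi * ‖ψ‖ ^ 2) := by
  have hψ := Lp.memLp ψ
  have hK := hz.norm_le_slopeBound hψ le_rfl (by rwa [radNorm_coe])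
  have hF := (hz.isNormalizedCoulombFrame hψ hK).1
  rw [energy, dirichlet_of_equivariant (hz.hasACDeriv_profile hψ hK)
    (fun r hr => (hF.norm_u r hr).le) (memLp_profileDeriv hz hψ hK) (memLp_genR_profile hz hψ hK)
    hu]
  have e := energy_profile_eq hz hψ hK
  rw [radNorm_coe] at e
  refine Eq.trans (congrArg (fun t => 2⁻¹ * ENNReal.ofReal (2 * Real.pi * t)) e) ?_
  rw [mul_assoc, ENNReal.ofReal_mul zero_le_two, ENNReal.ofReal_ofNat, ← mul_assoc,
    ENNReal.inv_mul_cancel two_ne_zero ENNReal.ofNat_ne_top, one_mul]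

theorem homogNorm_sub_le {ψ ψ' : RadialL2} {z z' : ℝ → ℂ} (hz : IsRiccati ψ z)
    (hz' : IsRiccati ψ' z') (h : ‖ψ‖ < 2 * √2) (h' : ‖ψ'‖ < 2 * √2) {u u' : Plane → Sphere2}
    (hu : IsEquivariant u (profile ψ z)) (hu' : IsEquivariant u' (profile ψ' z')) {C : ℝ}
    (hC : 0 ≤ C)
    (h1 : radNorm (fun r => profileDeriv ψ z r - profileDeriv ψ' z' r) ≤ C * ‖ψ - ψ'‖)
    (h2 : radNorm (fun r => r⁻¹ • genR (profile ψ z r - profile ψ' z' r)) ≤ C * ‖ψ - ψ'‖) :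
    homogNorm (fun x => (u x : Space) - (u' x : Space)) ≤
      ENNReal.ofReal (√(4 * Real.pi) * C * ‖ψ - ψ'‖) := by
  have hψ := Lp.memLp ψ
  have hψ' := Lp.memLp ψ'
  have hK := hz.norm_le_slopeBound hψ le_rfl (by rwa [radNorm_coe])
  have hK' := hz'.norm_le_slopeBound hψ' le_rfl (by rwa [radNorm_coe])
  have hF := (hz.isNormalizedCoulombFrame hψ hK).1
  have hF' := (hz'.isNormalizedCoulombFrame hψ' hK').1
  have hm : MemLp (fun r => r⁻¹ • genR (profile ψ z r - profile ψ' z' r)) 2 radialMeasure := by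
    refine ((memLp_genR_profile hz hψ hK).sub (memLp_genR_profile hz' hψ' hK')).ae_eq
      (Eventually.of_forall fun r => ?_)
    simp only [Pi.sub_apply, ← genRL_apply, map_sub, smul_sub]
  have hD := dirichlet_of_equivariant
    ((hz.hasACDeriv_profile hψ hK).sub (hz'.hasACDeriv_profile hψ' hK'))
    (B := 1 + 1) (fun r hr => (norm_sub_le _ _).trans
      (add_le_add (hF.norm_u r hr).le (hF'.norm_u r hr).le))
    ((memLp_profileDeriv hz hψ hK).sub (memLp_profileDeriv hz' hψ' hK')) hm
    (f := fun x => (u x : Space) - (u' x : Space)) (by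
      filter_upwards [hu, hu'] with x hx hx' r θ hr hxr
      rw [hx r θ hr hxr, hx' r θ hr hxr, rotR_sub])
  have hpi := Real.pi_pos.le
  rw [homogNorm, hD, ENNReal.ofReal_rpow_of_nonneg (by positivity) (by norm_num),
    ← Real.sqrt_eq_rpow]
  refine ENNReal.ofReal_le_ofReal (Real.sqrt_le_iff.2 ⟨by positivity, ?_⟩)
  have a1 := pow_le_pow_left₀ (radNorm_nonneg _) h1 2
  have a2 := pow_le_pow_left₀ (radNorm_nonneg _) h2 2
  refine (mul_le_mul_of_nonneg_left (add_le_add a1 a2) (by positivity)).trans (le_of_eq ?_)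
  rw [mul_pow, mul_pow, mul_pow, Real.sq_sqrt (by positivity)]
  ring

end EquivariantMap

end

theorem proposition2p2 :
    (∀ ψ : RadialL2, ‖ψ‖ < 2 * √2 →
      ∃ u : Plane → Sphere2, Represents ψ u ∧
        energy u = ENNReal.ofReal (Real.pi * ‖ψ‖ ^ 2) ∧
        ∀ u' : Plane → Sphere2, Represents ψ u' → u' =ᵐ[volume] u) ∧
    (∀ M : ℝ, M < 2 * √2 → ∃ C : ℝ, 0 ≤ C ∧
      ∀ (ψ ψ' : RadialL2) (u u' : Plane → Sphere2), ‖ψ‖ ≤ M → ‖ψ'‖ ≤ M →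
        Represents ψ u → Represents ψ' u' →
        homogNorm (fun x => (u x : Space) - (u' x : Space)) ≤ ENNReal.ofReal (C * ‖ψ - ψ'‖)) := by
  constructor
  · intro ψ h
    have hψ := Lp.memLp ψ
    have hn : radNorm ψ < 2 * √2 := by rwa [radNorm_coe]
    obtain ⟨z, hz⟩ := exists_isRiccati hψ hn
    obtain ⟨hF, hrep⟩ := hz.isNormalizedCoulombFrame hψ (hz.norm_le_slopeBound hψ le_rfl hn)
    obtain ⟨u, hu⟩ := exists_isEquivariant hF.norm_u
    refine ⟨u, ⟨_, _, _, hu, hF, ae_radialMeasure_iff.2 hrep⟩, energy_of_isEquivariant hz h hu,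
      fun u' hu' => ?_⟩
    obtain ⟨z', hz', he⟩ := hu'.exists_isRiccati h
    exact he.ae_eq hu fun r hr => hz'.profile_eq hz hψ hn hr
  · intro M hM
    obtain ⟨C, hC, H⟩ := exists_profile_lipschitz hM
    refine ⟨√(4 * Real.pi) * C, by positivity, fun ψ ψ' u u' hψM hψM' hu hu' => ?_⟩
    obtain ⟨z, hz, he⟩ := hu.exists_isRiccati (hψM.trans_lt hM)
    obtain ⟨z', hz', he'⟩ := hu'.exists_isRiccati (hψM'.trans_lt hM)
    obtain ⟨h1, h2⟩ := H ψ ψ' z z' (Lp.memLp ψ) (Lp.memLp ψ') (by rwa [radNorm_coe])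
      (by rwa [radNorm_coe]) hz hz'
    rw [radNorm_sub_coe] at h1 h2
    exact homogNorm_sub_le hz hz' (hψM.trans_lt hM) (hψM'.trans_lt hM) he he' hC h1 h2
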